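/- Let $\kappa\in\mathbb N$, let $A_1,\dots,A_\kappa$ be invertible linear maps of $\mathbb R^2$ with $\|A_i\|<1$, let $c_1,\dots,c_\kappa\in\mathbb R^2$, put $\varphi_i(x)=A_ix+c_i$, and let $E$ be the self-affine set of the system, i.e. the unique non-empty compact set with $E=\bigcup_{i=1}^\kappa\varphi_i(E)$. For a finite word $\mathtt i=(i_1,\dots,i_n)$ write $|\mathtt i|=n$, $A_{\mathtt i}=A_{i_1}\cdots A_{i_n}$, $\varphi_{\mathtt i}=\varphi_{i_1}\circ\cdots\circ\varphi_{i_n}$, and let $\alpha_1(\mathtt i)\ge\alpha_2(\mathtt i)$ be the singular values of $A_{\mathtt i}$. If $\alpha_1(\mathtt i)>\alpha_2(\mathtt i)$, let $\vartheta_1(\mathtt i)\in\mathbb P^1$ be the line through the origin that is the image under $A_{\mathtt i}$ of the eigenline of $A_{\mathtt i}^TA_{\mathtt i}$ for the eigenvalue $\alpha_1(\mathtt i)^2$. Let $\Sigma=\{1,\dots,\kappa\}^{\mathbb N}$, and for $\mathtt i\in\Sigma$ let $\mathtt i|_n$ be its prefix of length $n$, let $\pi\mathtt i$ be the point given by $\{\pi\mathtt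 i\}=\bigcap_n\varphi_{\mathtt i|_n}(E)$, and let $\vartheta_1(\mathtt i)=\lim_{n\to\infty}\vartheta_1(\mathtt i|_n)$ in $\mathbb P^1$ with the angle metric (the limit exists under assumption 1 below). For $e\in S^1$ let $\langle e\rangle$ be the line spanned by $e$, let $\mathrm{proj}^e$ be the orthogonal projection along $e$ (onto the line orthogonal to $e$), and let $$\mathrm{vis}^e(E)=\{x\in\mathbb R^2:\{x+te:t\ge0\}\cap E=\{x\}\}.$$ Assume: 1. (dominated splitting) there are $\tau>1$ and $n_0\in\mathbb N$ with $\alpha_1(\mathtt i)>\tau^{|\mathtt i|}\alpha_2(\mathtt i)$ for all finite words $\mathtt i$ with $|\mathtt i|\ge n_0$; 2. (projection condition) $\mathbb P^1\setminus\vartheta_1(\Sigma)\ne\emptyset$, and for every $e\in S^1$ with $\langle e\rangle\notin\vartheta_1(\Sigma)$ there is $n_0$ such that $\mathrm{proj}^e\varphi_{\mathtt i}(E)$ is a non-trivial interval for all words $\mathtt i$ with $|\mathtt i|\ge n_0$; 3. for every $e\in S^1$ the set $\{\pi\mathtt i:\mathtt i\in\Sigma,\ \vartheta_1(\mathtt i)=\langle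 e\rangle\}$ has Hausdorff dimension at most $1$. Then $\dim_H\mathrm{vis}^e(E)=1$ for every $e\in S^1$ such that $E$ is not contained in a line parallel to $e$. (In particular, if $E$ is not contained in a line, this holds for all $e\in S^1$.) -/

import Mathlib

noncomputable section

/-- The Euclidean plane `ℝ²`. -/
abbrev Plane : Type := EuclideanSpace ℝ (Fin 2)

/-! ### Singular values and orientations of linear maps of the plane

Orientations, i.e. points of the projective line `ℙ¹`, are one-dimensional subspaces of the plane;
the orientation `⟨e⟩` of a direction `e` is the subspace `ℝ ∙ e`. -/

/-- `α₁(A)`: the larger of the square roots of the eigenvalues of `Aᵀ A`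
(the longer semiaxis of `A (B(0,1))`). -/
def alpha1 (A : Plane →L[ℝ] Plane) : ℝ :=
  (A : Plane →ₗ[ℝ] Plane).singularValues 0

/-- `α₂(A)`: the smaller of the square roots of the eigenvalues of `Aᵀ A`
(the shorter semiaxis of `A (B(0,1))`). -/
def alpha2 (A : Plane →L[ℝ] Plane) : ℝ :=
  (A : Plane →ₗ[ℝ] Plane).singularValues 1

/-- `ϑ₁(A)`: the image under `A` of the eigenspace of `Aᵀ A` for the eigenvalue `α₁(A)²`.
When `A` is invertible and `α₁(A) ≠ α₂(A)` this eigenspace is spanned by one unit vector `η₁(A)`,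
and `ϑ₁(A)` is the line `⟨A η₁(A)⟩` spanned by the longer semiaxis of the ellipse `A (B(0,1))`. -/
def orientation1 (A : Plane →L[ℝ] Plane) : Submodule ℝ Plane :=
  (Module.End.eigenspace
    ((ContinuousLinearMap.adjoint A ∘L A : Plane →L[ℝ] Plane) : Module.End ℝ Plane)
    (alpha1 A ^ 2)).map (A : Plane →ₗ[ℝ] Plane)

/-- The angle, in `[0, π/2]`, between two lines through the origin: the smallest angle between
nonzero vectors of the two lines. This is the metric of the projective line. -/
def lineAngle (L M : Submodule ℝ Plane) : ℝ :=
  sInf {t : ℝ | ∃ u ∈ L, ∃ v ∈ M, u ≠ 0 ∧ v ≠ 0 ∧ t = InnerProductGeometry.angle u v}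

/-! ### Affine iterated function systems -/

/-- A finite system of maps `φ_i x = A_i x + c_i` of the plane, with `A_i` an invertible linear
contraction. -/
structure AffineIFS (κ : ℕ) where
  /-- the linear parts `A_i` -/
  lin : Fin κ → (Plane →L[ℝ] Plane)
  /-- the translation vectors `c_i` -/
  trans : Fin κ → Plane
  lin_bijective : ∀ i, Function.Bijective (lin i)
  lin_contractive : ∀ i, ‖lin i‖ < 1

namespace AffineIFS

variable {κ : ℕ} (Φ : AffineIFS κ)

/-- The map `φ_i x = A_i x + c_i`. -/
def map (i : Fin κ) (x : Plane) : Plane := Φ.lin i x + Φ.trans i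

/-- `A_w = A_{i₁} ⋯ A_{iₙ}` for a finite word `w = (i₁, …, iₙ)`. -/
def wordLin (w : List (Fin κ)) : Plane →L[ℝ] Plane := (w.map Φ.lin).prod

/-- `φ_w = φ_{i₁} ∘ ⋯ ∘ φ_{iₙ}` for a finite word `w = (i₁, …, iₙ)`. -/
def wordMap (w : List (Fin κ)) : Plane → Plane := (w.map Φ.map).foldr (fun f g => f ∘ g) id

/-- `E` is the self-affine set of the system: the (unique) nonempty compact set with
`E = ⋃ i, φ_i(E)`. -/
def IsSelfAffineSet (E : Set Plane) : Prop :=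
  E.Nonempty ∧ IsCompact E ∧ E = ⋃ i, Φ.map i '' E

/-- The prefix `i|_n` of length `n` of an infinite word `i`. -/
def wordPrefix (i : ℕ → Fin κ) (n : ℕ) : List (Fin κ) := List.ofFn (fun k : Fin n => i k)

/-- Dominated splitting: there are `τ > 1` and `n₀` with `α₁(w) > τ ^ |w| * α₂(w)` for all finite
words `w` of length at least `n₀`. -/
def Dominated : Prop :=
  ∃ τ : ℝ, 1 < τ ∧ ∃ n₀ : ℕ, ∀ w : List (Fin κ), n₀ ≤ w.length →
    τ ^ w.length * alpha2 (Φ.wordLin w) < alpha1 (Φ.wordLin w)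

/-- `ϑ₁(i) = L` for an infinite word `i`: the line `L` is the limit of the orientations
`ϑ₁(i|_n)` as `n → ∞`. -/
def IsLimitOrientation (i : ℕ → Fin κ) (L : Submodule ℝ Plane) : Prop :=
  Module.finrank ℝ L = 1 ∧
    Filter.Tendsto (fun n => lineAngle (orientation1 (Φ.wordLin (wordPrefix i n))) L)
      Filter.atTop (nhds 0)

/-- The set `ϑ₁(Σ)` of limit orientations of infinite words. -/
def limitOrientations : Set (Submodule ℝ Plane) := {L | ∃ i, Φ.IsLimitOrientation i L}

/-- `x = π i`: the point `x` lies in `⋂ n, φ_{i|_n}(E)`. When `E` is the self-affine set, this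
intersection is the single point `π i`. -/
def IsCodedBy (E : Set Plane) (i : ℕ → Fin κ) (x : Plane) : Prop :=
  x ∈ ⋂ n : ℕ, Φ.wordMap (wordPrefix i n) '' E

end AffineIFS

/-! ### Projections and visible parts -/

/-- The orthogonal projection along the direction `e`, onto the line orthogonal to `e`. -/
def projAlong (e : Plane) : Plane → Plane := ((ℝ ∙ e)ᗮ).starProjection

/-- The projection condition: some orientation is not a limit orientation, and for each direction
`e` whose orientation is not a limit orientation, the projections along `e` of all the cylinders
`φ_w(E)` of sufficiently high level are non-trivial intervals (convex subsets with more than one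
point) of the line orthogonal to `e`. -/
def AffineIFS.ProjectionCondition {κ : ℕ} (Φ : AffineIFS κ) (E : Set Plane) : Prop :=
  (∃ L : Submodule ℝ Plane, Module.finrank ℝ L = 1 ∧ L ∉ Φ.limitOrientations) ∧
  ∀ e : Plane, ‖e‖ = 1 → (ℝ ∙ e) ∉ Φ.limitOrientations →
    ∃ n₀ : ℕ, ∀ w : List (Fin κ), n₀ ≤ w.length →
      Convex ℝ (projAlong e '' (Φ.wordMap w '' E)) ∧
      (projAlong e '' (Φ.wordMap w '' E)).Nontrivial

/-- The visible part of `E` in direction `e`: the points `x` such that the half line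
`{x + t e : t ≥ 0}` meets `E` exactly in `x`. -/
def visiblePart (e : Plane) (E : Set Plane) : Set Plane :=
  {x | {y | ∃ t : ℝ, 0 ≤ t ∧ y = x + t • e} ∩ E = {x}}

end

/-! The functional `area e` encodes the projection along `e`, and `planeAdj A e` is a multiple of
`A⁻¹ e`, so projecting a cylinder `φ_w(E)` along `e` amounts to projecting `E` along `A_w⁻¹ e`.
Since `α₁ = ‖A‖` and `α₁ α₂ = |det A|`, domination says that `|det A_w| ≤ q ^ |w| * ‖A_w‖ ^ 2` for
long words, and then the orientations of a word and of its extensions are exponentially close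
(`HasOrientations`).

Upper bound. If `⟨e⟩` is not a limit orientation, long cylinders are uniformly transversal to `e`:
they are thin neighbourhoods of pieces of graphs of bounded slope, project onto intervals, and are
much longer than thick. A visible point cannot lie below such a sheet, so at each small scale the
visible part is almost the graph of a function of one-sided bounded slope. A piece of diameter `M r`
therefore needs only `O(M)` sets of size `r`, and the dimension is at most one
(`dimH_visiblePart_le_one`). For general `e`, the points coded by words with limit orientation `⟨e⟩`
are handled by the dimension assumption. Every other visible point lies in some `φ_w(E)` for which
`A_w⁻¹ e` is not a limit orientation, and is the image under `φ_w` of a point visible in that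
direction; there are countably many words `w`.

Lower bound. The last point of `E` on each line parallel to `e` is visible, so `E` and its visible
part have the same projection, and it suffices that this projection has dimension at least one. If
`A_w⁻¹ e` is not a limit orientation for some `w`, the projection contains an interval. Otherwise
`e` is an eigenvector of every `A_j`, dominating the other eigenvalue, and `⟨e⟩` is the only limit
orientation; the dimension assumption then gives `dim E ≤ 1`. If the projection of `E` along `e` is
not an interval, it has a gap. All other projections of long cylinders are intervals, and a
perturbation of the slope (`exists_overlap`) shows that cylinders from the two sides of the gap
overlap over an interval in a suitable projection. By self-affinity this overlap recurs in every
cylinder at comparable scale.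

Such recurring overlaps force `dim E > 1`, a contradiction. To see this
(`SplitsOverIntervals.one_lt_dimH`), choose a random point by uniform base `N` digits of its
projection, and toss a coin between two separated cylinders whenever the digit is the one over which
they overlap. The projection is uniformly distributed, and typically a positive proportion of the
steps carry a coin, which raises the exponent of the mass distribution above one. -/

open Filter Topology MeasureTheory

/-! ### Plane geometry -/

/-- The oriented area spanned by two vectors of the plane. -/
def area (x y : Plane) : ℝ := x 0 * y 1 - x 1 * y 0

/-- The rotation by a right angle. -/
noncomputable def quarterTurn (x : Plane) : Plane := !₂[-x 1, x 0]

@[simp] lemma quarterTurn_zero_apply (x : Plane) : quarterTurn x 0 = -x 1 := by simp [quarterTurn]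
@[simp] lemma quarterTurn_one_apply (x : Plane) : quarterTurn x 1 = x 0 := by simp [quarterTurn]

lemma Plane.ext_coord {x y : Plane} (h0 : x 0 = y 0) (h1 : x 1 = y 1) : x = y := by
  ext i; fin_cases i <;> assumption

lemma Plane.norm_sq (x : Plane) : ‖x‖ ^ 2 = x 0 ^ 2 + x 1 ^ 2 := by
  simp [EuclideanSpace.norm_sq_eq, Fin.sum_univ_two]

lemma Plane.inner_eq (x y : Plane) : inner ℝ x y = x 0 * y 0 + x 1 * y 1 := by
  simp [PiLp.inner_apply, Fin.sum_univ_two]; ring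

lemma area_add_left (x y z : Plane) : area (x + y) z = area x z + area y z := by
  simp [area]; ring
lemma area_add_right (x y z : Plane) : area x (y + z) = area x y + area x z := by
  simp [area]; ring
lemma area_sub_left (x y z : Plane) : area (x - y) z = area x z - area y z := by
  simp [area]; ring
lemma area_sub_right (x y z : Plane) : area x (y - z) = area x y - area x z := by
  simp [area]; ring
lemma area_smul_left (a : ℝ) (x y : Plane) : area (a • x) y = a * area x y := by
  simp [area]; ring
lemma area_smul_right (a : ℝ) (x y : Plane) : area x (a • y) = a * area x y := by
  simp [area]; ring
@[simp] lemma area_self (x : Plane) : area x x = 0 := by simp [area]; ring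
@[simp] lemma area_zero_right (x : Plane) : area x 0 = 0 := by simp [area]
lemma area_comm (x y : Plane) : area x y = -area y x := by simp [area]; ring
lemma abs_area_comm (x y : Plane) : |area x y| = |area y x| := by rw [area_comm, abs_neg]

lemma continuous_area (x : Plane) : Continuous (area x) := by
  unfold area; fun_prop

lemma area_sq_add_inner_sq (x y : Plane) :
    area x y ^ 2 + (inner ℝ x y) ^ 2 = ‖x‖ ^ 2 * ‖y‖ ^ 2 := by
  rw [Plane.norm_sq, Plane.norm_sq, Plane.inner_eq, area]; ring

lemma abs_area_le (x y : Plane) : |area x y| ≤ ‖x‖ * ‖y‖ := by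
  apply abs_le_of_sq_le_sq _ (by positivity)
  nlinarith [area_sq_add_inner_sq x y, sq_nonneg (inner ℝ x y)]

/-- Cramer's rule: three vectors of the plane are linearly dependent. -/
lemma area_smul_eq (u v w : Plane) : area u w • v = area u v • w + area v w • u := by
  apply Plane.ext_coord <;> simp [area] <;> ring

/-- For unit vectors `|area u v|` is the sine of the angle between the lines, so this is a
homogeneous triangle inequality for that distance between lines. -/
lemma abs_area_mul_norm_le (u v w : Plane) :
    |area u w| * ‖v‖ ≤ |area u v| * ‖w‖ + |area v w| * ‖u‖ := by
  have h := congrArg norm (area_smul_eq u v w)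
  rw [norm_smul, Real.norm_eq_abs] at h
  rw [h]
  refine (norm_add_le _ _).trans ?_
  simp [norm_smul]

lemma abs_area_triangle {u v w : Plane} (hu : ‖u‖ = 1) (hv : ‖v‖ = 1) (hw : ‖w‖ = 1) :
    |area u w| ≤ |area u v| + |area v w| := by
  simpa [hu, hv, hw] using abs_area_mul_norm_le u v w

lemma area_quarterTurn (x : Plane) : area x (quarterTurn x) = ‖x‖ ^ 2 := by
  rw [Plane.norm_sq]; simp [area]; ring

lemma norm_quarterTurn (x : Plane) : ‖quarterTurn x‖ = ‖x‖ := by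
  have : ‖quarterTurn x‖ ^ 2 = ‖x‖ ^ 2 := by
    rw [Plane.norm_sq, Plane.norm_sq]; simp; ring
  exact (pow_left_inj₀ (norm_nonneg _) (norm_nonneg _) two_ne_zero).1 this

lemma Plane.decomp {e : Plane} (he : ‖e‖ = 1) (z : Plane) :
    z = inner ℝ e z • e + area e z • quarterTurn e := by
  have h := Plane.norm_sq e
  rw [he] at h
  apply Plane.ext_coord <;> simp [Plane.inner_eq, area]
  · linear_combination (z 0) * h
  · linear_combination (z 1) * h

lemma mem_span_of_area_eq_zero {x y : Plane} (hx : x ≠ 0) (h : area x y = 0) :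
    ∃ t : ℝ, y = t • x := by
  have hn : ‖x‖ ^ 2 ≠ 0 := by positivity
  refine ⟨inner ℝ x y / ‖x‖ ^ 2, ?_⟩
  have h2 := Plane.norm_sq x
  unfold area at h
  apply Plane.ext_coord <;> simp [Plane.inner_eq] <;> field_simp <;> rw [h2]
  · linear_combination (-x 1) * h
  · linear_combination (x 0) * h

/-! ### Linear maps of the plane -/

/-- The determinant of a linear map of the plane. -/
noncomputable def planeDet (A : Plane →L[ℝ] Plane) : ℝ := area (A !₂[1, 0]) (A !₂[0, 1])

/-- The adjugate of a linear map of the plane. -/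
noncomputable def planeAdj (A : Plane →L[ℝ] Plane) (y : Plane) : Plane :=
  !₂[A !₂[0, 1] 1 * y 0 - A !₂[0, 1] 0 * y 1, A !₂[1, 0] 0 * y 1 - A !₂[1, 0] 1 * y 0]

lemma Plane.map_eq (A : Plane →L[ℝ] Plane) (z : Plane) :
    A z = z 0 • A !₂[1, 0] + z 1 • A !₂[0, 1] := by
  rw [← map_smul, ← map_smul, ← map_add]
  congr 1
  apply Plane.ext_coord <;> simp

lemma area_map (A : Plane →L[ℝ] Plane) (x y : Plane) :
    area (A x) (A y) = planeDet A * area x y := by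
  rw [Plane.map_eq A x, Plane.map_eq A y]; simp [area, planeDet]; ring

/-- The adjugate is the adjoint for the area form. This moves the projection of an image `A S` along
`x` to the projection of `S` along `planeAdj A x`, without dividing by the determinant. -/
lemma area_map_right (A : Plane →L[ℝ] Plane) (x y : Plane) :
    area x (A y) = area (planeAdj A x) y := by
  rw [Plane.map_eq A y]; simp [area, planeAdj]; ring

lemma planeAdj_map (A : Plane →L[ℝ] Plane) (x : Plane) : planeAdj A (A x) = planeDet A • x := by
  rw [Plane.map_eq A x]
  apply Plane.ext_coord <;> simp [area, planeAdj, planeDet] <;> ring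

lemma map_planeAdj (A : Plane →L[ℝ] Plane) (x : Plane) : A (planeAdj A x) = planeDet A • x := by
  rw [Plane.map_eq A]
  apply Plane.ext_coord <;> simp [area, planeAdj, planeDet] <;> ring

lemma planeAdj_add (A : Plane →L[ℝ] Plane) (x y : Plane) :
    planeAdj A (x + y) = planeAdj A x + planeAdj A y := by
  apply Plane.ext_coord <;> simp [planeAdj] <;> ring

lemma planeAdj_smul (A : Plane →L[ℝ] Plane) (t : ℝ) (x : Plane) :
    planeAdj A (t • x) = t • planeAdj A x := by
  apply Plane.ext_coord <;> simp [planeAdj] <;> ring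

lemma norm_planeAdj_le (A : Plane →L[ℝ] Plane) (x : Plane) : ‖planeAdj A x‖ ≤ ‖A‖ * ‖x‖ := by
  have h := area_quarterTurn (planeAdj A x)
  rw [← area_map_right] at h
  have h1 : ‖planeAdj A x‖ ^ 2 ≤ ‖x‖ * (‖A‖ * ‖planeAdj A x‖) := by
    rw [← h, ← norm_quarterTurn (planeAdj A x)]
    exact (le_abs_self _).trans ((abs_area_le _ _).trans
      (mul_le_mul_of_nonneg_left (A.le_opNorm _) (norm_nonneg _)))
  rcases (norm_nonneg (planeAdj A x)).eq_or_lt with h0 | h0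
  · rw [← h0]; positivity
  · nlinarith

lemma planeDet_mul (A B : Plane →L[ℝ] Plane) : planeDet (A * B) = planeDet A * planeDet B := by
  change area (A (B _)) (A (B _)) = _
  rw [area_map]; rfl

lemma planeDet_one : planeDet 1 = 1 := by simp [planeDet, area]

lemma planeAdj_mul (A B : Plane →L[ℝ] Plane) (x : Plane) :
    planeAdj (A * B) x = planeAdj B (planeAdj A x) := by
  have h : ∀ y, area (planeAdj (A * B) x - planeAdj B (planeAdj A x)) y = 0 := fun y ↦ by
    rw [area_sub_left, ← area_map_right, ← area_map_right, ← area_map_right]; simp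
  have h2 := h (quarterTurn (planeAdj (A * B) x - planeAdj B (planeAdj A x)))
  rw [area_quarterTurn] at h2
  exact sub_eq_zero.1 (norm_eq_zero.1 (pow_eq_zero_iff two_ne_zero |>.1 h2))

lemma planeDet_ne_zero {A : Plane →L[ℝ] Plane} (hA : Function.Bijective A) : planeDet A ≠ 0 := by
  intro h
  obtain ⟨x, hx⟩ := hA.2 !₂[1, 0]
  obtain ⟨y, hy⟩ := hA.2 !₂[0, 1]
  have := area_map A x y
  rw [h, hx, hy] at this
  simp [area] at this

lemma planeAdj_ne_zero {A : Plane →L[ℝ] Plane} (hA : planeDet A ≠ 0) {x : Plane} (hx : x ≠ 0) :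
    planeAdj A x ≠ 0 := by
  intro h
  have := map_planeAdj A x
  rw [h, map_zero] at this
  exact (smul_ne_zero hA hx) this.symm

lemma norm_pos_of_det {A : Plane →L[ℝ] Plane} (hA : planeDet A ≠ 0) : 0 < ‖A‖ := by
  rw [norm_pos_iff]
  rintro rfl
  simp [planeDet] at hA

lemma abs_planeDet_mul_norm_le (A : Plane →L[ℝ] Plane) (x : Plane) :
    |planeDet A| * ‖x‖ ≤ ‖A‖ * ‖A x‖ := by
  have h := congrArg norm (planeAdj_map A x)
  rw [norm_smul, Real.norm_eq_abs] at h
  rw [← h]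
  exact norm_planeAdj_le A _

/-- Write `A = (A B) B⁻¹`; in the plane `‖B⁻¹‖ = ‖B‖ / |det B|`. -/
lemma norm_mul_det_le (A B : Plane →L[ℝ] Plane) : |planeDet B| * ‖A‖ ≤ ‖A * B‖ * ‖B‖ := by
  rcases (abs_nonneg (planeDet B)).eq_or_lt with h0 | h0
  · rw [← h0, zero_mul]; positivity
  have : ‖A‖ ≤ (‖A * B‖ * ‖B‖) / |planeDet B| := by
    refine A.opNorm_le_bound (by positivity) fun x ↦ ?_
    rw [div_mul_eq_mul_div, le_div_iff₀ h0]
    have h1 : ‖(A * B) (planeAdj B x)‖ = ‖A x‖ * |planeDet B| := by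
      change ‖A (B _)‖ = _
      rw [map_planeAdj, map_smul, norm_smul, Real.norm_eq_abs, mul_comm]
    rw [← h1]
    refine ((A * B).le_opNorm _).trans ?_
    rw [mul_assoc]
    exact mul_le_mul_of_nonneg_left (norm_planeAdj_le B x) (norm_nonneg _)
  rw [le_div_iff₀ h0] at this
  linarith

/-! ### Principal directions -/

/-- `u` is a unit vector in the direction of the longer semiaxis of `A (B(0,1))`. -/
def IsPrincipal (A : Plane →L[ℝ] Plane) (u : Plane) : Prop :=
  ‖u‖ = 1 ∧ ∃ v : Plane, ‖v‖ = 1 ∧ A v = ‖A‖ • u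

/-- Since `‖A‖ • u = A v`, the area on the left is an area of two images under `A`, hence `det A`
times `area f v`. The image of the unit disc thus has thickness of order `|det A| / ‖A‖` across `u`.
-/
lemma IsPrincipal.norm_mul_abs_area_le {A : Plane →L[ℝ] Plane} {u : Plane}
    (h : IsPrincipal A u) (f : Plane) : ‖A‖ * |area (A f) u| ≤ |planeDet A| * ‖f‖ := by
  obtain ⟨_, v, hv, hAv⟩ := h
  have h1 : area (A f) (‖A‖ • u) = planeDet A * area f v := by rw [← hAv, area_map]
  rw [area_smul_right] at h1
  have h2 := congrArg abs h1
  rw [abs_mul, abs_mul, abs_of_nonneg (norm_nonneg A)] at h2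
  rw [h2]
  have := abs_area_le f v
  rw [hv, mul_one] at this
  exact mul_le_mul_of_nonneg_left this (abs_nonneg _)

/-- The long axis of `A * B` is the image under `A` of some vector, so the previous estimate applies
to it. With `B` a single letter this makes the orientations along a word a Cauchy sequence. -/
lemma IsPrincipal.abs_area_mul_le {A B : Plane →L[ℝ] Plane} {u w : Plane}
    (hA : IsPrincipal A u) (hAB : IsPrincipal (A * B) w) :
    ‖A‖ ^ 2 * |planeDet B| * |area u w| ≤ |planeDet A| * ‖B‖ ^ 2 := by
  obtain ⟨_, v, hv, hABv⟩ := hAB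
  have h1 := hA.norm_mul_abs_area_le (B v)
  have h2 : A (B v) = ‖A * B‖ • w := hABv
  rw [h2, area_smul_left, abs_mul, abs_of_nonneg (norm_nonneg _), abs_area_comm] at h1
  have h3 : ‖B v‖ ≤ ‖B‖ := by simpa [hv] using B.le_opNorm v
  have h4 := norm_mul_det_le A B
  calc ‖A‖ ^ 2 * |planeDet B| * |area u w|
      = (|planeDet B| * ‖A‖) * (‖A‖ * |area u w|) := by ring
    _ ≤ (‖A * B‖ * ‖B‖) * (‖A‖ * |area u w|) :=
        mul_le_mul_of_nonneg_right h4 (by positivity)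
    _ = (‖A‖ * (‖A * B‖ * |area u w|)) * ‖B‖ := by ring
    _ ≤ (|planeDet A| * ‖B v‖) * ‖B‖ := mul_le_mul_of_nonneg_right h1 (norm_nonneg _)
    _ ≤ (|planeDet A| * ‖B‖) * ‖B‖ := by gcongr
    _ = _ := by ring

/-- Pull back by `A`: the long axis of `A * B` comes from a vector in the image of `B`, which is
close to the long axis `u` of `B`. Here `A` is fixed and `B` is long, so `A u` is almost the
orientation of the product. -/
lemma IsPrincipal.abs_area_map_le {A B : Plane →L[ℝ] Plane} {u w : Plane}
    (hB : IsPrincipal B u) (hAB : IsPrincipal (A * B) w) (hA : planeDet A ≠ 0) :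
    ‖B‖ ^ 2 * |area w (A u)| ≤ ‖A‖ * |planeDet B| := by
  obtain ⟨_, v, hv, hABv⟩ := hAB
  have hB' := hB
  obtain ⟨hu, v', hv', hBv'⟩ := hB'
  have h1 := hB.norm_mul_abs_area_le v
  rw [hv, mul_one] at h1
  have h2 : A (B v) = ‖A * B‖ • w := hABv
  have h3 : ‖A * B‖ * |area w (A u)| = |planeDet A| * |area (B v) u| := by
    rw [← abs_mul, ← area_map, h2, area_smul_left, abs_mul, abs_of_nonneg (norm_nonneg _)]
  have h4 : |planeDet A| * ‖B‖ ≤ ‖A‖ * ‖A * B‖ := by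
    have h5 := abs_planeDet_mul_norm_le A (B v')
    rw [hBv', norm_smul, hu, mul_one, norm_norm] at h5
    refine h5.trans (mul_le_mul_of_nonneg_left ?_ (norm_nonneg _))
    rw [← hBv']
    have := (A * B).le_opNorm v'
    rwa [hv', mul_one] at this
  have hA' : 0 < |planeDet A| := abs_pos.2 hA
  refine le_of_mul_le_mul_left ?_ hA'
  calc |planeDet A| * (‖B‖ ^ 2 * |area w (A u)|)
      = (|planeDet A| * ‖B‖) * (‖B‖ * |area w (A u)|) := by ring
    _ ≤ (‖A‖ * ‖A * B‖) * (‖B‖ * |area w (A u)|) :=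
        mul_le_mul_of_nonneg_right h4 (by positivity)
    _ = ‖A‖ * ‖B‖ * (‖A * B‖ * |area w (A u)|) := by ring
    _ = ‖A‖ * |planeDet A| * (‖B‖ * |area (B v) u|) := by rw [h3]; ring
    _ ≤ ‖A‖ * |planeDet A| * |planeDet B| := by gcongr
    _ = _ := by ring

lemma IsPrincipal.mul_norm_le_planeAdj {A : Plane →L[ℝ] Plane} {u e : Plane}
    (h : IsPrincipal A u) : |area e u| * ‖A‖ ≤ ‖planeAdj A e‖ := by
  obtain ⟨_, v, hv, hAv⟩ := h
  have h1 : area e (‖A‖ • u) = area (planeAdj A e) v := by rw [← hAv, area_map_right]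
  rw [area_smul_right] at h1
  have h2 := abs_area_le (planeAdj A e) v
  rw [← h1, abs_mul, abs_of_nonneg (norm_nonneg A), hv, mul_one] at h2
  linarith

/-! ### Singular values -/

lemma exists_singular_basis (A : Plane →L[ℝ] Plane) : ∃ b₀ b₁ : Plane,
    ‖b₀‖ = 1 ∧ ‖b₁‖ = 1 ∧ inner ℝ b₀ b₁ = 0 ∧
    (ContinuousLinearMap.adjoint A) (A b₀) = alpha1 A ^ 2 • b₀ ∧
    (ContinuousLinearMap.adjoint A) (A b₁) = alpha2 A ^ 2 • b₁ := by
  set T : Plane →ₗ[ℝ] Plane := (A : Plane →ₗ[ℝ] Plane) with hTdef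
  have hT := T.isSymmetric_adjoint_comp_self
  have hn : Module.finrank ℝ Plane = 2 := by simp
  set b := hT.eigenvectorBasis hn
  have key : ∀ i : Fin 2, (ContinuousLinearMap.adjoint A) (A
    (b i)) = T.singularValues i ^ 2 • b i := by
    intro i
    have h1 := hT.apply_eigenvectorBasis hn i
    rw [T.sq_singularValues_fin hn i]
    refine Eq.trans ?_ h1
    refine ext_inner_right ℝ fun y ↦ ?_
    rw [ContinuousLinearMap.adjoint_inner_left, LinearMap.comp_apply,
      LinearMap.adjoint_inner_left]
    rfl
  refine ⟨b 0, b 1, b.norm_eq_one 0, b.norm_eq_one 1, b.inner_eq_zero (by decide), ?_, ?_⟩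
  · simpa [alpha1] using key 0
  · simpa [alpha2] using key 1

lemma alpha1_nonneg (A : Plane →L[ℝ] Plane) : 0 ≤ alpha1 A := LinearMap.singularValues_nonneg _ _
lemma alpha2_nonneg (A : Plane →L[ℝ] Plane) : 0 ≤ alpha2 A := LinearMap.singularValues_nonneg _ _
lemma alpha2_le_alpha1 (A : Plane →L[ℝ] Plane) : alpha2 A ≤ alpha1 A :=
  LinearMap.singularValues_antitone _ (Nat.zero_le 1)

lemma norm_map_eq_of_adjoint {A : Plane →L[ℝ] Plane} {b : Plane} {s : ℝ} (hs : 0 ≤ s)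
    (hb : ‖b‖ = 1) (h : (ContinuousLinearMap.adjoint A) (A b) = s ^ 2 • b) : ‖A b‖ = s := by
  have h1 : ‖A b‖ ^ 2 = s ^ 2 := by
    rw [← real_inner_self_eq_norm_sq, ← ContinuousLinearMap.adjoint_inner_left, h,
      real_inner_smul_left, real_inner_self_eq_norm_sq, hb]
    ring
  exact (pow_left_inj₀ (norm_nonneg _) hs two_ne_zero).1 h1

lemma orthonormal_decomp {b₀ b₁ : Plane} (h0 : ‖b₀‖ = 1) (h1 : ‖b₁‖ = 1)
    (h : inner ℝ b₀ b₁ = 0) (x : Plane) :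
    x = inner ℝ b₀ x • b₀ + inner ℝ b₁ x • b₁ ∧
      ‖x‖ ^ 2 = inner ℝ b₀ x ^ 2 + inner ℝ b₁ x ^ 2 := by
  have hc := area_sq_add_inner_sq b₀ b₁
  rw [h, h0, h1] at hc
  have hd := Plane.decomp h0 b₁
  rw [h, zero_smul, zero_add] at hd
  have hx := Plane.decomp h0 x
  have hin : inner ℝ b₁ x = area b₀ b₁ * area b₀ x := by
    conv_lhs => rw [hd]
    rw [real_inner_smul_left]
    congr 1
    simp [Plane.inner_eq, area]; ring
  refine ⟨?_, ?_⟩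
  · conv_lhs => rw [hx]
    rw [hin]
    congr 1
    have hd' : ∀ c : ℝ, c • b₁ = (c * area b₀ b₁) • quarterTurn b₀ := fun c ↦ by
      rw [mul_smul, ← hd]
    rw [hd']
    congr 1
    linear_combination (-area b₀ x) * hc
  · have := area_sq_add_inner_sq b₀ x
    rw [h0] at this
    rw [hin]
    linear_combination (-this) - (area b₀ x ^ 2) * hc

lemma alpha1_eq_norm (A : Plane →L[ℝ] Plane) : alpha1 A = ‖A‖ := by
  obtain ⟨b₀, b₁, h0, h1, h01, e0, e1⟩ := exists_singular_basis A
  have n0 := norm_map_eq_of_adjoint (alpha1_nonneg A) h0 e0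
  have n1 := norm_map_eq_of_adjoint (alpha2_nonneg A) h1 e1
  have hA01 : inner ℝ (A b₀) (A b₁) = 0 := by
    rw [← ContinuousLinearMap.adjoint_inner_left, e0, real_inner_smul_left, h01, mul_zero]
  apply le_antisymm
  · rw [← n0]
    simpa [h0] using A.le_opNorm b₀
  · refine A.opNorm_le_bound (alpha1_nonneg A) fun x ↦ ?_
    apply le_of_sq_le_sq _ (by have := alpha1_nonneg A; positivity)
    obtain ⟨hx, hxn⟩ := orthonormal_decomp h0 h1 h01 x
    set p := inner ℝ b₀ x
    set q := inner ℝ b₁ x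
    have : ‖A x‖ ^ 2 = p ^ 2 * alpha1 A ^ 2 + q ^ 2 * alpha2 A ^ 2 := by
      conv_lhs => rw [hx]
      rw [map_add, map_smul, map_smul, ← real_inner_self_eq_norm_sq, inner_add_left,
        inner_add_right, inner_add_right]
      simp only [real_inner_smul_left, real_inner_smul_right]
      rw [real_inner_comm (A b₀) (A b₁), hA01, real_inner_self_eq_norm_sq,
        real_inner_self_eq_norm_sq,
        n0, n1]
      ring
    rw [this, mul_pow, hxn]
    have := pow_le_pow_left₀ (alpha2_nonneg A) (alpha2_le_alpha1 A) 2
    nlinarith [sq_nonneg q]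

/-- Together with `alpha1_eq_norm` this replaces the singular values by the norm and the
determinant, the latter being multiplicative. -/
lemma alpha1_mul_alpha2 (A : Plane →L[ℝ] Plane) : alpha1 A * alpha2 A = |planeDet A| := by
  obtain ⟨b₀, b₁, h0, h1, h01, e0, e1⟩ := exists_singular_basis A
  have n0 := norm_map_eq_of_adjoint (alpha1_nonneg A) h0 e0
  have n1 := norm_map_eq_of_adjoint (alpha2_nonneg A) h1 e1
  have hA01 : inner ℝ (A b₀) (A b₁) = 0 := by
    rw [← ContinuousLinearMap.adjoint_inner_left, e0, real_inner_smul_left, h01, mul_zero]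
  have k1 := area_sq_add_inner_sq (A b₀) (A b₁)
  have k2 := area_sq_add_inner_sq b₀ b₁
  rw [hA01, n0, n1, area_map] at k1
  rw [h01, h0, h1] at k2
  have : (alpha1 A * alpha2 A) ^ 2 = |planeDet A| ^ 2 := by
    rw [sq_abs]
    linear_combination -k1 + planeDet A ^ 2 * k2
  exact (pow_left_inj₀ (mul_nonneg (alpha1_nonneg A) (alpha2_nonneg A)) (abs_nonneg _)
    two_ne_zero).1 this

lemma exists_isPrincipal_orientation1 {A : Plane →L[ℝ] Plane} (hA : alpha2 A < alpha1 A) :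
    ∃ u, IsPrincipal A u ∧ orientation1 A = Submodule.span ℝ {u} := by
  obtain ⟨b₀, b₁, h0, h1, h01, e0, e1⟩ := exists_singular_basis A
  have n0 := norm_map_eq_of_adjoint (alpha1_nonneg A) h0 e0
  have hpos : 0 < alpha1 A := (alpha2_nonneg A).trans_lt hA
  have hne : alpha1 A ≠ 0 := hpos.ne'
  have heig : Module.End.eigenspace
      ((ContinuousLinearMap.adjoint A ∘L A : Plane →L[ℝ] Plane) : Module.End ℝ Plane)
      (alpha1 A ^ 2) = Submodule.span ℝ {b₀} := by
    ext x
    rw [Module.End.mem_eigenspace_iff, Submodule.mem_span_singleton]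
    change (ContinuousLinearMap.adjoint A) (A x) = _ ↔ _
    constructor
    · intro hx
      obtain ⟨hd, -⟩ := orthonormal_decomp h0 h1 h01 x
      have k1 : inner ℝ b₁ ((ContinuousLinearMap.adjoint A)
        (A x)) = alpha2 A ^ 2 * inner ℝ b₁ x := by
        rw [ContinuousLinearMap.adjoint_inner_right, ← ContinuousLinearMap.adjoint_inner_left, e1,
          real_inner_smul_left]
      rw [hx, real_inner_smul_right] at k1
      have k2 : inner ℝ b₁ x = 0 := by
        have : (alpha1 A ^ 2 - alpha2 A ^ 2) * inner ℝ b₁ x = 0 := by linear_combination k1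
        rcases mul_eq_zero.1 this with h | h
        · nlinarith [alpha2_nonneg A]
        · exact h
      rw [k2, zero_smul, add_zero] at hd
      exact ⟨_, hd.symm⟩
    · rintro ⟨a, rfl⟩
      rw [map_smul, map_smul, e0, smul_comm]
  refine ⟨(alpha1 A)⁻¹ • A b₀, ⟨?_, b₀, h0, ?_⟩, ?_⟩
  · rw [norm_smul, n0, norm_inv, Real.norm_of_nonneg (alpha1_nonneg A), inv_mul_cancel₀ hne]
  · rw [← alpha1_eq_norm, smul_smul, mul_inv_cancel₀ hne, one_smul]
  · rw [orientation1, heig, Submodule.map_span, Set.image_singleton]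
    exact (Submodule.span_singleton_smul_eq (IsUnit.mk0 _ (inv_ne_zero hne)) _).symm

/-! ### Angles between lines -/

lemma sin_angle_eq_abs_area {u v : Plane} (hu : ‖u‖ = 1) (hv : ‖v‖ = 1) :
    Real.sin (InnerProductGeometry.angle u v) = |area u v| := by
  have h1 := InnerProductGeometry.cos_angle u v
  rw [hu, hv, mul_one, div_one] at h1
  have h2 := area_sq_add_inner_sq u v
  rw [hu, hv] at h2
  have h3 := InnerProductGeometry.sin_angle_nonneg u v
  have h4 := Real.sin_sq_add_cos_sq (InnerProductGeometry.angle u v)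
  rw [h1] at h4
  have : Real.sin (InnerProductGeometry.angle u v) ^ 2 = |area u v| ^ 2 := by
    rw [sq_abs]; linarith
  exact (pow_left_inj₀ h3 (abs_nonneg _) two_ne_zero).1 this

/-- Rescaling the two vectors affects their angle only through the signs, so the infimum is over two
values. -/
lemma lineAngle_span {u v : Plane} (hu : ‖u‖ = 1) (hv : ‖v‖ = 1) :
    lineAngle (Submodule.span ℝ {u}) (Submodule.span ℝ {v}) =
      min (InnerProductGeometry.angle u v) (Real.pi - InnerProductGeometry.angle u v) := by
  have hu0 : u ≠ 0 := by rintro rfl; simp at hu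
  have hv0 : v ≠ 0 := by rintro rfl; simp at hv
  have : {t : ℝ | ∃ u' ∈ Submodule.span ℝ {u}, ∃ v' ∈ Submodule.span ℝ {v}, u' ≠ 0 ∧ v' ≠ 0 ∧
      t = InnerProductGeometry.angle u' v'} =
      {InnerProductGeometry.angle u v, Real.pi - InnerProductGeometry.angle u v} := by
    ext t
    simp only [Set.mem_ofPred_eq, Set.mem_insert_iff, Set.mem_singleton_iff]
    constructor
    · rintro ⟨u', hu', v', hv', hu'0, hv'0, rfl⟩
      obtain ⟨a, rfl⟩ := Submodule.mem_span_singleton.1 hu'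
      obtain ⟨b, rfl⟩ := Submodule.mem_span_singleton.1 hv'
      have ha : a ≠ 0 := by rintro rfl; simp at hu'0
      have hb : b ≠ 0 := by rintro rfl; simp at hv'0
      rcases lt_or_gt_of_ne ha with ha | ha <;> rcases lt_or_gt_of_ne hb with hb | hb <;>
        simp [InnerProductGeometry.angle_smul_left_of_neg,
          InnerProductGeometry.angle_smul_left_of_pos,
          InnerProductGeometry.angle_smul_right_of_neg,
            InnerProductGeometry.angle_smul_right_of_pos, ha, hb,
          InnerProductGeometry.angle_neg_left, InnerProductGeometry.angle_neg_right]
    · rintro (rfl | rfl)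
      · exact ⟨u, Submodule.mem_span_singleton_self u, v, Submodule.mem_span_singleton_self v,
          hu0, hv0, rfl⟩
      · exact ⟨-u, neg_mem (Submodule.mem_span_singleton_self u), v,
          Submodule.mem_span_singleton_self v, neg_ne_zero.2 hu0, hv0,
          (InnerProductGeometry.angle_neg_left u v).symm⟩
  rw [lineAngle, this]
  exact csInf_pair _ _

lemma sin_lineAngle_span {u v : Plane} (hu : ‖u‖ = 1) (hv : ‖v‖ = 1) :
    Real.sin (lineAngle (Submodule.span ℝ {u}) (Submodule.span ℝ {v})) = |area u v| := by
  rw [lineAngle_span hu hv]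
  rcases min_choice (InnerProductGeometry.angle u v) (Real.pi - InnerProductGeometry.angle u v)
    with h | h <;> rw [h]
  · exact sin_angle_eq_abs_area hu hv
  · rw [Real.sin_pi_sub]; exact sin_angle_eq_abs_area hu hv

lemma abs_area_le_lineAngle {u v : Plane} (hu : ‖u‖ = 1) (hv : ‖v‖ = 1) :
    |area u v| ≤ lineAngle (Submodule.span ℝ {u}) (Submodule.span ℝ {v}) := by
  rw [← sin_lineAngle_span hu hv]
  apply Real.sin_le
  rw [lineAngle_span hu hv]
  exact le_min (InnerProductGeometry.angle_nonneg _ _)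
    (sub_nonneg.2 (InnerProductGeometry.angle_le_pi _ _))

lemma lineAngle_nonneg {u v : Plane} (hu : ‖u‖ = 1) (hv : ‖v‖ = 1) :
    0 ≤ lineAngle (Submodule.span ℝ {u}) (Submodule.span ℝ {v}) :=
  (abs_nonneg _).trans (abs_area_le_lineAngle hu hv)

/-- Jordan's inequality on `[0, π/2]`. With `abs_area_le_lineAngle`, convergence of lines becomes
convergence of areas to zero. -/
lemma lineAngle_le_abs_area {u v : Plane} (hu : ‖u‖ = 1) (hv : ‖v‖ = 1) :
    lineAngle (Submodule.span ℝ {u}) (Submodule.span ℝ {v}) ≤ Real.pi / 2 * |area u v| := by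
  have h1 : lineAngle (Submodule.span ℝ {u}) (Submodule.span ℝ {v}) ≤ Real.pi / 2 := by
    rw [lineAngle_span hu hv, min_le_iff]
    by_contra! h
    linarith
  have h2 := Real.mul_le_sin (lineAngle_nonneg hu hv) h1
  rw [sin_lineAngle_span hu hv] at h2
  have hpi := Real.pi_pos
  calc _ = Real.pi / 2 * (2 / Real.pi * lineAngle (Submodule.span ℝ {u}) (Submodule.span ℝ
    {v})) := by
        field_simp
    _ ≤ _ := by gcongr

/-! ### Projections -/

lemma projAlong_eq {e : Plane} (he : ‖e‖ = 1) (z : Plane) :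
    projAlong e z = area e z • quarterTurn e := by
  rw [projAlong, Submodule.starProjection_orthogonal_val,
    Submodule.starProjection_unit_singleton ℝ he]
  nth_rewrite 1 [Plane.decomp he z]
  simp

lemma area_projAlong {e : Plane} (he : ‖e‖ = 1) (z : Plane) :
    area e (projAlong e z) = area e z := by
  rw [projAlong_eq he, area_smul_right, area_quarterTurn, he]; ring

lemma isLinearMap_area (e : Plane) : IsLinearMap ℝ (area e) :=
  ⟨fun x y ↦ area_add_right e x y, fun a x ↦ area_smul_right a e x⟩

lemma area_image_of_projAlong {e : Plane} (he : ‖e‖ = 1) {S : Set Plane}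
    (h : Convex ℝ (projAlong e '' S)) (h' : (projAlong e '' S).Nontrivial) :
    Convex ℝ (area e '' S) ∧ (area e '' S).Nontrivial := by
  have : area e '' S = area e '' (projAlong e '' S) := by
    rw [Set.image_image]; simp_rw [area_projAlong he]
  constructor
  · rw [this]
    exact h.is_linear_image (isLinearMap_area e)
  · obtain ⟨-, ⟨x, hx, rfl⟩, -, ⟨y, hy, rfl⟩, hxy⟩ := h'
    refine ⟨_, ⟨x, hx, rfl⟩, _, ⟨y, hy, rfl⟩, fun h ↦ hxy ?_⟩
    rw [projAlong_eq he, projAlong_eq he, h]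

/-! ### Upper bounds for the Hausdorff dimension -/

lemma exists_iterated_cover {X : Type*} [PseudoMetricSpace X] {V : Set X} {K : ℕ} {q ρ₀ : ℝ}
    (hq0 : 0 < q) (hq1 : q < 1)
    (h : ∀ ρ, 0 < ρ → ρ ≤ ρ₀ → ∀ U ⊆ V, (∀ x ∈ U, ∀ y ∈ U, dist x y ≤ ρ) →
      ∃ c : Fin K → Set X, U ⊆ ⋃ i, c i ∧ ∀ i, ∀ x ∈ c i, ∀ y ∈ c i, dist x y ≤ q * ρ)
    (n : ℕ) {ρ : ℝ} (hρ : 0 < ρ) (hρ₀ : ρ ≤ ρ₀) {U : Set X} (hUV : U ⊆ V)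
    (hU : ∀ x ∈ U, ∀ y ∈ U, dist x y ≤ ρ) :
    ∃ c : (Fin n → Fin K) → Set X, U ⊆ ⋃ i, c i ∧ (∀ i, c i ⊆ V) ∧
      ∀ i, ∀ x ∈ c i, ∀ y ∈ c i, dist x y ≤ q ^ n * ρ := by
  induction n with
  | zero =>
    refine ⟨fun _ ↦ U, fun x hx ↦ Set.mem_iUnion.2 ⟨Fin.elim0, hx⟩, fun _ ↦ hUV, fun _ ↦ ?_⟩
    simpa using hU
  | succ n ih =>
    obtain ⟨c, hcU, hcV, hc⟩ := ih
    have hqn : q ^ n ≤ 1 := pow_le_one₀ hq0.le hq1.le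
    have := fun i ↦ h (q ^ n * ρ) (by positivity)
      ((mul_le_of_le_one_left hρ.le hqn).trans hρ₀) (c i) (hcV i) (hc i)
    choose d hd1 hd2 using this
    -- Intersecting with `V` makes the new pieces admissible for the next refinement.
    refine ⟨fun f ↦ d (fun j ↦ f j.succ) (f 0) ∩ V, fun x hx ↦ ?_,
      fun _ ↦ Set.inter_subset_right, fun f x hx y hy ↦ ?_⟩
    · obtain ⟨i, hi⟩ := Set.mem_iUnion.1 (hcU hx)
      obtain ⟨j, hj⟩ := Set.mem_iUnion.1 (hd1 i hi)
      exact Set.mem_iUnion.2 ⟨Fin.cons j i, by simpa using ⟨hj, hUV hx⟩⟩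
    · rw [pow_succ', mul_assoc]
      exact hd2 _ _ x hx.1 y hy.1

/-- After `n` refinements there are `K ^ n` pieces of diameter at most `q ^ n * ρ₀`, and the sum of
the `s`-th powers of their diameters is at most a constant times `(K * q ^ s) ^ n`, which tends to
zero. -/
lemma dimH_le_of_refine {X : Type*} [MetricSpace X] {V : Set X} (hV : TotallyBounded V)
    {K : ℕ} {q ρ₀ : ℝ} {s : NNReal} (hq0 : 0 < q) (hq1 : q < 1) (hρ₀ : 0 < ρ₀)
    (hK : K * q ^ (s : ℝ) < 1)
    (h : ∀ ρ, 0 < ρ → ρ ≤ ρ₀ → ∀ U ⊆ V, (∀ x ∈ U, ∀ y ∈ U, dist x y ≤ ρ) →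
      ∃ c : Fin K → Set X, U ⊆ ⋃ i, c i ∧ ∀ i, ∀ x ∈ c i, ∀ y ∈ c i, dist x y ≤ q * ρ) :
    dimH V ≤ s := by
  borelize X
  have main : ∀ U ⊆ V, (∀ x ∈ U, ∀ y ∈ U, dist x y ≤ ρ₀) → dimH U ≤ s := by
    intro U hUV hU
    have := fun n ↦ exists_iterated_cover hq0 hq1 h n hρ₀ le_rfl hUV hU
    choose c hcU _ hc using this
    have hdiam : ∀ n i, Metric.ediam (c n i) ≤ ENNReal.ofReal (q ^ n * ρ₀) := fun n i ↦
      Metric.ediam_le fun x hx y hy ↦ by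
        rw [edist_dist]; exact ENNReal.ofReal_le_ofReal (hc n i x hx y hy)
    have hlim0 : Tendsto (fun n : ℕ ↦ q ^ n * ρ₀) atTop (𝓝 0) := by
      simpa using (tendsto_pow_atTop_nhds_zero_of_lt_one hq0.le hq1).mul_const ρ₀
    have hr : Tendsto (fun n : ℕ ↦ ENNReal.ofReal (q ^ n * ρ₀)) atTop (𝓝 0) := by
      simpa using ENNReal.tendsto_ofReal hlim0
    have hle := Measure.hausdorffMeasure_le_liminf_sum (s : ℝ) U _ hr c
      (Eventually.of_forall hdiam) (Eventually.of_forall hcU)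
    have hsum : ∀ n, ∑ i, Metric.ediam (c n i) ^ (s : ℝ) ≤
        ENNReal.ofReal ((K * q ^ (s : ℝ)) ^ n * ρ₀ ^ (s : ℝ)) := by
      intro n
      calc ∑ i, Metric.ediam (c n i) ^ (s : ℝ)
          ≤ ∑ _i : Fin n → Fin K, ENNReal.ofReal (q ^ n * ρ₀) ^ (s : ℝ) :=
            Finset.sum_le_sum fun i _ ↦ ENNReal.rpow_le_rpow (hdiam n i) s.2
        _ = _ := by
          rw [Finset.sum_const, Finset.card_univ, Fintype.card_fun, Fintype.card_fin,
            Fintype.card_fin, ENNReal.ofReal_rpow_of_nonneg (by positivity) s.coe_nonneg,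
              nsmul_eq_mul,
            ← ENNReal.ofReal_natCast, ← ENNReal.ofReal_mul (by positivity),
            Real.mul_rpow (by positivity) hρ₀.le, ← Real.rpow_natCast, ← Real.rpow_mul hq0.le,
            mul_comm (n : ℝ), Real.rpow_mul hq0.le, Real.rpow_natCast, mul_pow]
          push_cast
          ring_nf
    have hlim : Tendsto (fun n : ℕ ↦ ENNReal.ofReal ((K * q ^ (s : ℝ)) ^ n * ρ₀ ^ (s : ℝ))) atTop
        (𝓝 0) := by
      have : Tendsto (fun n : ℕ ↦ (K * q ^ (s : ℝ)) ^ n * ρ₀ ^ (s : ℝ)) atTop (𝓝 0) := by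
        simpa using (tendsto_pow_atTop_nhds_zero_of_lt_one (by positivity) hK).mul_const _
      simpa using ENNReal.tendsto_ofReal this
    have h0 : Measure.hausdorffMeasure (s : ℝ) U = 0 := by
      refine le_antisymm (hle.trans ?_) bot_le
      rw [← hlim.liminf_eq]
      exact liminf_le_liminf (Eventually.of_forall hsum)
    exact dimH_le_of_hausdorffMeasure_ne_top (by rw [h0]; simp)
  obtain ⟨t, htf, ht⟩ := Metric.totallyBounded_iff.1 hV (ρ₀ / 2) (by positivity)
  have : V = ⋃ y ∈ t, V ∩ Metric.ball y (ρ₀ / 2) := by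
    rw [← Set.inter_iUnion₂]
    exact (Set.inter_eq_left.2 ht).symm
  rw [this, dimH_bUnion htf.countable]
  refine iSup₂_le fun y _ ↦ main _ Set.inter_subset_left fun a ha b hb ↦ ?_
  have h1 := Metric.mem_ball.1 ha.2
  have h2 := Metric.mem_ball'.1 hb.2
  linarith [dist_triangle a y b]

/-! ### Visible parts of sets that are made of transversal sheets -/

lemma abs_area_sub_le {e : Plane} (he : ‖e‖ = 1) (z z' : Plane) :
    |area e z - area e z'| ≤ dist z z' := by
  rw [← area_sub_right, dist_eq_norm]
  simpa [he] using abs_area_le e (z - z')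

lemma abs_inner_sub_le {e : Plane} (he : ‖e‖ = 1) (z z' : Plane) :
    |inner ℝ e z - inner ℝ e z'| ≤ dist z z' := by
  rw [← inner_sub_right, dist_eq_norm]
  simpa [he] using abs_real_inner_le_norm e (z - z')

lemma dist_le_coord {e : Plane} (he : ‖e‖ = 1) (z z' : Plane) :
    dist z z' ≤ |inner ℝ e z - inner ℝ e z'| + |area e z - area e z'| := by
  rw [← area_sub_right, ← inner_sub_right, dist_eq_norm]
  conv_lhs => rw [Plane.decomp he (z - z')]
  refine (norm_add_le _ _).trans ?_
  simp [norm_smul, norm_quarterTurn, he]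

/-- A subset of the plane that is almost the graph of a monotone function at the scale `r`
is covered by few sets of diameter comparable to `r`. -/
lemma exists_cover_of_almost_monotone {X : Type*} {W : Set X} {T x : X → ℝ} {L M r : ℝ}
    (hL : 0 ≤ L) (hr : 0 < r) {N : ℕ} (hN : (2 + L) * M ≤ N)
    (hT : ∀ z ∈ W, ∀ z' ∈ W, |T z - T z'| ≤ M * r) (hx : ∀ z ∈ W, ∀ z' ∈ W, |x z - x z'| ≤ M * r)
    (hmono : ∀ z ∈ W, ∀ z' ∈ W, T z ≤ T z' → x z' ≤ x z + L * (T z' - T z) + r) :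
    ∃ c : Fin (2 * N + 1) → Set X, W ⊆ ⋃ i, c i ∧
      ∀ i, ∀ z ∈ c i, ∀ z' ∈ c i, |x z - x z'| + |T z - T z'| ≤ (5 + 2 * L) * r := by
  rcases W.eq_empty_or_nonempty with rfl | ⟨z₀, hz₀⟩
  · exact ⟨fun _ ↦ ∅, by simp, by simp⟩
  -- Slice by unit steps of `g`. Within a slice, for `T z ≤ T z'`, the rise `x z' - x z` is at least
  -- `(1 + L) * (T z' - T z) - r`, while `hmono` bounds it by `L * (T z' - T z) + r`; hence `T z' -
  -- T z ≤ 2 * r`. As `|g| ≤ N`, there are `2 * N + 1` slices.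
  set g : X → ℝ := fun z ↦ ((1 + L) * (T z - T z₀) - (x z - x z₀)) / r with hg
  have hgN : ∀ z ∈ W, |g z| ≤ N := by
    intro z hz
    rw [hg]
    simp only
    rw [abs_div, abs_of_pos hr, div_le_iff₀ hr]
    have h1 := abs_le.1 (hT z hz z₀ hz₀)
    have h2 := abs_le.1 (hx z hz z₀ hz₀)
    have h3 : (2 + L) * M * r ≤ N * r := mul_le_mul_of_nonneg_right hN hr.le
    rw [abs_le]
    constructor <;> nlinarith
  refine ⟨fun i ↦ {z ∈ W | ⌊g z⌋ + N = (i : ℕ)}, fun z hz ↦ ?_, ?_⟩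
  · have h1 := abs_le.1 (hgN z hz)
    have h2 : -(N : ℤ) ≤ ⌊g z⌋ := Int.le_floor.2 (by push_cast; exact h1.1)
    have h3 : ⌊g z⌋ ≤ (N : ℤ) := by
      have := (Int.floor_le (g z)).trans h1.2
      exact_mod_cast this
    refine Set.mem_iUnion.2 ⟨⟨(⌊g z⌋ + N).toNat, by omega⟩, hz, ?_⟩
    simp only
    omega
  · have key : ∀ z ∈ W, ∀ z' ∈ W, ⌊g z⌋ = ⌊g z'⌋ → T z ≤ T z' →
        |x z - x z'| + |T z - T z'| ≤ (5 + 2 * L) * r := by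
      intro z hz z' hz' hzz hle
      have h1 := abs_le.1 (Int.abs_sub_lt_one_of_floor_eq_floor hzz).le
      have h2 : g z - g z' = ((1 + L) * (T z - T z') - (x z - x z')) / r := by
        simp only [hg]; ring
      rw [h2, le_div_iff₀ hr, div_le_iff₀ hr] at h1
      have h3 := hmono z hz z' hz' hle
      have h4 : T z' - T z ≤ 2 * r := by nlinarith
      have h5 : L * (T z' - T z) ≤ L * (2 * r) := mul_le_mul_of_nonneg_left h4 hL
      rw [abs_sub_comm (T z), abs_of_nonneg (sub_nonneg.2 hle)]
      have h6 : |x z - x z'| ≤ 3 * r + 2 * L * r := by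
        rw [abs_le]; constructor <;> nlinarith
      linarith
    intro i z hz z' hz'
    have hzz : ⌊g z⌋ = ⌊g z'⌋ := by have := hz.2; have := hz'.2; omega
    rcases le_total (T z) (T z') with h | h
    · exact key z hz.1 z' hz'.1 hzz h
    · have := key z' hz'.1 z hz.1 hzz.symm h
      rwa [abs_sub_comm, abs_sub_comm (T z')] at this

/-- A sheet: a subset of `E` that projects along `e` onto an interval of length at least `ℓ`, and
that is almost the graph of an `L`-Lipschitz function at the scale `r`. -/
def IsSheet (e : Plane) (E : Set Plane) (L ℓ r : ℝ) (F : Set Plane) : Prop :=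
  F ⊆ E ∧ Convex ℝ (area e '' F) ∧ (∃ p ∈ F, ∃ q ∈ F, ℓ ≤ area e q - area e p) ∧
    ∀ z ∈ F, ∀ z' ∈ F, |inner ℝ e z - inner ℝ e z'| ≤ L * |area e z - area e z'| + r

lemma mem_of_mem_visiblePart {e : Plane} {E : Set Plane} {z : Plane} (hz : z ∈ visiblePart e E) :
    z ∈ E := by
  have : z ∈ ({z} : Set Plane) := rfl
  rw [← (show _ = _ from hz)] at this
  exact this.2

lemma inner_le_of_mem_visiblePart {e : Plane} (he : ‖e‖ = 1) {E : Set Plane} {z w : Plane}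
    (hz : z ∈ visiblePart e E) (hw : w ∈ E) (h : area e w = area e z) :
    inner ℝ e w ≤ inner ℝ e z := by
  by_contra! hlt
  have hwz : w = z + (inner ℝ e w - inner ℝ e z) • e := by
    have hz' := Plane.decomp he z
    have hw' := Plane.decomp he w
    rw [h] at hw'
    calc w = inner ℝ e w • e + area e z • quarterTurn e := hw'
      _ = (inner ℝ e z • e + area e z • quarterTurn e) +
          (inner ℝ e w - inner ℝ e z) • e := by module
      _ = _ := by rw [← hz']
  have : w ∈ ({z} : Set Plane) := by
    rw [← (show _ = _ from hz)]
    exact ⟨⟨_, (sub_pos.2 hlt).le, hwz⟩, hw⟩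
  rw [Set.mem_singleton_iff.1 this] at hlt
  exact lt_irrefl _ hlt

lemma Convex.mem_of_between {S : Set ℝ} (hS : Convex ℝ S) {a b c : ℝ} (ha : a ∈ S) (hb : b ∈ S)
    (h1 : a ≤ c) (h2 : c ≤ b) : c ∈ S :=
  hS.ordConnected.out ha hb ⟨h1, h2⟩

/-- The projection of `U` lies in an interval of length `2 * (M * r)`, so the sheet through a point
of `U` reaches the left or the right end of that interval. Each of the two classes of points is
almost monotone, which explains the two families of `2 * N + 1` pieces. -/
lemma exists_cover_visiblePart {e : Plane} (he : ‖e‖ = 1) {E : Set Plane} {L M r : ℝ}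
    (hL : 0 ≤ L) (hr : 0 < r) {N : ℕ} (hN : (2 + L) * M ≤ N)
    (hsheet : ∀ z ∈ E, ∃ F, IsSheet e E L (2 * (M * r)) r F ∧ z ∈ F)
    {U : Set Plane} (hU : U ⊆ visiblePart e E) (hd : ∀ x ∈ U, ∀ y ∈ U, dist x y ≤ M * r) :
    ∃ c : Fin ((2 * N + 1) + (2 * N + 1)) → Set Plane, U ⊆ ⋃ i, c i ∧
      ∀ i, ∀ x ∈ c i, ∀ y ∈ c i, dist x y ≤ (5 + 2 * L) * r := by
  rcases U.eq_empty_or_nonempty with rfl | ⟨z₀, hz₀⟩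
  · exact ⟨fun _ ↦ ∅, by simp, by simp⟩
  set Va : ℝ → Set Plane := fun a ↦ {z ∈ U | ∃ F, IsSheet e E L (2 * (M * r)) r F ∧ z ∈ F ∧
    a ∈ area e '' F} with hVa
  have hT : ∀ z ∈ U, ∀ z' ∈ U, |area e z - area e z'| ≤ M * r := fun z hz z' hz' ↦
    (abs_area_sub_le he z z').trans (hd z hz z' hz')
  have hX : ∀ z ∈ U, ∀ z' ∈ U, |inner ℝ e z - inner ℝ e z'| ≤ M * r := fun z hz z' hz' ↦
    (abs_inner_sub_le he z z').trans (hd z hz z' hz')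
  -- The sheet through `z'` has a point on the line through `z` parallel to `e`; that point is not
  -- beyond the visible point `z`, and is not much lower than `z'`.
  have hstep : ∀ z ∈ U, ∀ z' ∈ U, ∀ F, IsSheet e E L (2 * (M * r)) r F → z' ∈ F →
      area e z ∈ area e '' F →
      inner ℝ e z' ≤ inner ℝ e z + L * |area e z' - area e z| + r := by
    rintro z hz z' hz' F hF hz'F ⟨w, hwF, hw⟩
    have h1 := inner_le_of_mem_visiblePart he (hU hz) (hF.1 hwF) hw
    have h2 := hF.2.2.2 z' hz'F w hwF
    rw [hw] at h2
    linarith [le_abs_self (inner ℝ e z' - inner ℝ e w)]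
  obtain ⟨c₁, hc₁, hd₁⟩ := exists_cover_of_almost_monotone (W := Va (area e z₀ - M * r))
    (T := area e) (x := fun z ↦ inner ℝ e z) hL hr hN (fun z hz z' hz' ↦ hT z hz.1 z' hz'.1)
    (fun z hz z' hz' ↦ hX z hz.1 z' hz'.1) (by
      rintro z ⟨hz, -⟩ z' ⟨hz', F, hF, hz'F, haF⟩ hle
      have h0 := (abs_le.1 (hT z hz z₀ hz₀)).1
      have := hstep z hz z' hz' F hF hz'F
        (hF.2.1.mem_of_between haF ⟨z', hz'F, rfl⟩ (by linarith) hle)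
      rwa [abs_of_nonneg (sub_nonneg.2 hle)] at this)
  -- The class reaching the right end is the mirror image, with `-area e` as abscissa.
  obtain ⟨c₂, hc₂, hd₂⟩ := exists_cover_of_almost_monotone (W := Va (area e z₀ + M * r))
    (T := fun z ↦ -area e z) (x := fun z ↦ inner ℝ e z) hL hr hN
    (fun z hz z' hz' ↦ by
      have := hT z hz.1 z' hz'.1
      rwa [← abs_neg, show -(-area e z - -area e z') = area e z - area e z' by ring])
    (fun z hz z' hz' ↦ hX z hz.1 z' hz'.1) (by
      rintro z ⟨hz, -⟩ z' ⟨hz', F, hF, hz'F, haF⟩ hle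
      have h0 := (abs_le.1 (hT z hz z₀ hz₀)).2
      have := hstep z hz z' hz' F hF hz'F
        (hF.2.1.mem_of_between ⟨z', hz'F, rfl⟩ haF (by linarith) (by linarith))
      rwa [abs_of_nonpos (by linarith), show -(area e z' - area e z) = -area e z' - -area e z by
        ring] at this)
  refine ⟨fun i ↦ Sum.elim c₁ c₂ (finSumFinEquiv.symm i), fun z hz ↦ ?_, fun i ↦ ?_⟩
  · obtain ⟨F, hF, hzF⟩ := hsheet z (mem_of_mem_visiblePart (hU hz))
    obtain ⟨p, hp, q, hq, hpq⟩ := hF.2.2.1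
    have h0 := abs_le.1 (hT z hz z₀ hz₀)
    rcases le_or_gt (area e p) (area e z₀ - M * r) with h | h
    · have hmem : z ∈ Va (area e z₀ - M * r) := ⟨hz, F, hF, hzF,
        hF.2.1.mem_of_between ⟨p, hp, rfl⟩ ⟨z, hzF, rfl⟩ h (by linarith)⟩
      obtain ⟨i, hi⟩ := Set.mem_iUnion.1 (hc₁ hmem)
      exact Set.mem_iUnion.2 ⟨finSumFinEquiv (Sum.inl i), by
        simpa only [Equiv.symm_apply_apply, Sum.elim_inl, Sum.elim_inr] using hi⟩
    · have hmem : z ∈ Va (area e z₀ + M * r) := ⟨hz, F, hF, hzF,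
        hF.2.1.mem_of_between ⟨z, hzF, rfl⟩ ⟨q, hq, rfl⟩ (by linarith) (by linarith)⟩
      obtain ⟨i, hi⟩ := Set.mem_iUnion.1 (hc₂ hmem)
      exact Set.mem_iUnion.2 ⟨finSumFinEquiv (Sum.inr i), by
        simpa only [Equiv.symm_apply_apply, Sum.elim_inl, Sum.elim_inr] using hi⟩
  · obtain ⟨j, rfl⟩ := finSumFinEquiv.surjective i
    simp only [Equiv.symm_apply_apply]
    intro x hx y hy
    refine (dist_le_coord he x y).trans ?_
    rcases j with j | j
    · exact hd₁ j x hx y hy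
    · have := hd₂ j x hx y hy
      rwa [show |-area e x - -area e y| = |area e x - area e y| by
        rw [← abs_neg]; congr 1; ring] at this

/-- If every point of `E` lies, at every small scale, in a long sheet transversal to `e`, then the
visible part of `E` in direction `e` has dimension at most one. -/
theorem dimH_visiblePart_le_one {e : Plane} (he : ‖e‖ = 1) {E : Set Plane} (hE : IsCompact E)
    {L : ℝ} (hL : 0 ≤ L)
    (hsheet : ∀ M : ℝ, 0 < M → ∃ r₀ : ℝ, 0 < r₀ ∧ ∀ r, 0 < r → r < r₀ → ∀ z ∈ E,
      ∃ F, IsSheet e E L (M * r) r F ∧ z ∈ F) :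
    dimH (visiblePart e E) ≤ 1 := by
  refine le_of_forall_gt_imp_ge_of_dense fun s' hs' ↦ ?_
  rcases eq_or_ne s' ⊤ with rfl | htop
  · exact le_top
  lift s' to NNReal using htop
  have hs : 1 < (s' : ℝ) := by exact_mod_cast hs'
  -- A piece of size `ρ = M * r` splits into at most a constant times `M` pieces of size `(5 + 2 *
  -- L) * ρ / M`, so the refinement criterion asks for `C * M ^ (1 - s') < 1`. This holds for large
  -- `M` because `s' > 1`.
  set C : ℝ := (8 * (2 + L) + 6 + 4) * (5 + 2 * L) ^ (s' : ℝ)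
  have hlim : Tendsto (fun M : ℝ ↦ C * M ^ (-((s' : ℝ) - 1))) atTop (𝓝 0) := by
    simpa using (tendsto_rpow_neg_atTop (sub_pos.2 hs)).const_mul C
  obtain ⟨M, hM1, hM2⟩ := ((hlim.eventually (gt_mem_nhds one_pos)).and
    (eventually_gt_atTop (5 + 2 * L))).exists
  have hM : 0 < M := by linarith
  obtain ⟨r₀, hr₀, hr⟩ := hsheet (2 * M) (by linarith)
  set N := ⌈(2 + L) * M⌉₊
  have hN1 : (2 + L) * M ≤ N := Nat.le_ceil _
  have hN2 : (N : ℝ) < (2 + L) * M + 1 := Nat.ceil_lt_add_one (by positivity)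
  refine dimH_le_of_refine (K := (2 * N + 1) + (2 * N + 1)) (q := (5 + 2 * L) / M)
    (ρ₀ := M * (r₀ / 2)) (hE.totallyBounded.subset fun z hz ↦ mem_of_mem_visiblePart hz)
    (by positivity) ((div_lt_one hM).2 hM2) (by positivity) ?_ ?_
  · refine lt_of_le_of_lt ?_ hM1
    push_cast
    rw [Real.div_rpow (by positivity) hM.le]
    have h1 : M ^ (-((s' : ℝ) - 1)) = M / M ^ (s' : ℝ) := by
      rw [neg_sub, Real.rpow_sub hM, Real.rpow_one]
    rw [h1]
    have h2 : 2 * (N : ℝ) + 1 + (2 * N + 1) ≤ (8 * (2 + L) + 6 + 4) * M := by nlinarith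
    calc _ ≤ (8 * (2 + L) + 6 + 4) * M * ((5 + 2 * L) ^ (s' : ℝ) / M ^ (s' : ℝ)) := by gcongr
      _ = _ := by ring
  · intro ρ hρ hρ' U hU hd
    have hρM : M * (ρ / M) = ρ := by field_simp
    have h2 : ρ / M < r₀ := by
      rw [div_lt_iff₀ hM]; nlinarith
    obtain ⟨c, hc, hcd⟩ := exists_cover_visiblePart he hL (r := ρ / M) (by positivity) hN1
      (fun z hz ↦ by
        obtain ⟨F, hF, hzF⟩ := hr (ρ / M) (by positivity) h2 z hz
        exact ⟨F, by rwa [mul_assoc] at hF, hzF⟩) hU (by rwa [hρM])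
    exact ⟨c, hc, fun i x hx y hy ↦ (hcd i x hx y hy).trans (by rw [div_mul_eq_mul_div,
      mul_div_assoc])⟩

/-! ### A random digit machine -/

section Machine

variable {S : Type*} {N : ℕ} (m : S → Fin N) (next : S → Fin N → Bool → S) (s₀ : S)

/-- The state after reading a word of letters (the last letter is the head of the list). -/
def machineRun : List (Fin N × Bool) → S
  | [] => s₀
  | a :: w => next (machineRun w) a.1 a.2

/-- The number of times that the digit selected by the current state is read. -/
def machineSplits : List (Fin N × Bool) → ℕ
  | [] => 0
  | a :: w => machineSplits w + if a.1 = m (machineRun next s₀ w) then 1 else 0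

/-- The reversed prefix of length `n`. -/
def revPrefix {α : Type*} (ω : ℕ → α) : ℕ → List α
  | 0 => []
  | n + 1 => ω n :: revPrefix ω n

/-- All words of length `n`. -/
def wordsOfLength (α : Type*) [Fintype α] [DecidableEq α] : ℕ → Finset (List α)
  | 0 => {[]}
  | n + 1 => (Finset.univ ×ˢ wordsOfLength α n).image fun p ↦ p.1 :: p.2

lemma revPrefix_mem_wordsOfLength {α : Type*} [Fintype α] [DecidableEq α] (ω : ℕ → α) (n : ℕ) :
    revPrefix ω n ∈ wordsOfLength α n := by
  induction n with
  | zero => simp [revPrefix, wordsOfLength]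
  | succ n ih => simp [revPrefix, wordsOfLength, ih]

lemma eq_of_revPrefix_eq {α : Type*} {ω ω' : ℕ → α} {n : ℕ} (h : revPrefix ω n = revPrefix ω' n) :
    ∀ k < n, ω k = ω' k := by
  induction n with
  | zero => simp
  | succ n ih =>
    simp only [revPrefix, List.cons.injEq] at h
    intro k hk
    rcases Nat.lt_succ_iff_lt_or_eq.1 hk with hk | rfl
    · exact ih h.2 k hk
    · exact h.1

lemma sum_wordsOfLength_succ {α : Type*} [Fintype α] [DecidableEq α] (n : ℕ) (f : List α → ℝ) :
    ∑ w ∈ wordsOfLength α (n + 1), f w = ∑ w ∈ wordsOfLength α n, ∑ a, f (a :: w) := by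
  rw [wordsOfLength, Finset.sum_image (by rintro ⟨a, w⟩ - ⟨b, v⟩ - h; simpa using h),
    Finset.sum_product_right]

/-- Whatever the state, exactly two of the `2 * N` letters carry the selected digit, and these have
weight one half; each step multiplies the sum by `2 * N - 1`. -/
lemma sum_half_pow_machineSplits (n : ℕ) :
    ∑ w ∈ wordsOfLength (Fin N × Bool) n, (1 / 2 : ℝ) ^ machineSplits m next s₀ w =
      (2 * N - 1) ^ n := by
  induction n with
  | zero => simp [wordsOfLength, machineSplits]
  | succ n ih =>
    rw [sum_wordsOfLength_succ, pow_succ, ← ih, Finset.sum_mul]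
    refine Finset.sum_congr rfl fun w _ ↦ ?_
    simp only [machineSplits, pow_add]
    rw [← Finset.mul_sum]
    congr 1
    rw [Fintype.sum_prod_type]
    have : ∀ d : Fin N, (1 / 2 : ℝ) ^ (if d = m (machineRun next s₀ w) then 1 else 0) =
        1 - if d = m (machineRun next s₀ w) then 1 / 2 else 0 := fun d ↦ by
      split_ifs <;> norm_num
    refine (Finset.sum_congr rfl fun d _ ↦ Finset.sum_congr rfl fun _ _ ↦ this d).trans ?_
    simp only [Finset.sum_sub_distrib, Finset.sum_const, Fintype.card_bool, ← Finset.mul_sum,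
      Finset.card_univ, Fintype.card_fin,
      Finset.sum_ite_eq', Finset.mem_univ, if_true, nsmul_eq_mul]
    push_cast
    ring

/-- The uniform measure on sequences of digits and coins. -/
noncomputable def machineMeasure (N : ℕ) [NeZero N] : Measure (ℕ → Fin N × Bool) :=
  Measure.infinitePi fun _ ↦ (PMF.uniformOfFintype (Fin N × Bool)).toMeasure

instance [NeZero N] : IsProbabilityMeasure (machineMeasure N) := by
  unfold machineMeasure; infer_instance

lemma machineMeasure_box [NeZero N] (n : ℕ) (T : ℕ → Finset (Fin N × Bool)) :
    machineMeasure N {ω | ∀ k < n, ω k ∈ T k} =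
      ENNReal.ofReal (∏ k ∈ Finset.range n, (T k).card / (2 * N : ℝ)) := by
  have h1 : {ω : ℕ → Fin N × Bool | ∀ k < n, ω k ∈ T k} =
      Set.pi (Finset.range n) fun k ↦ (T k : Set (Fin N × Bool)) := by
    ext ω; simp [Set.mem_pi]
  rw [h1, machineMeasure, Measure.infinitePi_pi _ (fun _ _ ↦ MeasurableSet.of_discrete),
    ENNReal.ofReal_prod_of_nonneg (fun _ _ ↦ by positivity)]
  refine Finset.prod_congr rfl fun k _ ↦ ?_
  rw [PMF.toMeasure_uniformOfFintype_apply _ MeasurableSet.of_discrete]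
  have hN : (0 : ℝ) < 2 * N := by have := NeZero.pos N; positivity
  rw [ENNReal.ofReal_div_of_pos hN]
  congr 1
  · simp
  · rw [← Nat.cast_ofNat, ← Nat.cast_mul, ENNReal.ofReal_natCast]
    simp [Fintype.card_prod, mul_comm]

lemma machineMeasure_revPrefix_le [NeZero N] (n : ℕ) (w : List (Fin N × Bool)) :
    machineMeasure N {ω | revPrefix ω n = w} ≤ ENNReal.ofReal ((1 / (2 * N : ℝ)) ^ n) := by
  rcases Set.eq_empty_or_nonempty {ω : ℕ → Fin N × Bool | revPrefix ω n = w} with h | ⟨ω₀, h₀⟩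
  · rw [h]; simp
  calc _ ≤ machineMeasure N {ω | ∀ k < n, ω k ∈ ({ω₀ k} : Finset (Fin N × Bool))} := by
        refine measure_mono fun ω hω k hk ↦ ?_
        rw [Finset.mem_singleton]
        exact eq_of_revPrefix_eq ((show _ = _ from hω).trans (show _ = _ from h₀).symm) k hk
    _ ≤ _ := by rw [machineMeasure_box]; simp

/-- Markov's inequality for `(1 / 2) ^ machineSplits`, whose expectation is `(1 - 1 / (2 * N)) ^ n`.
-/
lemma machineMeasure_few_splits_le [NeZero N] {θ : ℝ} (hθ : 0 < θ) (n : ℕ) :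
    machineMeasure N {ω | θ ^ n ≤ (1 / 2 : ℝ) ^ machineSplits m next s₀ (revPrefix ω n)} ≤
      ENNReal.ofReal (((1 - 1 / (2 * N : ℝ)) / θ) ^ n) := by
  classical
  set B := (wordsOfLength (Fin N × Bool) n).filter
    fun w ↦ θ ^ n ≤ (1 / 2 : ℝ) ^ machineSplits m next s₀ w with hB
  have hN : (0 : ℝ) < 2 * N := by have := NeZero.pos N; positivity
  calc _ ≤ machineMeasure N (⋃ w ∈ B, {ω | revPrefix ω n = w}) := by
        refine measure_mono fun ω hω ↦ ?_
        exact Set.mem_iUnion₂.2 ⟨_, Finset.mem_filter.2 ⟨revPrefix_mem_wordsOfLength ω n, hω⟩, rfl⟩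
    _ ≤ ∑ w ∈ B, machineMeasure N {ω | revPrefix ω n = w} := measure_biUnion_finset_le _ _
    _ ≤ ∑ w ∈ B, ENNReal.ofReal ((1 / (2 * N : ℝ)) ^ n) :=
        Finset.sum_le_sum fun w _ ↦ machineMeasure_revPrefix_le n w
    _ = ENNReal.ofReal (∑ w ∈ B, (1 / (2 * N : ℝ)) ^ n) :=
        (ENNReal.ofReal_sum_of_nonneg fun _ _ ↦ by positivity).symm
    _ ≤ _ := by
      apply ENNReal.ofReal_le_ofReal
      calc ∑ w ∈ B, (1 / (2 * N : ℝ)) ^ n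
          ≤ ∑ w ∈ B, (1 / 2 : ℝ) ^ machineSplits m next s₀ w * ((1 / (2 * N : ℝ)) ^ n / θ ^ n) := by
            refine Finset.sum_le_sum fun w hw ↦ ?_
            have h1 := (Finset.mem_filter.1 hw).2
            rw [← mul_div_assoc, le_div_iff₀ (by positivity), mul_comm]
            exact mul_le_mul_of_nonneg_right h1 (by positivity)
        _ ≤ ∑ w ∈ wordsOfLength (Fin N × Bool) n,
            (1 / 2 : ℝ) ^ machineSplits m next s₀ w * ((1 / (2 * N : ℝ)) ^ n / θ ^ n) :=
            Finset.sum_le_sum_of_subset_of_nonneg (Finset.filter_subset _ _)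
              fun _ _ _ ↦ by positivity
        _ = _ := by
            rw [← Finset.sum_mul, sum_half_pow_machineSplits, ← div_pow, ← mul_pow]
            congr 1
            field_simp
            rw [sub_div, mul_div_assoc, div_self (by intro h0; rw [h0] at hN; simp at hN), mul_one]

/-- The integer with the given base `N` digits. -/
def digitIndex (ω : ℕ → Fin N × Bool) : ℕ → ℕ
  | 0 => 0
  | n + 1 => N * digitIndex ω n + (ω n).1

lemma digit_eq_of_digitIndex_eq {ω ω' : ℕ → Fin N × Bool} {n : ℕ}
    (h : digitIndex ω n = digitIndex ω' n) : ∀ k < n, (ω k).1 = (ω' k).1 := by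
  induction n with
  | zero => simp
  | succ n ih =>
    simp only [digitIndex] at h
    have h1 := (ω n).1.isLt
    have h2 := (ω' n).1.isLt
    have hpos : 0 < N := by omega
    have hd := congrArg (· / N) h
    have hm := congrArg (· % N) h
    simp only [Nat.mul_add_div hpos, Nat.mul_add_mod, Nat.div_eq_of_lt h1, Nat.div_eq_of_lt h2,
      Nat.mod_eq_of_lt h1, Nat.mod_eq_of_lt h2, add_zero] at hd hm
    intro k hk
    rcases Nat.lt_succ_iff_lt_or_eq.1 hk with hk | rfl
    · exact ih hd k hk
    · exact Fin.ext hm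

lemma prod_split_factor (ω : ℕ → Fin N × Bool) {n M : ℕ} (hnM : n ≤ M) :
    ∏ k ∈ Finset.range M, (if k < n ∧ (ω k).1 = m (machineRun next s₀ (revPrefix ω k))
      then (1 / 2 : ℝ) else 1) = (1 / 2 : ℝ) ^ machineSplits m next s₀ (revPrefix ω n) := by
  rw [← Finset.prod_subset (Finset.range_subset_range.2 hnM) (fun k _ hk ↦ by
    rw [if_neg]; rintro ⟨h, -⟩; exact hk (Finset.mem_range.2 h))]
  clear hnM
  have : ∏ k ∈ Finset.range n, (if k < n ∧ (ω k).1 = m (machineRun next s₀ (revPrefix ω k))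
      then (1 / 2 : ℝ) else 1) = ∏ k ∈ Finset.range n,
      (if (ω k).1 = m (machineRun next s₀ (revPrefix ω k)) then (1 / 2 : ℝ) else 1) :=
    Finset.prod_congr rfl fun k hk ↦ by simp [Finset.mem_range.1 hk]
  rw [this]
  clear this
  induction n with
  | zero => simp [machineSplits, revPrefix]
  | succ n ih =>
    rw [Finset.prod_range_succ, ih]
    simp only [revPrefix, machineSplits, pow_add]
    congr 1
    split_ifs <;> simp

/-- Sequences with prescribed digits up to `M`, and prescribed coins at those of the first `n` times
at which the digit read is the selected one. -/
lemma machineMeasure_path_le [NeZero N] (ω₀ : ℕ → Fin N × Bool) {n M : ℕ} (hnM : n ≤ M) :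
    machineMeasure N {ω | (∀ k < M, (ω k).1 = (ω₀ k).1) ∧
      ∀ k < n, (ω₀ k).1 = m (machineRun next s₀ (revPrefix ω₀ k)) → (ω k).2 = (ω₀ k).2} ≤
      ENNReal.ofReal ((1 / N : ℝ) ^ M *
        (1 / 2 : ℝ) ^ machineSplits m next s₀ (revPrefix ω₀ n)) := by
  classical
  have hN : (0 : ℝ) < N := by exact_mod_cast NeZero.pos N
  set T : ℕ → Finset (Fin N × Bool) := fun k ↦
    if k < n ∧ (ω₀ k).1 = m (machineRun next s₀ (revPrefix ω₀ k)) then {ω₀ k}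
    else {((ω₀ k).1, false), ((ω₀ k).1, true)} with hT
  calc _ ≤ machineMeasure N {ω | ∀ k < M, ω k ∈ T k} := by
        refine measure_mono fun ω hω k hk ↦ ?_
        have h1 := hω.1 k hk
        simp only [hT]
        split_ifs with hc
        · rw [Finset.mem_singleton]
          exact Prod.ext h1 (hω.2 k hc.1 hc.2)
        · rw [Finset.mem_insert, Finset.mem_singleton, ← h1]
          rcases h : (ω k).2 with _ | _
          · left; exact Prod.ext rfl h
          · right; exact Prod.ext rfl h
    _ ≤ _ := by
        rw [machineMeasure_box]
        apply ENNReal.ofReal_le_ofReal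
        rw [← prod_split_factor m next s₀ ω₀ hnM]
        have : (1 / N : ℝ) ^ M = ∏ _k ∈ Finset.range M, (1 / N : ℝ) := by simp
        rw [this, ← Finset.prod_mul_distrib]
        refine Finset.prod_le_prod (fun _ _ ↦ by positivity) fun k _ ↦ ?_
        simp only [hT]
        split_ifs with hc
        · simp
        · have h2 : (({((ω₀ k).1, false), ((ω₀ k).1, true)} : Finset (Fin N × Bool)).card :
          ℝ) ≤ 2 := by
            exact_mod_cast Finset.card_le_two
          rw [mul_one, div_le_div_iff₀ (by positivity) hN]
          nlinarith

end Machine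

/-! ### Sets with many sheets over an interval have dimension larger than one -/

/-- A family of compact sets such that every set of the family that projects onto an interval `J`
contains two well-separated sets of the family that both project onto one of the `N` intervals
into which `J` is divided. -/
def SplitsOverIntervals {Z : Type*} [MetricSpace Z] (𝒢 : Set (Set Z)) (π : Z → ℝ) (N κ : ℕ)
    (δ : ℝ) : Prop :=
  (∀ G ∈ 𝒢, IsCompact G) ∧
  ∀ G ∈ 𝒢, ∀ l h : ℝ, 0 < h → Set.Icc l (l + h) ⊆ π '' G → ∃ m : Fin N, ∃ G' : Bool → Set Z,
    (∀ b, G' b ∈ 𝒢 ∧ G' b ⊆ G ∧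
      Set.Icc (l + m * (h / N)) (l + m * (h / N) + h / N) ⊆ π '' G' b) ∧
    ∀ z ∈ G' false, ∀ z' ∈ G' true, δ * h ^ κ ≤ dist z z'

/-- A state is a set of the family with the left end and the length of an interval that it covers.
Reading a digit passes to a subinterval; the set is kept unless the digit is the selected one, in
which case the coin picks one of the two separated subsets. The sets and intervals are nested, so
compactness yields a point `ζ ω` for each sequence. -/
lemma exists_machine {Z : Type*} [MetricSpace Z] {𝒢 : Set (Set Z)} {π : Z → ℝ} (hπ : Continuous π)
    {N κ : ℕ} [NeZero N] {δ : ℝ} (hs : SplitsOverIntervals 𝒢 π N κ δ) {G : Set Z} (hG : G ∈ 𝒢)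
    {l h : ℝ} (hh : 0 < h) (hGl : Set.Icc l (l + h) ⊆ π '' G) :
    ∃ (m : Set Z × ℝ × ℝ → Fin N) (next : Set Z × ℝ × ℝ → Fin N → Bool → Set Z × ℝ × ℝ)
      (s₀ : Set Z × ℝ × ℝ) (ζ : (ℕ → Fin N × Bool) → Z),
      (∀ ω, ζ ω ∈ G) ∧
      (∀ ω n, π (ζ ω) ∈ Set.Icc (l + digitIndex ω n * (h / N ^ n))
        (l + digitIndex ω n * (h / N ^ n) + h / N ^ n)) ∧
      (∀ s d b b', d ≠ m s → next s d b = next s d b') ∧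
      ∀ ω ω' n, machineRun next s₀ (revPrefix ω n) = machineRun next s₀ (revPrefix ω' n) →
        (ω n).1 = m (machineRun next s₀ (revPrefix ω n)) → (ω' n).1 = (ω n).1 →
        (ω n).2 ≠ (ω' n).2 → δ * (h / N ^ n) ^ κ ≤ dist (ζ ω) (ζ ω') := by
  classical
  obtain ⟨hcpt, hs⟩ := hs
  have hN : (0 : ℝ) < N := by exact_mod_cast NeZero.pos N
  set Valid : Set Z × ℝ × ℝ → Prop := fun s ↦
    s.1 ∈ 𝒢 ∧ 0 < s.2.2 ∧ Set.Icc s.2.1 (s.2.1 + s.2.2) ⊆ π '' s.1 with hValid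
  have hs' : ∀ s : Set Z × ℝ × ℝ, Valid s → ∃ m : Fin N, ∃ G' : Bool → Set Z,
      (∀ b, G' b ∈ 𝒢 ∧ G' b ⊆ s.1 ∧
        Set.Icc (s.2.1 + m * (s.2.2 / N)) (s.2.1 + m * (s.2.2 / N) + s.2.2 / N) ⊆ π '' G' b) ∧
      ∀ z ∈ G' false, ∀ z' ∈ G' true, δ * s.2.2 ^ κ ≤ dist z z' :=
    fun s hv ↦ hs s.1 hv.1 s.2.1 s.2.2 hv.2.1 hv.2.2
  choose! m G' hG'1 hG'2 using hs'
  set next : Set Z × ℝ × ℝ → Fin N → Bool → Set Z × ℝ × ℝ := fun s d b ↦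
    (if d = m s then G' s b else s.1, s.2.1 + d * (s.2.2 / N), s.2.2 / N) with hnext
  set s₀ : Set Z × ℝ × ℝ := (G, l, h)
  set run : (ℕ → Fin N × Bool) → ℕ → Set Z × ℝ × ℝ := fun ω n ↦
    machineRun next s₀ (revPrefix ω n) with hrun
  have hstep : ∀ ω n, run ω (n + 1) = next (run ω n) (ω n).1 (ω n).2 := fun ω n ↦ rfl
  have hval : ∀ ω n, Valid (run ω n) := by
    intro ω n
    induction n with
    | zero => exact ⟨hG, hh, hGl⟩
    | succ n ih =>
      rw [hstep]
      have hpos := ih.2.1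
      refine ⟨?_, by simp only [hnext]; positivity, ?_⟩
      · simp only [hnext]
        split_ifs with hd
        · exact (hG'1 _ ih _).1
        · exact ih.1
      · simp only [hnext]
        split_ifs with hd
        · rw [hd]; exact (hG'1 _ ih _).2.2
        · refine Set.Subset.trans (Set.Icc_subset_Icc ?_ ?_) ih.2.2
          · have : 0 ≤ ((ω n).1 : ℝ) * ((run ω n).2.2 / N) := by positivity
            linarith
          · have h1 : (((ω n).1 : ℕ) : ℝ) + 1 ≤ N := by exact_mod_cast (ω n).1.isLt
            have h2 : (((ω n).1 : ℕ) + 1 : ℝ) * ((run ω n).2.2 / N) ≤ N * ((run ω n).2.2 / N) :=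
              mul_le_mul_of_nonneg_right h1 (by positivity)
            rw [mul_div_cancel₀ _ hN.ne'] at h2
            linarith
  have hsub : ∀ ω n, (run ω (n + 1)).1 ⊆ (run ω n).1 := by
    intro ω n
    rw [hstep]
    simp only [hnext]
    split_ifs with hd
    · exact (hG'1 _ (hval ω n) _).2.1
    · exact subset_rfl
  have hlen : ∀ ω n, (run ω n).2.2 = h / N ^ n := by
    intro ω n
    induction n with
    | zero => simp [hrun, revPrefix, machineRun, s₀]
    | succ n ih =>
      rw [hstep]
      simp only [hnext]
      rw [ih, pow_succ, div_div]
  have hleft : ∀ ω n, (run ω n).2.1 = l + digitIndex ω n * (h / N ^ n) := by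
    intro ω n
    induction n with
    | zero => simp [hrun, revPrefix, machineRun, s₀, digitIndex]
    | succ n ih =>
      rw [hstep]
      simp only [hnext, digitIndex]
      rw [ih, hlen]
      push_cast
      field_simp
      ring
  have hIcc : ∀ ω n, Set.Icc (run ω (n + 1)).2.1 ((run ω (n + 1)).2.1 + (run ω (n + 1)).2.2) ⊆
      Set.Icc (run ω n).2.1 ((run ω n).2.1 + (run ω n).2.2) := by
    intro ω n
    have hpos := (hval ω n).2.1
    rw [hstep]
    simp only [hnext]
    refine Set.Icc_subset_Icc ?_ ?_
    · have : 0 ≤ ((ω n).1 : ℝ) * ((run ω n).2.2 / N) := by positivity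
      linarith
    · have h1 : (((ω n).1 : ℕ) : ℝ) + 1 ≤ N := by exact_mod_cast (ω n).1.isLt
      have h2 : (((ω n).1 : ℕ) + 1 : ℝ) * ((run ω n).2.2 / N) ≤ N * ((run ω n).2.2 / N) :=
        mul_le_mul_of_nonneg_right h1 (by positivity)
      rw [mul_div_cancel₀ _ hN.ne'] at h2
      linarith
  have hpt : ∀ ω, ∃ z, ∀ n, z ∈ (run ω n).1 ∧
      π z ∈ Set.Icc (run ω n).2.1 ((run ω n).2.1 + (run ω n).2.2) := by
    intro ω
    set K : ℕ → Set Z := fun n ↦ (run ω n).1 ∩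
      π ⁻¹' Set.Icc (run ω n).2.1 ((run ω n).2.1 + (run ω n).2.2) with hK
    have hKc : ∀ n, IsCompact (K n) := fun n ↦
      (hcpt _ (hval ω n).1).inter_right (isClosed_Icc.preimage hπ)
    obtain ⟨z, hz⟩ := IsCompact.nonempty_iInter_of_sequence_nonempty_isCompact_isClosed K
      (fun n z hz ↦ ⟨hsub ω n hz.1, hIcc ω n hz.2⟩)
      (fun n ↦ by
        obtain ⟨z, hz, hzl⟩ := (hval ω n).2.2
          (Set.left_mem_Icc.2 (by linarith [(hval ω n).2.1]))
        exact ⟨z, hz, by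
          rw [Set.mem_preimage, hzl]
          exact Set.left_mem_Icc.2 (by linarith [(hval ω n).2.1])⟩)
      (hKc 0) (fun n ↦ (hKc n).isClosed)
    exact ⟨z, fun n ↦ Set.mem_iInter.1 hz n⟩
  choose ζ hζ using hpt
  refine ⟨m, next, s₀, ζ, fun ω ↦ (hζ ω 0).1, fun ω n ↦ ?_, fun s d b b' hd ↦ ?_, ?_⟩
  · have := (hζ ω n).2
    rwa [hlen, hleft] at this
  · simp [hnext, hd]
  · intro ω ω' n hω hm hd hb
    have h1 := (hζ ω (n + 1)).1
    have h2 := (hζ ω' (n + 1)).1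
    change run ω n = run ω' n at hω
    change _ = m (run ω n) at hm
    rw [hstep] at h1 h2
    rw [hd, ← hω] at h2
    simp only [hnext, if_pos hm] at h1 h2
    have h3 := hG'2 (run ω n) (hval ω n)
    rw [hlen] at h3
    rcases hb1 : (ω n).2 with _ | _ <;> rcases hb2 : (ω' n).2 with _ | _
    · exact absurd (hb1.trans hb2.symm) hb
    · rw [hb1] at h1; rw [hb2] at h2; exact h3 _ h1 _ h2
    · rw [hb1] at h1; rw [hb2] at h2; rw [dist_comm]; exact h3 _ h2 _ h1
    · exact absurd (hb1.trans hb2.symm) hb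

/-- A set of diameter `r` determines the first `M` digits up to five choices, as its projection is
no longer than a grid cell. Given the digits, it also determines the coins at the splits among the
first `n` steps: two different outcomes would be separated by more than `r`. -/
lemma machineMeasure_preimage_le {Z : Type*} [MetricSpace Z] {π : Z → ℝ} {Λ : ℝ} (hΛ : 0 ≤ Λ)
    (hπ : ∀ z z', |π z - π z'| ≤ Λ * dist z z') {S : Type*} {N κ : ℕ} [NeZero N] {δ l h : ℝ}
    (hh : 0 < h) {m : S → Fin N} {next : S → Fin N → Bool → S} {s₀ : S}
    {ζ : (ℕ → Fin N × Bool) → Z}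
    (hζ : ∀ ω n, π (ζ ω) ∈ Set.Icc (l + digitIndex ω n * (h / N ^ n))
        (l + digitIndex ω n * (h / N ^ n) + h / N ^ n))
    (hcoin : ∀ s d b b', d ≠ m s → next s d b = next s d b')
    (hsep : ∀ ω ω' n, machineRun next s₀ (revPrefix ω n) = machineRun next s₀ (revPrefix ω' n) →
        (ω n).1 = m (machineRun next s₀ (revPrefix ω n)) → (ω' n).1 = (ω n).1 →
        (ω n).2 ≠ (ω' n).2 → δ * (h / N ^ n) ^ κ ≤ dist (ζ ω) (ζ ω'))
    {U : Set Z} {r : ℝ} (hU : ∀ x ∈ U, ∀ y ∈ U, dist x y ≤ r) {n M : ℕ} (hnM : n ≤ M)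
    (hr : Λ * r ≤ h / N ^ M) (hr' : ∀ k < n, r < δ * (h / N ^ k) ^ κ) {θ : ℝ} :
    machineMeasure N {ω | ζ ω ∈ U ∧
      (1 / 2 : ℝ) ^ machineSplits m next s₀ (revPrefix ω n) < θ ^ n} ≤
      ENNReal.ofReal (5 * ((1 / N : ℝ) ^ M * θ ^ n)) := by
  set A := {ω | ζ ω ∈ U ∧ (1 / 2 : ℝ) ^ machineSplits m next s₀ (revPrefix ω n) < θ ^ n} with hA
  have hN : (0 : ℝ) < N := by exact_mod_cast NeZero.pos N
  have hcell : ∀ i : ℕ, machineMeasure N {ω | ω ∈ A ∧ digitIndex ω M = i} ≤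
      ENNReal.ofReal ((1 / N : ℝ) ^ M * θ ^ n) := by
    intro i
    rcases Set.eq_empty_or_nonempty {ω | ω ∈ A ∧ digitIndex ω M = i} with h0 | ⟨ω₀, hω₀, hi₀⟩
    · rw [h0]; simp
    refine (measure_mono fun ω hω ↦ ?_).trans
      ((machineMeasure_path_le m next s₀ ω₀ hnM).trans (ENNReal.ofReal_le_ofReal
        (mul_le_mul_of_nonneg_left hω₀.2.le (by positivity))))
    obtain ⟨hωA, hi⟩ := hω
    have hdig := digit_eq_of_digitIndex_eq (hi.trans hi₀.symm)
    -- States and relevant coins must be compared together: equal states are needed to invoke the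
    -- separation, and equal relevant coins to keep the states equal, since irrelevant coins do not
    -- influence the state.
    have hpath : ∀ k ≤ n, machineRun next s₀ (revPrefix ω₀ k) =
        machineRun next s₀ (revPrefix ω k) ∧ ∀ j < k,
          (ω₀ j).1 = m (machineRun next s₀ (revPrefix ω₀ j)) → (ω j).2 = (ω₀ j).2 := by
      intro k
      induction k with
      | zero => intro _; exact ⟨rfl, by simp⟩
      | succ k ih =>
        intro hk
        obtain ⟨ih1, ih2⟩ := ih (by omega)
        have hk' : k < n := by omega
        have hdk := hdig k (by omega)
        have hc : (ω₀ k).1 = m (machineRun next s₀ (revPrefix ω₀ k)) → (ω k).2 = (ω₀ k).2 := by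
          intro hm
          by_contra hne
          have h1 := hsep ω₀ ω k ih1 hm hdk (Ne.symm hne)
          have h2 := hU _ hω₀.1 _ hωA.1
          linarith [hr' k hk']
        refine ⟨?_, fun j hj ↦ ?_⟩
        · simp only [revPrefix, machineRun]
          rw [← ih1, hdk]
          by_cases hm : (ω₀ k).1 = m (machineRun next s₀ (revPrefix ω₀ k))
          · rw [hc hm]
          · exact hcoin _ _ _ _ hm
        · rcases Nat.lt_succ_iff_lt_or_eq.1 hj with hj | rfl
          · exact ih2 j hj
          · exact hc
    exact ⟨hdig, (hpath n le_rfl).2⟩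
  rcases A.eq_empty_or_nonempty with h0 | ⟨ω₀, hω₀⟩
  · rw [h0]; simp
  have hcover : A ⊆ ⋃ j ∈ Finset.range 5,
    {ω | ω ∈ A ∧ digitIndex ω M = digitIndex ω₀ M + j - 2} := by
    intro ω hω
    have h1 := hζ ω M
    have h2 := hζ ω₀ M
    have h3 := abs_le.1 ((hπ (ζ ω) (ζ ω₀)).trans
      ((mul_le_mul_of_nonneg_left (hU _ hω.1 _ hω₀.1) hΛ).trans hr))
    have hpos : 0 < h / (N : ℝ) ^ M := by positivity
    have h4 : (digitIndex ω M : ℝ) ≤ digitIndex ω₀ M + 2 := by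
      by_contra! hc
      nlinarith [h1.1, h2.2]
    have h5 : (digitIndex ω₀ M : ℝ) ≤ digitIndex ω M + 2 := by
      by_contra! hc
      nlinarith [h1.2, h2.1]
    have h4' : digitIndex ω M ≤ digitIndex ω₀ M + 2 := by exact_mod_cast h4
    have h5' : digitIndex ω₀ M ≤ digitIndex ω M + 2 := by exact_mod_cast h5
    refine Set.mem_iUnion₂.2 ⟨digitIndex ω M + 2 - digitIndex ω₀ M,
      Finset.mem_range.2 (by omega), hω, by omega⟩
  calc machineMeasure N A ≤ ∑ j ∈ Finset.range 5,
        machineMeasure N {ω | ω ∈ A ∧ digitIndex ω M = digitIndex ω₀ M + j - 2} :=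
        (measure_mono hcover).trans (measure_biUnion_finset_le _ _)
    _ ≤ ∑ j ∈ Finset.range 5, ENNReal.ofReal ((1 / N : ℝ) ^ M * θ ^ n) :=
        Finset.sum_le_sum fun j _ ↦ hcell _
    _ = _ := by
        rw [Finset.sum_const, Finset.card_range, nsmul_eq_mul,
          ENNReal.ofReal_mul (by norm_num)]
        norm_num

/-- The mass distribution principle, for the image of a measure on a set of parameters. -/
lemma le_dimH_of_preimage_le {Ω Z : Type*} [MeasurableSpace Ω] [MetricSpace Z] (P : Measure Ω)
    (ζ : Ω → Z) {G : Set Z} {B : Set Ω} (hB : P B ≠ 0) (hBG : ∀ ω ∈ B, ζ ω ∈ G)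
    {s : NNReal} {C : NNReal} (hC : C ≠ 0) {r₀ : ENNReal} (hr₀ : 0 < r₀)
    (h : ∀ U : Set Z, Metric.ediam U ≤ r₀ → P (B ∩ ζ ⁻¹' U) ≤ C * Metric.ediam U ^ (s : ℝ)) :
    s ≤ dimH G := by
  borelize Z
  apply le_dimH_of_hausdorffMeasure_ne_zero
  -- An outer measure suffices for comparison with the Hausdorff measure, so `ζ` and `B` need not be
  -- measurable.
  set ν : OuterMeasure Z := (C⁻¹ : NNReal) • OuterMeasure.map ζ
    (OuterMeasure.restrict B P.toOuterMeasure)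
    with hν
  have hνU : ∀ U, ν U = (C⁻¹ : NNReal) * P (B ∩ ζ ⁻¹' U) := by
    intro U
    rw [hν, Set.inter_comm]
    simp [ENNReal.smul_def]
  have hle : ν ≤ OuterMeasure.mkMetric fun r ↦ r ^ (s : ℝ) := by
    apply OuterMeasure.le_mkMetric _ _ r₀ hr₀
    intro U hU
    rw [hνU]
    calc _ ≤ ((C⁻¹ : NNReal) : ENNReal) * (C * Metric.ediam U ^ (s : ℝ)) := by gcongr; exact h U hU
      _ = _ := by
        rw [← mul_assoc, ← ENNReal.coe_mul, inv_mul_cancel₀ hC, ENNReal.coe_one, one_mul]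
  have h1 := hle G
  rw [OuterMeasure.coe_mkMetric, hνU] at h1
  intro h0
  change Measure.mkMetric _ G = 0 at h0
  rw [h0, nonpos_iff_eq_zero, mul_eq_zero] at h1
  rcases h1 with h1 | h1
  · simp [hC] at h1
  · apply hB
    rwa [Set.inter_eq_left.2 (show B ⊆ ζ ⁻¹' G from hBG)] at h1

/-- The digits alone give the random point a mass distribution of exponent one. Outside an
exceptional set of sequences the coins contribute a further factor `θ ^ n` at scale `b⁻¹ ^ n`, that
is, the additional exponent `ε`. -/
theorem SplitsOverIntervals.one_lt_dimH {Z : Type*} [MetricSpace Z] {𝒢 : Set (Set Z)} {π : Z → ℝ}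
    {Λ : ℝ} (hΛ : 0 < Λ) (hπ : ∀ z z', |π z - π z'| ≤ Λ * dist z z') {N κ : ℕ} (hN : 2 ≤ N)
    (hκ : 0 < κ) {δ : ℝ} (hδ : 0 < δ) (hs : SplitsOverIntervals 𝒢 π N κ δ) {G : Set Z}
    (hG : G ∈ 𝒢) {l h : ℝ} (hh : 0 < h) (hGl : Set.Icc l (l + h) ⊆ π '' G) : 1 < dimH G := by
  have : NeZero N := ⟨by omega⟩
  have hπc : Continuous π :=
    (LipschitzWith.of_dist_le_mul (K := ⟨Λ, hΛ.le⟩) fun x y ↦ by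
      rw [Real.dist_eq]; exact hπ x y).continuous
  obtain ⟨m, next, s₀, ζ, hζG, hζ, hcoin, hsep⟩ := exists_machine hπc hs hG hh hGl
  have hN0 : (0 : ℝ) < N := by positivity
  have hN1 : (1 : ℝ) < N := by exact_mod_cast (by omega : 1 < N)
  set ρ : ℝ := 1 - 1 / (2 * N : ℝ) with hρ
  have hρ0 : 0 < ρ := by
    have : 1 / (2 * N : ℝ) < 1 := by rw [div_lt_one (by positivity)]; linarith
    linarith
  have hρ1 : ρ < 1 := by
    have : 0 < 1 / (2 * N : ℝ) := by positivity
    linarith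
  -- With this choice `ρ / θ = θ`, so the sequences with too few splits at time `n` have probability
  -- at most `θ ^ n`, which is summable.
  set θ : ℝ := √ρ with hθ
  have hθ0 : 0 < θ := Real.sqrt_pos.2 hρ0
  have hθ1 : θ < 1 := by rw [hθ, Real.sqrt_lt' one_pos]; simpa using hρ1
  have hρθ : ρ / θ = θ := Real.div_sqrt
  -- At scale `N ^ (-2 * κ * n)`, one factor `N ^ (-κ * n)` matches the separation at all splits
  -- before time `n`, and the other absorbs the constants `δ` and `h`. Meanwhile `2 * κ * n` digits
  -- are determined.
  set b : ℝ := (N : ℝ) ^ (2 * κ) with hb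
  have hb1 : 1 < b := one_lt_pow₀ hN1 (by omega)
  have hb0 : 0 < b := one_pos.trans hb1
  set ε : ℝ := -Real.log θ / Real.log b with hε
  have hlogb : 0 < Real.log b := Real.log_pos hb1
  have hε0 : 0 < ε := div_pos (neg_pos.2 (Real.log_neg hθ0 hθ1)) hlogb
  have hbε : (b⁻¹) ^ ε = θ := by
    rw [Real.inv_rpow hb0.le, ← Real.rpow_neg hb0.le, Real.rpow_def_of_pos hb0, hε]
    rw [show Real.log b * -(-Real.log θ / Real.log b) = Real.log θ by field_simp,
      Real.exp_log hθ0]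
  obtain ⟨n₁, hn₁, hn₁'⟩ : ∃ n₁ : ℕ, θ ^ n₁ / (1 - θ) < 1 ∧
      ∀ n ≥ n₁, h / Λ * (N : ℝ)⁻¹ ^ (κ * n) < δ * h ^ κ := by
    have h1 : Tendsto (fun n : ℕ ↦ θ ^ n / (1 - θ)) atTop (𝓝 0) := by
      simpa using (tendsto_pow_atTop_nhds_zero_of_lt_one hθ0.le hθ1).div_const (1 - θ)
    have h2 : Tendsto (fun n : ℕ ↦ h / Λ * (N : ℝ)⁻¹ ^ (κ * n)) atTop (𝓝 0) := by
      have : Tendsto (fun n : ℕ ↦ h / Λ * ((N : ℝ)⁻¹ ^ κ) ^ n) atTop (𝓝 0) := by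
        simpa using (tendsto_pow_atTop_nhds_zero_of_lt_one (r := (N : ℝ)⁻¹ ^ κ) (by positivity)
          (pow_lt_one₀ (by positivity) (inv_lt_one_of_one_lt₀ hN1) hκ.ne')).const_mul (h / Λ)
      simpa only [pow_mul] using this
    obtain ⟨n₂, hn₂⟩ := eventually_atTop.1
      ((h1.eventually (gt_mem_nhds one_pos)).and
        (h2.eventually (gt_mem_nhds (by positivity : 0 < δ * h ^ κ))))
    exact ⟨n₂, (hn₂ n₂ le_rfl).1, fun n hn ↦ (hn₂ n hn).2⟩
  set Bad : ℕ → Set (ℕ → Fin N × Bool) := fun n ↦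
    {ω | θ ^ n ≤ (1 / 2 : ℝ) ^ machineSplits m next s₀ (revPrefix ω n)} with hBad
  have hBadP : ∀ n, machineMeasure N (Bad n) ≤ ENNReal.ofReal (θ ^ n) := by
    intro n
    have := machineMeasure_few_splits_le m next s₀ hθ0 n
    rwa [← hρ, hρθ] at this
  set B : Set (ℕ → Fin N × Bool) := (⋃ n, Bad (n + n₁))ᶜ with hB
  have hBpos : machineMeasure N B ≠ 0 := by
    intro h0
    have h1 : machineMeasure N (⋃ n, Bad (n + n₁)) < 1 := by
      calc _ ≤ ∑' n, machineMeasure N (Bad (n + n₁)) := measure_iUnion_le _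
        _ ≤ ∑' n, ENNReal.ofReal (θ ^ (n + n₁)) := ENNReal.tsum_le_tsum fun n ↦ hBadP _
        _ = ENNReal.ofReal (∑' n, θ ^ (n + n₁)) := by
            refine (ENNReal.ofReal_tsum_of_nonneg (fun _ ↦ by positivity) ?_).symm
            exact (summable_nat_add_iff n₁).2 (summable_geometric_of_lt_one hθ0.le hθ1)
        _ = ENNReal.ofReal (θ ^ n₁ / (1 - θ)) := by
            simp_rw [pow_add]
            rw [tsum_mul_right, tsum_geometric_of_lt_one hθ0.le hθ1]
            congr 1
            rw [div_eq_mul_inv, mul_comm]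
        _ < 1 := by rwa [ENNReal.ofReal_lt_one]
    have h2 : machineMeasure N Set.univ ≤ machineMeasure N (⋃ n, Bad (n + n₁)) +
        machineMeasure N B := by
      rw [hB, ← Set.union_compl_self (⋃ n, Bad (n + n₁))]
      exact measure_union_le _ _
    rw [h0, add_zero, measure_univ] at h2
    exact absurd h1 (not_lt.2 h2)
  set s : NNReal := Real.toNNReal (1 + ε)
  have hscoe : (s : ℝ) = 1 + ε := Real.coe_toNNReal _ (by positivity)
  have hs1 : 1 < s := by
    rw [← NNReal.coe_lt_coe, hscoe]; simpa using hε0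
  have hpow : ∀ n : ℕ, (1 / N : ℝ) ^ (2 * κ * n) * θ ^ n = (b⁻¹ ^ n) ^ (1 + ε) := by
    intro n
    have h1 : (b⁻¹ ^ n) ^ ε = θ ^ n := by
      rw [← Real.rpow_natCast b⁻¹ n, ← Real.rpow_mul (by positivity), mul_comm,
        Real.rpow_mul (by positivity), hbε, Real.rpow_natCast]
    rw [Real.rpow_add (by positivity), Real.rpow_one, h1, hb, one_div, inv_pow, inv_pow, pow_mul]
  have hbound : ∀ n ≥ n₁, ∀ (U : Set Z) (r : ℝ), (∀ x ∈ U, ∀ y ∈ U, dist x y ≤ r) →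
      r ≤ h / Λ * b⁻¹ ^ n →
      machineMeasure N (B ∩ ζ ⁻¹' U) ≤ ENNReal.ofReal (5 * (b⁻¹ ^ n) ^ (1 + ε)) := by
    intro n hn U r hU hr
    have hbn : b⁻¹ ^ n = (N : ℝ)⁻¹ ^ (κ * n) * (N : ℝ)⁻¹ ^ (κ * n) := by
      rw [hb, ← pow_add, inv_pow, inv_pow, ← pow_mul]; congr 2; ring
    rw [← hpow]
    refine (measure_mono ?_).trans (machineMeasure_preimage_le hΛ.le hπ hh hζ hcoin hsep hU
      (n := n) (M := 2 * κ * n) (by nlinarith) ?_ ?_)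
    · rintro ω ⟨hωB, hωU⟩
      refine ⟨hωU, ?_⟩
      by_contra! hc
      exact hωB (Set.mem_iUnion.2 ⟨n - n₁, by rwa [Nat.sub_add_cancel hn]⟩)
    · calc Λ * r ≤ Λ * (h / Λ * b⁻¹ ^ n) := by gcongr
        _ = h / N ^ (2 * κ * n) := by
            rw [show b⁻¹ ^ n = ((N : ℝ) ^ (2 * κ * n))⁻¹ by rw [hb, inv_pow, ← pow_mul]]
            field_simp
    · intro k hk
      have h1 : (N : ℝ)⁻¹ ^ (κ * n) ≤ (N : ℝ)⁻¹ ^ (κ * k) :=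
        pow_le_pow_of_le_one (by positivity) (inv_le_one_of_one_le₀ hN1.le)
          (Nat.mul_le_mul_left κ hk.le)
      have h2 : δ * (h / N ^ k) ^ κ = δ * h ^ κ * (N : ℝ)⁻¹ ^ (κ * k) := by
        rw [div_pow, ← pow_mul, mul_comm k κ, inv_pow]; field_simp
      rw [h2]
      calc r ≤ h / Λ * (N : ℝ)⁻¹ ^ (κ * n) * (N : ℝ)⁻¹ ^ (κ * n) := by
            rw [mul_assoc, ← hbn]; exact hr
        _ < δ * h ^ κ * (N : ℝ)⁻¹ ^ (κ * n) := by
            have := hn₁' n hn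
            gcongr
        _ ≤ _ := by gcongr
  set C : ℝ := 5 * (b * (Λ / h)) ^ (1 + ε) with hC
  have hC0 : 0 < C := by positivity
  refine (ENNReal.coe_lt_coe.2 hs1).trans_le ?_
  refine le_dimH_of_preimage_le (machineMeasure N) ζ hBpos (fun ω _ ↦ hζG ω)
    (C := C.toNNReal) (Real.toNNReal_pos.2 hC0).ne'
    (r₀ := ENNReal.ofReal (h / Λ * b⁻¹ ^ n₁)) (by rw [ENNReal.ofReal_pos]; positivity) ?_
  intro U hU
  have hfin : Metric.ediam U ≠ ⊤ := ne_top_of_le_ne_top ENNReal.ofReal_ne_top hU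
  set r := (Metric.ediam U).toReal with hr
  have hUr : ∀ x ∈ U, ∀ y ∈ U, dist x y ≤ r := by
    intro x hx y hy
    rw [dist_edist]
    exact ENNReal.toReal_mono hfin (Metric.edist_le_ediam_of_mem hx hy)
  have hr1 : r ≤ h / Λ * b⁻¹ ^ n₁ := ENNReal.toReal_le_of_le_ofReal (by positivity) hU
  have hed : Metric.ediam U = ENNReal.ofReal r := (ENNReal.ofReal_toReal hfin).symm
  have hbinv1 : b⁻¹ < 1 := inv_lt_one_of_one_lt₀ hb1
  have hr00 : 0 ≤ r := ENNReal.toReal_nonneg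
  rcases hr00.eq_or_lt with hr0 | hr0
  -- A set of diameter zero satisfies the bound at every scale, so its mass vanishes.
  · have h0 : machineMeasure N (B ∩ ζ ⁻¹' U) ≤ 0 := by
      have hlim : Tendsto (fun n : ℕ ↦ ENNReal.ofReal (5 * (b⁻¹ ^ n) ^ (1 + ε))) atTop (𝓝 0) := by
        have h1 : Tendsto (fun n : ℕ ↦ (b⁻¹ ^ n) ^ (1 + ε)) atTop (𝓝 (0 ^ (1 + ε))) :=
          (tendsto_pow_atTop_nhds_zero_of_lt_one (by positivity) hbinv1).rpow_const
            (Or.inr (by positivity))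
        rw [Real.zero_rpow (by positivity)] at h1
        simpa using ENNReal.tendsto_ofReal (h1.const_mul 5)
      refine ge_of_tendsto hlim (eventually_atTop.2 ⟨n₁, fun n hn ↦ ?_⟩)
      exact hbound n hn U r hUr (by rw [← hr0]; positivity)
    exact h0.trans bot_le
  · have hx1 : r * (Λ / h) ≤ b⁻¹ ^ n₁ := by
      calc r * (Λ / h) ≤ h / Λ * b⁻¹ ^ n₁ * (Λ / h) := by gcongr
        _ = _ := by field_simp
    obtain ⟨n, hn1, hn2⟩ := exists_nat_pow_near_of_lt_one (x := r * (Λ / h)) (y := b⁻¹)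
      (by positivity) (hx1.trans (pow_le_one₀ (by positivity) hbinv1.le)) (by positivity) hbinv1
    have hn : n₁ ≤ n := by
      by_contra! hc
      have : b⁻¹ ^ n₁ ≤ b⁻¹ ^ (n + 1) := pow_le_pow_of_le_one (by positivity) hbinv1.le hc
      linarith
    refine (hbound n hn U r hUr ?_).trans ?_
    · calc r = h / Λ * (r * (Λ / h)) := by field_simp
        _ ≤ _ := by gcongr
    · rw [hed, hscoe, ENNReal.ofReal_rpow_of_nonneg hr0.le (by positivity)]
      change _ ≤ ENNReal.ofReal C * _
      rw [← ENNReal.ofReal_mul hC0.le]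
      apply ENNReal.ofReal_le_ofReal
      rw [hC, mul_assoc, ← Real.mul_rpow (by positivity) hr0.le]
      gcongr
      calc b⁻¹ ^ n = b * b⁻¹ ^ (n + 1) := by rw [pow_succ]; field_simp
        _ ≤ b * (r * (Λ / h)) := by gcongr
        _ = _ := by ring

namespace AffineIFS

variable {κ : ℕ} (Φ : AffineIFS κ)

/-! ### Words -/

@[simp] lemma wordLin_nil : Φ.wordLin [] = 1 := rfl

lemma wordLin_cons (i : Fin κ) (w : List (Fin κ)) :
    Φ.wordLin (i :: w) = Φ.lin i * Φ.wordLin w := by simp [wordLin]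

lemma wordLin_append (w v : List (Fin κ)) :
    Φ.wordLin (w ++ v) = Φ.wordLin w * Φ.wordLin v := by simp [wordLin]

lemma wordLin_singleton (i : Fin κ) : Φ.wordLin [i] = Φ.lin i := by simp [wordLin]

@[simp] lemma wordMap_nil : Φ.wordMap [] = id := rfl

lemma wordMap_cons (i : Fin κ) (w : List (Fin κ)) :
    Φ.wordMap (i :: w) = Φ.map i ∘ Φ.wordMap w := rfl

lemma wordMap_append (w v : List (Fin κ)) :
    Φ.wordMap (w ++ v) = Φ.wordMap w ∘ Φ.wordMap v := by
  induction w with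
  | nil => rfl
  | cons i w ih => rw [List.cons_append, wordMap_cons, ih, wordMap_cons]; rfl

lemma wordMap_eq (w : List (Fin κ)) (x : Plane) :
    Φ.wordMap w x = Φ.wordLin w x + Φ.wordMap w 0 := by
  induction w with
  | nil => simp
  | cons i w ih =>
    rw [wordMap_cons, Function.comp_apply, ih, wordLin_cons]
    simp only [map, map_add, Function.comp_apply]
    rw [add_assoc]
    rfl

lemma continuous_wordMap (w : List (Fin κ)) : Continuous (Φ.wordMap w) := by
  have : Φ.wordMap w = fun x ↦ Φ.wordLin w x + Φ.wordMap w 0 := funext (Φ.wordMap_eq w)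
  rw [this]; fun_prop

lemma wordMap_sub (w : List (Fin κ)) (x y : Plane) :
    Φ.wordMap w x - Φ.wordMap w y = Φ.wordLin w (x - y) := by
  rw [Φ.wordMap_eq w x, Φ.wordMap_eq w y, map_sub]; abel

lemma planeDet_wordLin_ne_zero (w : List (Fin κ)) : planeDet (Φ.wordLin w) ≠ 0 := by
  induction w with
  | nil => simp [planeDet_one]
  | cons i w ih =>
    rw [wordLin_cons, planeDet_mul]
    exact mul_ne_zero (planeDet_ne_zero (Φ.lin_bijective i)) ih

@[simp] lemma length_wordPrefix (i : ℕ → Fin κ) (n : ℕ) : (wordPrefix i n).length = n := by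
  simp [wordPrefix]

@[simp] lemma wordPrefix_zero (i : ℕ → Fin κ) : wordPrefix i 0 = [] := by simp [wordPrefix]

lemma wordPrefix_succ (i : ℕ → Fin κ) (n : ℕ) :
    wordPrefix i (n + 1) = wordPrefix i n ++ [i n] := by
  simp [wordPrefix, List.ofFn_succ', -List.ofFn_succ]

lemma exists_norm_lin_le : ∃ ρ : ℝ, 0 < ρ ∧ ρ < 1 ∧ ∀ i, ‖Φ.lin i‖ ≤ ρ := by
  rcases isEmpty_or_nonempty (Fin κ) with h | h
  · exact ⟨1 / 2, by norm_num, by norm_num, fun i ↦ h.elim i⟩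
  · obtain ⟨j, hj⟩ := Finite.exists_max fun i ↦ ‖Φ.lin i‖
    exact ⟨‖Φ.lin j‖, norm_pos_of_det (planeDet_ne_zero (Φ.lin_bijective j)),
      Φ.lin_contractive j, hj⟩

lemma norm_wordLin_le {ρ : ℝ} (hρ : 0 ≤ ρ) (h : ∀ i, ‖Φ.lin i‖ ≤ ρ) (w : List (Fin κ)) :
    ‖Φ.wordLin w‖ ≤ ρ ^ w.length := by
  induction w with
  | nil =>
    simp
  | cons i w ih =>
    rw [wordLin_cons, List.length_cons, pow_succ']
    exact (norm_mul_le _ _).trans (mul_le_mul (h i) ih (norm_nonneg _) hρ)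

variable {Φ} {E : Set Plane}

lemma IsSelfAffineSet.exists_letter (hE : Φ.IsSelfAffineSet E) {x : Plane} (hx : x ∈ E) :
    ∃ i, ∃ y ∈ E, Φ.map i y = x := by
  rw [hE.2.2] at hx
  obtain ⟨i, hi⟩ := Set.mem_iUnion.1 hx
  exact ⟨i, hi⟩

lemma IsSelfAffineSet.wordMap_mem (hE : Φ.IsSelfAffineSet E) (w : List (Fin κ)) {x : Plane}
    (hx : x ∈ E) : Φ.wordMap w x ∈ E := by
  induction w with
  | nil => exact hx
  | cons i w ih =>
    rw [hE.2.2]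
    exact Set.mem_iUnion.2 ⟨i, _, ih, rfl⟩

lemma IsSelfAffineSet.image_append_subset (hE : Φ.IsSelfAffineSet E) (w v : List (Fin κ)) :
    Φ.wordMap (w ++ v) '' E ⊆ Φ.wordMap w '' E := by
  rintro _ ⟨x, hx, rfl⟩
  rw [wordMap_append]
  exact ⟨_, hE.wordMap_mem v hx, rfl⟩

lemma IsSelfAffineSet.isCompact_image (hE : Φ.IsSelfAffineSet E) (w : List (Fin κ)) :
    IsCompact (Φ.wordMap w '' E) := hE.2.1.image (Φ.continuous_wordMap w)

lemma IsSelfAffineSet.exists_code (hE : Φ.IsSelfAffineSet E) {x : Plane} (hx : x ∈ E) :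
    ∃ i : ℕ → Fin κ, ∀ n, x ∈ Φ.wordMap (wordPrefix i n) '' E := by
  have := fun y : E ↦ hE.exists_letter y.2
  choose f g hg hfg using this
  set y : ℕ → E := fun n ↦ Nat.rec ⟨x, hx⟩ (fun _ z ↦ ⟨g z, hg z⟩) n with hy
  refine ⟨fun n ↦ f (y n), fun n ↦ ⟨y n, (y n).2, ?_⟩⟩
  induction n with
  | zero => simp [hy]
  | succ n ih =>
    rw [wordPrefix_succ, wordMap_append, Function.comp_apply]
    convert ih using 2
    exact hfg (y n)

lemma IsSelfAffineSet.exists_code_append (hE : Φ.IsSelfAffineSet E) (u : List (Fin κ)) {x : Plane}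
    (hx : x ∈ Φ.wordMap u '' E) :
    ∃ i : ℕ → Fin κ, ∀ n, x ∈ Φ.wordMap (u ++ wordPrefix i n) '' E := by
  obtain ⟨y, hy, rfl⟩ := hx
  obtain ⟨i, hi⟩ := hE.exists_code hy
  refine ⟨i, fun n ↦ ?_⟩
  rw [wordMap_append, Set.image_comp]
  exact ⟨y, hi n, rfl⟩

/-! ### Orientations of long words -/

/-- Consequences of dominated splitting: unit vectors `U w` that span the orientations of the long
words, with exponentially small angles between the orientations of words and of their
extensions. -/
structure HasOrientations (Φ : AffineIFS κ) (q C : ℝ) (n₀ : ℕ) (U : List (Fin κ) → Plane) :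
    Prop where
  pos : 0 < q
  lt_one : q < 1
  nonneg : 0 ≤ C
  principal : ∀ w, n₀ ≤ w.length → IsPrincipal (Φ.wordLin w) (U w)
  orientation : ∀ w, n₀ ≤ w.length → orientation1 (Φ.wordLin w) = Submodule.span ℝ {U w}
  ratio : ∀ w, n₀ ≤ w.length → |planeDet (Φ.wordLin w)| ≤ q ^ w.length * ‖Φ.wordLin w‖ ^ 2
  cauchy : ∀ w v, n₀ ≤ w.length → |area (U w) (U (w ++ v))| ≤ C * q ^ w.length

/-- Appending one letter moves the orientation of a word of length `n` by at most `B * q ^ n`, where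
`B` bounds `‖A_i‖ ^ 2 / |det A_i|`. Summing the geometric series gives `C = B / (1 - q)`. -/
lemma Dominated.exists_hasOrientations (h : Φ.Dominated) :
    ∃ q C n₀ U, Φ.HasOrientations q C n₀ U := by
  obtain ⟨τ, hτ, n₀, hdom⟩ := h
  have hτ0 : 0 < τ := one_pos.trans hτ
  have hlt : ∀ w : List (Fin κ), n₀ ≤ w.length → alpha2 (Φ.wordLin w) < alpha1 (Φ.wordLin w) :=
    fun w hw ↦ (le_mul_of_one_le_left (alpha2_nonneg _) (one_le_pow₀ hτ.le)).trans_lt (hdom w hw)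
  have hex := fun w : List (Fin κ) ↦ fun hw ↦ exists_isPrincipal_orientation1 (hlt w hw)
  choose! U hU1 hU2 using hex
  set q := τ⁻¹
  have hq0 : 0 < q := inv_pos.2 hτ0
  have hq1 : q < 1 := inv_lt_one_of_one_lt₀ hτ
  have hratio : ∀ w, n₀ ≤ w.length →
      |planeDet (Φ.wordLin w)| ≤ q ^ w.length * ‖Φ.wordLin w‖ ^ 2 := by
    intro w hw
    have h1 := hdom w hw
    rw [← alpha1_mul_alpha2, ← alpha1_eq_norm]
    have h2 : alpha2 (Φ.wordLin w) ≤ q ^ w.length * alpha1 (Φ.wordLin w) := by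
      rw [inv_pow, inv_mul_eq_div, le_div_iff₀ (by positivity), mul_comm]
      exact h1.le
    have h3 := mul_le_mul_of_nonneg_left h2 (alpha1_nonneg (Φ.wordLin w))
    linarith
  obtain ⟨B, hB0, hB⟩ : ∃ B : ℝ, 0 ≤ B ∧ ∀ i, ‖Φ.lin i‖ ^ 2 ≤ B * |planeDet (Φ.lin i)| := by
    have hd := fun i ↦ abs_pos.2 (planeDet_ne_zero (Φ.lin_bijective i))
    rcases isEmpty_or_nonempty (Fin κ) with he | he
    · exact ⟨0, le_rfl, fun i ↦ he.elim i⟩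
    · obtain ⟨j, hj⟩ := Finite.exists_max fun i ↦ ‖Φ.lin i‖ ^ 2 / |planeDet (Φ.lin i)|
      exact ⟨_, by positivity, fun i ↦ (div_le_iff₀ (hd i)).1 (hj i)⟩
  have hone : ∀ w i, n₀ ≤ w.length → |area (U w) (U (w ++ [i]))| ≤ B * q ^ w.length := by
    intro w i hw
    have h2 := hU1 (w ++ [i]) (by simp; omega)
    rw [wordLin_append, wordLin_singleton] at h2
    have h1 := (hU1 w hw).abs_area_mul_le h2
    have hA := norm_pos_of_det (Φ.planeDet_wordLin_ne_zero w)
    have hd := abs_pos.2 (planeDet_ne_zero (Φ.lin_bijective i))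
    have hpos : 0 < ‖Φ.wordLin w‖ ^ 2 * |planeDet (Φ.lin i)| := by positivity
    refine le_of_mul_le_mul_left ?_ hpos
    calc _ ≤ |planeDet (Φ.wordLin w)| * ‖Φ.lin i‖ ^ 2 := h1
      _ ≤ (q ^ w.length * ‖Φ.wordLin w‖ ^ 2) * (B * |planeDet (Φ.lin i)|) :=
          mul_le_mul (hratio w hw) (hB i) (by positivity) (by positivity)
      _ = _ := by ring
  refine ⟨q, B / (1 - q), n₀, U, hq0, hq1, div_nonneg hB0 (by linarith), hU1, hU2, hratio, ?_⟩
  have h1q : 0 < 1 - q := by linarith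
  have hsum : ∀ v w, n₀ ≤ w.length →
      |area (U w) (U (w ++ v))| ≤ B * q ^ w.length * ((1 - q ^ v.length) / (1 - q)) := by
    intro v
    induction v using List.reverseRecOn with
    | nil => intro w hw; simp
    | append_singleton v i ih =>
      intro w hw
      have h1 := ih w hw
      have hwv : n₀ ≤ (w ++ v).length := by simp; omega
      have h2 := hone (w ++ v) i hwv
      have h3 := abs_area_triangle (hU1 w hw).1 (hU1 _ hwv).1
        (hU1 (w ++ v ++ [i]) (by simp; omega)).1
      rw [← List.append_assoc]
      refine (h3.trans (add_le_add h1 h2)).trans (le_of_eq ?_)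
      simp only [List.length_append, List.length_cons, List.length_nil, pow_add, zero_add, pow_one]
      field_simp
      ring
  intro w v hw
  refine (hsum v w hw).trans ?_
  calc _ ≤ B * q ^ w.length * (1 / (1 - q)) := by
        gcongr
        have : 0 ≤ q ^ v.length := by positivity
        linarith
    _ = _ := by ring

namespace HasOrientations

variable {q C : ℝ} {n₀ : ℕ} {U : List (Fin κ) → Plane}

lemma norm_eq (H : Φ.HasOrientations q C n₀ U) {w : List (Fin κ)} (hw : n₀ ≤ w.length) :
    ‖U w‖ = 1 := (H.principal w hw).1

lemma isLimitOrientation_iff (H : Φ.HasOrientations q C n₀ U) {f : Plane} (hf : f ≠ 0) (i :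
    ℕ → Fin κ) :
    Φ.IsLimitOrientation i (Submodule.span ℝ {f}) ↔
      Tendsto (fun n ↦ |area (U (wordPrefix i n)) f|) atTop (𝓝 0) := by
  have hfn : 0 < ‖f‖ := norm_pos_iff.2 hf
  set g : Plane := ‖f‖⁻¹ • f with hg
  have hgn : ‖g‖ = 1 := by
    rw [hg, norm_smul, norm_inv, norm_norm, inv_mul_cancel₀ hfn.ne']
  have hspan : Submodule.span ℝ {f} = Submodule.span ℝ {g} :=
    (Submodule.span_singleton_smul_eq (IsUnit.mk0 _ (inv_ne_zero hfn.ne')) f).symm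
  have harea : ∀ w, |area (U w) g| = ‖f‖⁻¹ * |area (U w) f| := fun w ↦ by
    rw [hg, area_smul_right, abs_mul, abs_of_pos (inv_pos.2 hfn)]
  have hev : ∀ᶠ n in atTop, lineAngle (orientation1 (Φ.wordLin (wordPrefix i n)))
      (Submodule.span ℝ {f}) = lineAngle (Submodule.span ℝ {U (wordPrefix i n)})
        (Submodule.span ℝ {g}) := by
    filter_upwards [eventually_ge_atTop n₀] with n hn
    rw [H.orientation _ (by simpa using hn), hspan]
  have hnorm : ∀ᶠ n in atTop, ‖U (wordPrefix i n)‖ = 1 := by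
    filter_upwards [eventually_ge_atTop n₀] with n hn
    exact H.norm_eq (by simpa using hn)
  constructor
  · rintro ⟨-, h⟩
    have h1 := h.congr' hev
    have h2 : Tendsto (fun n ↦ |area (U (wordPrefix i n)) g|) atTop (𝓝 0) := by
      refine squeeze_zero' (Eventually.of_forall fun _ ↦ abs_nonneg _) ?_ h1
      filter_upwards [hnorm] with n hn using abs_area_le_lineAngle hn hgn
    have h3 := h2.const_mul ‖f‖
    rw [mul_zero] at h3
    refine h3.congr fun n ↦ ?_
    rw [harea, ← mul_assoc, mul_inv_cancel₀ hfn.ne', one_mul]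
  · intro h
    refine ⟨finrank_span_singleton hf, Tendsto.congr' (hev.mono fun _ h ↦ h.symm) ?_⟩
    have h1 := (h.const_mul ‖f‖⁻¹).const_mul (Real.pi / 2)
    rw [mul_zero, mul_zero] at h1
    refine squeeze_zero' ?_ ?_ h1
    · filter_upwards [hnorm] with n hn using lineAngle_nonneg hn hgn
    · filter_upwards [hnorm] with n hn
      rw [← harea]
      exact lineAngle_le_abs_area hn hgn

/-- Prepending `w` to an infinite word maps its limit orientation by `A_w`, because the orientation
of `w ++ v` is exponentially close to `A_w (U v)` as `v` grows. -/
lemma tendsto_area_append (H : Φ.HasOrientations q C n₀ U) {f : Plane} {i : ℕ → Fin κ} (w : List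
    (Fin κ))
    (h : Tendsto (fun n ↦ |area (U (wordPrefix i n)) f|) atTop (𝓝 0)) :
    Tendsto (fun n ↦ |area (U (w ++ wordPrefix i n)) (Φ.wordLin w f)|) atTop (𝓝 0) := by
  set A := Φ.wordLin w with hA
  have hdet : planeDet A ≠ 0 := Φ.planeDet_wordLin_ne_zero w
  have hd : 0 < |planeDet A| := abs_pos.2 hdet
  have hn := norm_pos_of_det hdet
  have hlim : Tendsto (fun n ↦ (‖A‖ * q ^ n * ‖A f‖ + |planeDet A| *
      |area (U (wordPrefix i n)) f|) * (‖A‖ / |planeDet A|)) atTop (𝓝 0) := by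
    have h1 := (((tendsto_pow_atTop_nhds_zero_of_lt_one H.pos.le H.lt_one).const_mul
      ‖A‖).mul_const ‖A f‖).add (h.const_mul |planeDet A|)
    have h2 := h1.mul_const (‖A‖ / |planeDet A|)
    simpa using h2
  refine squeeze_zero' (Eventually.of_forall fun _ ↦ abs_nonneg _) ?_ hlim
  filter_upwards [eventually_ge_atTop n₀] with n hn₀
  set v := wordPrefix i n
  have hv : n₀ ≤ v.length := by simpa [v] using hn₀
  have hvn : v.length = n := length_wordPrefix i n
  have hwv : n₀ ≤ (w ++ v).length := by simp; omega
  have hp := H.principal v hv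
  have hp2 := H.principal _ hwv
  rw [wordLin_append, ← hA] at hp2
  have h1 := hp.abs_area_map_le hp2 hdet
  have hB := norm_pos_of_det (Φ.planeDet_wordLin_ne_zero v)
  have h2 : |area (U (w ++ v)) (A (U v))| ≤ ‖A‖ * q ^ n := by
    have h3 := H.ratio v hv
    rw [hvn] at h3
    have h4 : 0 < ‖Φ.wordLin v‖ ^ 2 := by positivity
    refine le_of_mul_le_mul_left (h1.trans ?_) h4
    calc _ ≤ ‖A‖ * (q ^ n * ‖Φ.wordLin v‖ ^ 2) := by gcongr
      _ = _ := by ring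
  have h3 : |planeDet A| ≤ ‖A‖ * ‖A (U v)‖ := by
    have := abs_planeDet_mul_norm_le A (U v)
    rwa [hp.1, mul_one] at this
  have h4 := abs_area_mul_norm_le (U (w ++ v)) (A (U v)) (A f)
  rw [hp2.1, mul_one, area_map, abs_mul] at h4
  have h5 : 0 ≤ |area (U (w ++ v)) (A f)| := abs_nonneg _
  rw [← mul_div_assoc, le_div_iff₀ hd]
  calc _ ≤ |area (U (w ++ v)) (A f)| * (‖A‖ * ‖A (U v)‖) := by gcongr
    _ = (|area (U (w ++ v)) (A f)| * ‖A (U v)‖) * ‖A‖ := by ring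
    _ ≤ (|area (U (w ++ v)) (A (U v))| * ‖A f‖ + |planeDet A| * |area (U v) f|) * ‖A‖ := by gcongr
    _ ≤ _ := by gcongr

/-- The image under `A_w` of a limit orientation is exponentially close to the orientation
of `w`. -/
lemma abs_area_le_of_mem (H : Φ.HasOrientations q C n₀ U) {f : Plane} (hf : f ≠ 0)
    (hfK : Submodule.span ℝ {f} ∈ Φ.limitOrientations) {w : List (Fin κ)} (hw : n₀ ≤ w.length) :
    |area (U w) (Φ.wordLin w f)| ≤ C * q ^ w.length * ‖Φ.wordLin w f‖ := by
  obtain ⟨i, hi⟩ := hfK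
  have h1 := H.tendsto_area_append w ((H.isLimitOrientation_iff hf i).1 hi)
  have h2 := h1.const_add (C * q ^ w.length * ‖Φ.wordLin w f‖)
  rw [add_zero] at h2
  refine ge_of_tendsto h2 (Eventually.of_forall fun n ↦ ?_)
  have hwv : n₀ ≤ (w ++ wordPrefix i n).length := by simp; omega
  have h3 := abs_area_mul_norm_le (U w) (U (w ++ wordPrefix i n)) (Φ.wordLin w f)
  rw [H.norm_eq hw, H.norm_eq hwv, mul_one, mul_one] at h3
  refine h3.trans (add_le_add_left (mul_le_mul_of_nonneg_right (H.cauchy _ _ hw) (norm_nonneg _)) _)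

lemma notMem_of_forall_le (H : Φ.HasOrientations q C n₀ U) {f : Plane} (hf : f ≠ 0) {w : List
    (Fin κ)} {δ : ℝ} (hδ : 0 < δ)
    (h : ∀ v : List (Fin κ), δ ≤ |area (U (w ++ v)) (Φ.wordLin w f)|) :
    Submodule.span ℝ {f} ∉ Φ.limitOrientations := by
  rintro ⟨i, hi⟩
  have h1 := H.tendsto_area_append w ((H.isLimitOrientation_iff hf i).1 hi)
  exact absurd (ge_of_tendsto h1 (Eventually.of_forall fun n ↦ h _)) (not_le.2 hδ)

/-- A direction whose orientation is not a limit orientation is uniformly transversal to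
the orientations of all long words. -/
lemma exists_le_abs_area (H : Φ.HasOrientations q C n₀ U) {e : Plane} (he : ‖e‖ = 1)
    (heK : Submodule.span ℝ {e} ∉ Φ.limitOrientations) :
    ∃ δ > 0, ∃ n, n₀ ≤ n ∧ ∀ v : List (Fin κ), n ≤ v.length → δ ≤ |area (U v) e| := by
  by_contra! hcon
  apply heK
  -- König's lemma: `Q w` says that `w` has arbitrarily long extensions with orientation arbitrarily
  -- close to `e`. It passes to some one-letter extension, and along the resulting infinite word the
  -- Cauchy estimate forces convergence to `⟨e⟩`.
  set Q : List (Fin κ) → Prop := fun w ↦ ∀ δ > 0, ∀ n, n₀ ≤ n → ∃ v : List (Fin κ), n ≤ v.length ∧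
    |area (U (w ++ v)) e| < δ with hQ
  have hQ0 : Q [] := hcon
  have hQs : ∀ w, Q w → ∃ i, Q (w ++ [i]) := by
    intro w hw
    by_contra! hno
    simp only [hQ] at hno
    push Not at hno
    choose δ hδ n hn hnv using hno
    rcases isEmpty_or_nonempty (Fin κ) with hem | hne
    · obtain ⟨v, hv, -⟩ := hw 1 one_pos (n₀ + 1) (by omega)
      rcases v with _ | ⟨i, v⟩
      · simp at hv
      · exact hem.elim i
    · obtain ⟨j, hj⟩ := Finite.exists_min δ
      obtain ⟨k, hk⟩ := Finite.exists_max n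
      obtain ⟨v, hv, hva⟩ := hw (δ j) (hδ j) (n k + 1) (by have := hn k; omega)
      rcases v with _ | ⟨i, v⟩
      · simp at hv
      · have h1 := hnv i v (by have := hk i; simp at hv; omega)
        have h2 := hj i
        rw [List.append_assoc, List.singleton_append] at h1
        linarith
  have hne : Nonempty (Fin κ) := (hQs [] hQ0).nonempty
  choose! g hg using hQs
  set W : ℕ → List (Fin κ) := fun n ↦ Nat.rec [] (fun _ w ↦ w ++ [g w]) n with hW
  have hWQ : ∀ n, Q (W n) := by
    intro n
    induction n with
    | zero => exact hQ0
    | succ n ih => exact hg _ ih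
  set i : ℕ → Fin κ := fun n ↦ g (W n)
  have hWp : ∀ n, wordPrefix i n = W n := by
    intro n
    induction n with
    | zero => simp [hW]
    | succ n ih => rw [wordPrefix_succ, ih]
  have he0 : e ≠ 0 := by rintro rfl; simp at he
  refine ⟨i, (H.isLimitOrientation_iff he0 i).2 ?_⟩
  have hlim : Tendsto (fun n ↦ C * q ^ n) atTop (𝓝 0) := by
    simpa using (tendsto_pow_atTop_nhds_zero_of_lt_one H.pos.le H.lt_one).const_mul C
  refine squeeze_zero' (Eventually.of_forall fun _ ↦ abs_nonneg _) ?_ hlim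
  filter_upwards [eventually_ge_atTop n₀] with n hn
  refine le_of_forall_pos_le_add fun δ hδ ↦ ?_
  obtain ⟨v, hv, hva⟩ := hWQ n δ hδ n₀ le_rfl
  rw [← hWp] at hva
  have h1 : n₀ ≤ (wordPrefix i n).length := by simpa using hn
  have h2 : n₀ ≤ (wordPrefix i n ++ v).length := by simp; omega
  have h3 := H.cauchy (wordPrefix i n) v h1
  rw [length_wordPrefix] at h3
  have h4 := abs_area_triangle (H.norm_eq h1) (H.norm_eq h2) he
  linarith

end HasOrientations

end AffineIFS

/-! ### Visible parts in transversal directions -/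

/-- Take three non-collinear points of `E`: no direction is nearly parallel to both of two sides of
the triangle. -/
lemma exists_width {E : Set Plane} (hE : ¬ ∃ x v : Plane, E ⊆ {y | ∃ t : ℝ, y = x + t • v}) :
    ∃ ω : ℝ, 0 < ω ∧ ∀ f : Plane, ∃ p ∈ E, ∃ q ∈ E, ω * ‖f‖ ≤ area f q - area f p := by
  push Not at hE
  obtain ⟨x, hx, -⟩ := Set.not_subset.1 (hE 0 0)
  obtain ⟨p, hp, hpx⟩ := Set.not_subset.1 (hE x 0)
  have hP : p - x ≠ 0 := fun h ↦ hpx ⟨0, by rw [sub_eq_zero.1 h]; simp⟩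
  obtain ⟨q, hq, hqx⟩ := Set.not_subset.1 (hE x (p - x))
  have hPQ : area (p - x) (q - x) ≠ 0 := by
    intro h
    obtain ⟨t, ht⟩ := mem_span_of_area_eq_zero hP h
    exact hqx ⟨t, by rw [← ht]; abel⟩
  have hsum : 0 < ‖p - x‖ + ‖q - x‖ := by positivity
  refine ⟨|area (p - x) (q - x)| / (‖p - x‖ + ‖q - x‖), by positivity, fun f ↦ ?_⟩
  have h1 := abs_area_mul_norm_le (p - x) f (q - x)
  rw [abs_area_comm (p - x) f] at h1
  have key : ∀ y ∈ E, |area (p - x) (q - x)| * ‖f‖ ≤ |area f (y - x)| * (‖p - x‖ + ‖q - x‖) →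
      ∃ p' ∈ E, ∃ q' ∈ E, |area (p - x) (q - x)| / (‖p - x‖ + ‖q - x‖) * ‖f‖ ≤
        area f q' - area f p' := by
    intro y hy h
    rw [area_sub_right f] at h
    rcases le_total 0 (area f y - area f x) with h0 | h0
    · refine ⟨x, hx, y, hy, ?_⟩
      rw [div_mul_eq_mul_div, div_le_iff₀ hsum]
      rwa [abs_of_nonneg h0] at h
    · refine ⟨y, hy, x, hx, ?_⟩
      rw [div_mul_eq_mul_div, div_le_iff₀ hsum]
      rwa [abs_of_nonpos h0, neg_sub] at h
  rcases le_total (|area f (p - x)|) (|area f (q - x)|) with h | h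
  · refine key q hq (h1.trans ?_)
    nlinarith [norm_nonneg (p - x), norm_nonneg (q - x)]
  · refine key p hp (h1.trans ?_)
    nlinarith [norm_nonneg (p - x), norm_nonneg (q - x)]

lemma dimH_le_one_of_subset_line {E : Set Plane} {x v : Plane}
    (h : E ⊆ {y | ∃ t : ℝ, y = x + t • v}) : dimH E ≤ 1 := by
  have h1 : E ⊆ (fun t : ℝ ↦ x + t • v) '' Set.univ := by
    intro y hy
    obtain ⟨t, ht⟩ := h hy
    exact ⟨t, trivial, ht.symm⟩
  have h2 : ContDiff ℝ 1 fun t : ℝ ↦ x + t • v := by fun_prop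
  calc dimH E ≤ dimH ((fun t : ℝ ↦ x + t • v) '' Set.univ) := dimH_mono h1
    _ = dimH (Set.range fun t : ℝ ↦ x + t • v) := by rw [Set.image_univ]
    _ ≤ Module.finrank ℝ ℝ := h2.dimH_range_le
    _ = 1 := by simp

/-- Apply the adjugate to the decomposition of `A u` along `e` and its normal. The image of a
bounded set thus lies near a graph over the normal, with slope of order `‖A‖ / ‖planeAdj A e‖` and
thickness of order `|det A| / ‖planeAdj A e‖`. -/
lemma abs_inner_map_mul_le {e : Plane} (he : ‖e‖ = 1) (A : Plane →L[ℝ] Plane) (u : Plane) :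
    |inner ℝ e (A u)| * ‖planeAdj A e‖ ≤ |planeDet A| * ‖u‖ + |area e (A u)| * ‖A‖ := by
  have h1 := Plane.decomp he (A u)
  have h2 := planeAdj_map A u
  rw [h1, planeAdj_add, planeAdj_smul, planeAdj_smul] at h2
  have h3 : inner ℝ e (A u) • planeAdj A e =
      planeDet A • u - area e (A u) • planeAdj A (quarterTurn e) := by rw [← h2]; abel
  calc |inner ℝ e (A u)| * ‖planeAdj A e‖ = ‖inner ℝ e (A u) • planeAdj A e‖ := by
        rw [norm_smul, Real.norm_eq_abs]
    _ ≤ ‖planeDet A • u‖ + ‖area e (A u) • planeAdj A (quarterTurn e)‖ := by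
        rw [h3]; exact norm_sub_le _ _
    _ ≤ _ := by
        rw [norm_smul, norm_smul, Real.norm_eq_abs, Real.norm_eq_abs]
        gcongr
        refine (norm_planeAdj_le _ _).trans ?_
        rw [norm_quarterTurn, he, mul_one]

namespace AffineIFS

variable {κ : ℕ} {Φ : AffineIFS κ} {E : Set Plane}

lemma exists_pow_le_abs_planeDet (Φ : AffineIFS κ) :
    ∃ d : ℝ, 0 < d ∧ d ≤ 1 ∧ (∀ i, d ≤ |planeDet (Φ.lin i)|) ∧
      ∀ w, d ^ w.length ≤ |planeDet (Φ.wordLin w)| := by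
  obtain ⟨d, hd0, hd1, hd⟩ : ∃ d : ℝ, 0 < d ∧ d ≤ 1 ∧ ∀ i, d ≤ |planeDet (Φ.lin i)| := by
    have hpos := fun i ↦ abs_pos.2 (planeDet_ne_zero (Φ.lin_bijective i))
    rcases isEmpty_or_nonempty (Fin κ) with h | h
    · exact ⟨1, one_pos, le_rfl, fun i ↦ h.elim i⟩
    · obtain ⟨j, hj⟩ := Finite.exists_min fun i ↦ |planeDet (Φ.lin i)|
      exact ⟨min 1 |planeDet (Φ.lin j)|, lt_min one_pos (hpos j), min_le_left _ _,
        fun i ↦ (min_le_right _ _).trans (hj i)⟩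
  refine ⟨d, hd0, hd1, hd, fun w ↦ ?_⟩
  induction w with
  | nil => simp [planeDet_one]
  | cons i w ih =>
    rw [wordLin_cons, planeDet_mul, abs_mul, List.length_cons, pow_succ']
    exact mul_le_mul (hd i) ih (by positivity) (abs_nonneg _)

lemma ProjectionCondition.exists_convex_area (hproj : Φ.ProjectionCondition E) {f : Plane}
    (hf : f ≠ 0) (hfK : Submodule.span ℝ {f} ∉ Φ.limitOrientations) :
    ∃ n₀ : ℕ, ∀ w : List (Fin κ), n₀ ≤ w.length →
      Convex ℝ (area f '' (Φ.wordMap w '' E)) ∧ (area f '' (Φ.wordMap w '' E)).Nontrivial := by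
  have hfn : 0 < ‖f‖ := norm_pos_iff.2 hf
  set g : Plane := ‖f‖⁻¹ • f with hg
  have hgn : ‖g‖ = 1 := by
    rw [hg, norm_smul, norm_inv, norm_norm, inv_mul_cancel₀ hfn.ne']
  have hspan : Submodule.span ℝ {f} = Submodule.span ℝ {g} :=
    (Submodule.span_singleton_smul_eq (IsUnit.mk0 _ (inv_ne_zero hfn.ne')) f).symm
  rw [hspan] at hfK
  obtain ⟨n₀, hn₀⟩ := hproj.2 g hgn hfK
  refine ⟨n₀, fun w hw ↦ ?_⟩
  obtain ⟨h1, h2⟩ := hn₀ w hw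
  obtain ⟨h3, h4⟩ := area_image_of_projAlong hgn h1 h2
  have hfg : ∀ z, area f z = ‖f‖ * area g z := fun z ↦ by
    rw [hg, area_smul_left, ← mul_assoc, mul_inv_cancel₀ hfn.ne', one_mul]
  have himg : area f '' (Φ.wordMap w '' E) = (fun t ↦ ‖f‖ * t) '' (area g ''
    (Φ.wordMap w '' E)) := by
    rw [show area f = (fun t ↦ ‖f‖ * t) ∘ area g from funext hfg, Set.image_comp]
  rw [himg]
  refine ⟨?_, h4.image fun a b h ↦ mul_left_cancel₀ hfn.ne' h⟩
  exact h3.is_linear_image (f := fun t : ℝ ↦ ‖f‖ * t)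
    ⟨fun a b ↦ mul_add _ _ _, fun a b ↦ by simp only [smul_eq_mul]; ring⟩

theorem dimH_visiblePart_le_one_of_notMem (hE : Φ.IsSelfAffineSet E) (hdom : Φ.Dominated)
    (hproj : Φ.ProjectionCondition E)
    (hline : ¬ ∃ x v : Plane, E ⊆ {y | ∃ t : ℝ, y = x + t • v})
    {e : Plane} (he : ‖e‖ = 1) (heK : Submodule.span ℝ {e} ∉ Φ.limitOrientations) :
    dimH (visiblePart e E) ≤ 1 := by
  obtain ⟨q, C, n₀, U, H⟩ := hdom.exists_hasOrientations
  obtain ⟨δ, hδ, n₁, hn₁, hδU⟩ := H.exists_le_abs_area he heK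
  have he0 : e ≠ 0 := by rintro rfl; simp at he
  obtain ⟨n₂, hn₂⟩ := hproj.exists_convex_area he0 heK
  obtain ⟨ω, hω, hωE⟩ := exists_width hline
  obtain ⟨ρ, hρ0, hρ1, hρ⟩ := Φ.exists_norm_lin_le
  obtain ⟨d, hd0, hd1, hd, hdw⟩ := Φ.exists_pow_le_abs_planeDet
  obtain ⟨D, hD, hDE⟩ : ∃ D : ℝ, 0 < D ∧ ∀ z ∈ E, ∀ z' ∈ E, ‖z - z'‖ ≤ D := by
    obtain ⟨D, hD⟩ := hE.2.1.isBounded.exists_norm_le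
    refine ⟨|D| + |D| + 1, by positivity, fun z hz z' hz' ↦ (norm_sub_le _ _).trans ?_⟩
    have h1 := hD z hz
    have h2 := hD z' hz'
    have h3 := le_abs_self D
    linarith
  refine dimH_visiblePart_le_one (L := 1 / δ) he hE.2.1 (by positivity) fun M hM ↦ ?_
  obtain ⟨n₃, hn₃⟩ : ∃ n₃ : ℕ, ∀ n, n₃ ≤ n → M * D * q ^ n ≤ ω * δ ^ 2 * d := by
    have h1 := (tendsto_pow_atTop_nhds_zero_of_lt_one H.pos.le H.lt_one).const_mul (M * D)
    rw [mul_zero] at h1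
    exact eventually_atTop.1 (h1.eventually (ge_mem_nhds (by positivity)))
  set N := max (max n₁ n₂) n₃ with hN
  have hA1 : ∀ w : List (Fin κ), ‖Φ.wordLin w‖ ≤ 1 := fun w ↦
    (Φ.norm_wordLin_le hρ0.le hρ w).trans (pow_le_one₀ hρ0.le hρ1.le)
  have hApos : ∀ w : List (Fin κ), 0 < ‖Φ.wordLin w‖ := fun w ↦
    norm_pos_of_det (Φ.planeDet_wordLin_ne_zero w)
  have hdet : ∀ w : List (Fin κ), n₀ ≤ w.length → |planeDet (Φ.wordLin w)| ≤ ‖Φ.wordLin w‖ ^ 2 :=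
    fun w hw ↦ (H.ratio w hw).trans
      (mul_le_of_le_one_left (by positivity) (pow_le_one₀ H.pos.le H.lt_one.le))
  -- Transversality gives `‖planeAdj A e‖ ≥ δ * ‖A‖`, so the cylinder has thickness at most `D *
  -- |det A| / (δ * ‖A‖)`, slope at most `1 / δ`, and projected length at least `ω * δ * ‖A‖`.
  have hsheet : ∀ w : List (Fin κ), N ≤ w.length → ∀ r ℓ,
      D * |planeDet (Φ.wordLin w)| ≤ r * (δ * ‖Φ.wordLin w‖) → ℓ ≤ ω * (δ * ‖Φ.wordLin w‖) →
      IsSheet e E (1 / δ) ℓ r (Φ.wordMap w '' E) := by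
    intro w hw r ℓ hr hℓ
    set A := Φ.wordLin w with hA
    have hAw := hApos w
    have hadj : δ * ‖A‖ ≤ ‖planeAdj A e‖ := by
      have h1 := (H.principal w (by omega)).mul_norm_le_planeAdj (e := e)
      rw [abs_area_comm] at h1
      exact (mul_le_mul_of_nonneg_right (hδU w (by omega)) (norm_nonneg _)).trans h1
    refine ⟨by rintro _ ⟨x, hx, rfl⟩; exact hE.wordMap_mem w hx, (hn₂ w (by omega)).1, ?_, ?_⟩
    · obtain ⟨p, hp, p', hp', hpp⟩ := hωE (planeAdj A e)
      refine ⟨_, ⟨p, hp, rfl⟩, _, ⟨p', hp', rfl⟩, ?_⟩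
      rw [← area_sub_right, wordMap_sub, area_map_right, area_sub_right]
      exact hℓ.trans ((mul_le_mul_of_nonneg_left hadj hω.le).trans hpp)
    · rintro _ ⟨z, hz, rfl⟩ _ ⟨z', hz', rfl⟩
      rw [← area_sub_right, ← inner_sub_right, wordMap_sub]
      have h1 := abs_inner_map_mul_le he A (z - z')
      have h2 : |inner ℝ e (A (z - z'))| * (δ * ‖A‖) ≤
          r * (δ * ‖A‖) + |area e (A (z - z'))| * ‖A‖ := by
        refine (mul_le_mul_of_nonneg_left hadj (abs_nonneg _)).trans (h1.trans ?_)
        refine add_le_add_left (le_trans ?_ hr) _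
        rw [mul_comm D]
        exact mul_le_mul_of_nonneg_left (hDE z hz z' hz') (abs_nonneg _)
      have h3 : 0 < δ * ‖A‖ := by positivity
      refine le_of_mul_le_mul_right (h2.trans (le_of_eq ?_)) h3
      field_simp
      ring
  refine ⟨ω * δ * d ^ N / M, by positivity, fun r hr hr0 z hz ↦ ?_⟩
  obtain ⟨i, hi⟩ := hE.exists_code hz
  -- Take the first cylinder around `z` of thickness at most `r`. If its level is `N`, it is long
  -- because `r < r₀`; otherwise the previous level was thicker than `r`, so domination makes this
  -- one longer than `M * r`.
  set P : ℕ → Prop := fun n ↦ N ≤ n ∧ D * |planeDet (Φ.wordLin (wordPrefix i n))| ≤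
    r * (δ * ‖Φ.wordLin (wordPrefix i n)‖) with hP
  have hex : ∃ n, P n := by
    have h1 := (tendsto_pow_atTop_nhds_zero_of_lt_one hρ0.le hρ1).const_mul D
    rw [mul_zero] at h1
    obtain ⟨n, hn1, hn2⟩ := ((eventually_ge_atTop N).and
      (h1.eventually (ge_mem_nhds (show 0 < r * δ by positivity)))).exists
    refine ⟨n, hn1, ?_⟩
    have hw : n₀ ≤ (wordPrefix i n).length := by rw [length_wordPrefix]; omega
    have h2 := Φ.norm_wordLin_le hρ0.le hρ (wordPrefix i n)
    rw [length_wordPrefix] at h2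
    have h3 := hdet _ hw
    have h4 := hApos (wordPrefix i n)
    calc D * |planeDet (Φ.wordLin (wordPrefix i n))|
        ≤ D * (ρ ^ n * ‖Φ.wordLin (wordPrefix i n)‖) := by
          gcongr
          refine h3.trans ?_
          rw [pow_two]
          gcongr
      _ = (D * ρ ^ n) * ‖Φ.wordLin (wordPrefix i n)‖ := by ring
      _ ≤ (r * δ) * ‖Φ.wordLin (wordPrefix i n)‖ := by gcongr
      _ = _ := by ring
  classical
  obtain ⟨hn1, hn2⟩ := Nat.find_spec hex
  set n := Nat.find hex with hn
  refine ⟨_, hsheet (wordPrefix i n) (by rw [length_wordPrefix]; omega) r _ hn2 ?_, hi n⟩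
  rcases hn1.eq_or_lt with h | h
  · have h1 := (hdw (wordPrefix i n)).trans (hdet _ (by rw [length_wordPrefix]; omega))
    rw [length_wordPrefix, ← h] at h1
    rw [lt_div_iff₀ hM] at hr0
    have h2 : ‖Φ.wordLin (wordPrefix i N)‖ ^ 2 ≤ ‖Φ.wordLin (wordPrefix i N)‖ := by
      rw [pow_two]; exact mul_le_of_le_one_left (norm_nonneg _) (hA1 _)
    rw [← h]
    calc M * r ≤ ω * δ * d ^ N := by linarith
      _ ≤ ω * δ * ‖Φ.wordLin (wordPrefix i N)‖ := by gcongr; linarith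
      _ = _ := by ring
  · obtain ⟨k, hk⟩ : ∃ k, n = k + 1 := ⟨n - 1, by omega⟩
    have h1 : ¬ P k := Nat.find_min hex (by omega)
    have h2 : r * (δ * ‖Φ.wordLin (wordPrefix i k)‖) <
        D * |planeDet (Φ.wordLin (wordPrefix i k))| := by
      by_contra! h'
      exact h1 ⟨by omega, h'⟩
    have h3 := H.ratio (wordPrefix i n) (by rw [length_wordPrefix]; omega)
    rw [length_wordPrefix] at h3
    set A := Φ.wordLin (wordPrefix i n) with hA
    have h4 : A = Φ.wordLin (wordPrefix i k) * Φ.lin (i k) := by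
      rw [hA, hk, wordPrefix_succ, wordLin_append, wordLin_singleton]
    set B := Φ.wordLin (wordPrefix i k)
    have hAn : ‖A‖ ≤ ‖B‖ := by
      rw [h4]
      exact (norm_mul_le _ _).trans
        (mul_le_of_le_one_right (norm_nonneg _) ((hρ _).trans hρ1.le))
    have hAp : 0 < ‖A‖ := hApos _
    have h5 : r * δ * ‖A‖ * d ≤ D * |planeDet A| := by
      rw [h4, planeDet_mul, abs_mul, ← h4]
      calc r * δ * ‖A‖ * d ≤ r * δ * ‖B‖ * d := by gcongr
        _ = (r * (δ * ‖B‖)) * d := by ring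
        _ ≤ (D * |planeDet B|) * |planeDet (Φ.lin (i k))| :=
          mul_le_mul h2.le (hd _) hd0.le (by positivity)
        _ = _ := by ring
    have h6 := hn₃ n (by omega)
    have h7 : r * δ * d ≤ D * q ^ n * ‖A‖ := by
      refine le_of_mul_le_mul_right ?_ hAp
      calc r * δ * d * ‖A‖ = r * δ * ‖A‖ * d := by ring
        _ ≤ D * |planeDet A| := h5
        _ ≤ D * (q ^ n * ‖A‖ ^ 2) := by gcongr
        _ = _ := by ring
    have h8 : 0 < δ * d := by positivity
    refine le_of_mul_le_mul_right ?_ h8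
    calc M * r * (δ * d) = M * (r * δ * d) := by ring
      _ ≤ M * (D * q ^ n * ‖A‖) := by gcongr
      _ = (M * D * q ^ n) * ‖A‖ := by ring
      _ ≤ (ω * δ ^ 2 * d) * ‖A‖ := by gcongr
      _ = _ := by ring

/-! ### Visible parts in arbitrary directions -/

/-- The positivity of `c` matters: visibility concerns half lines, so the sign of the determinant
has to be corrected. -/
lemma exists_preimage_direction {e : Plane} (he : ‖e‖ = 1) {A : Plane →L[ℝ] Plane}
    (hA : planeDet A ≠ 0) : ∃ f : Plane, ‖f‖ = 1 ∧ (∃ c : ℝ, 0 < c ∧ A f = c • e) ∧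
      Submodule.span ℝ {f} = Submodule.span ℝ {planeAdj A e} := by
  have he0 : e ≠ 0 := by rintro rfl; simp at he
  have hg : 0 < ‖planeAdj A e‖ := norm_pos_iff.2 (planeAdj_ne_zero hA he0)
  have hd := abs_pos.2 hA
  refine ⟨((planeDet A)⁻¹ * |planeDet A| * ‖planeAdj A e‖⁻¹) • planeAdj A e, ?_,
    ⟨|planeDet A| * ‖planeAdj A e‖⁻¹, by positivity, ?_⟩, ?_⟩
  · rw [norm_smul, norm_mul, norm_mul, norm_inv, norm_inv, norm_norm, Real.norm_eq_abs,
      Real.norm_eq_abs, abs_abs, inv_mul_cancel₀ hd.ne', one_mul, inv_mul_cancel₀ hg.ne']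
  · rw [map_smul, map_planeAdj, smul_smul]
    congr 1
    field_simp
  · exact Submodule.span_singleton_smul_eq (IsUnit.mk0 _ (by positivity)) _

lemma mem_visiblePart_of_wordMap (hE : Φ.IsSelfAffineSet E) {e f : Plane} (he : ‖e‖ = 1)
    {w : List (Fin κ)} {c : ℝ} (hc : 0 < c) (hf : Φ.wordLin w f = c • e) {y : Plane} (hy : y ∈ E)
    (h : Φ.wordMap w y ∈ visiblePart e E) : y ∈ visiblePart f E := by
  rw [visiblePart, Set.mem_ofPred_eq] at h ⊢
  refine Set.eq_singleton_iff_unique_mem.2 ⟨⟨⟨0, le_rfl, by simp⟩, hy⟩, ?_⟩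
  rintro _ ⟨⟨t, ht, rfl⟩, hz⟩
  have h1 : Φ.wordMap w (y + t • f) = Φ.wordMap w y + (t * c) • e := by
    have := Φ.wordMap_sub w (y + t • f) y
    rw [add_sub_cancel_left, map_smul, hf, smul_smul] at this
    rw [← this]; abel
  have h2 := (Set.eq_singleton_iff_unique_mem.1 h).2 (Φ.wordMap w (y + t • f))
    ⟨⟨t * c, by positivity, h1⟩, hE.wordMap_mem w hz⟩
  rw [h1, add_eq_left, smul_eq_zero] at h2
  rcases h2 with h2 | h2
  · rcases mul_eq_zero.1 h2 with h3 | h3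
    · simp [h3]
    · exact absurd h3 hc.ne'
  · simp [h2] at he

lemma dimH_image_wordMap_le (Φ : AffineIFS κ) (w : List (Fin κ)) (S : Set Plane) :
    dimH (Φ.wordMap w '' S) ≤ dimH S := by
  have : LipschitzWith ‖Φ.wordLin w‖₊ (Φ.wordMap w) := by
    refine LipschitzWith.of_dist_le_mul fun x y ↦ ?_
    rw [dist_eq_norm, dist_eq_norm, wordMap_sub]
    exact (Φ.wordLin w).le_opNorm _
  exact this.dimH_image_le S

/-- Off the exceptional set of codes with limit orientation `⟨e⟩`, a visible point is pulled back by
a word `w` to a direction that is not a limit orientation, and countable stability of the dimension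
applies. -/
theorem dimH_visiblePart_le (hE : Φ.IsSelfAffineSet E) (hdom : Φ.Dominated)
    (hproj : Φ.ProjectionCondition E) {e : Plane} (he : ‖e‖ = 1)
    (hdim : dimH {x : Plane | ∃ i : ℕ → Fin κ,
        Φ.IsLimitOrientation i (Submodule.span ℝ {e}) ∧ Φ.IsCodedBy E i x} ≤ 1) :
    dimH (visiblePart e E) ≤ 1 := by
  have hsub : visiblePart e E ⊆ E := fun x hx ↦ mem_of_mem_visiblePart hx
  by_cases hline : ∃ x v : Plane, E ⊆ {y | ∃ t : ℝ, y = x + t • v}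
  · obtain ⟨x, v, h⟩ := hline
    exact dimH_le_one_of_subset_line (hsub.trans h)
  have he0 : e ≠ 0 := by rintro rfl; simp at he
  obtain ⟨q, C, n₀, U, H⟩ := hdom.exists_hasOrientations
  choose f hf1 hf2 hf3 using fun w : List (Fin κ) ↦
    exists_preimage_direction he (Φ.planeDet_wordLin_ne_zero w)
  set G : Set (List (Fin κ)) := {w | Submodule.span ℝ {f w} ∉ Φ.limitOrientations} with hG
  have hcover : visiblePart e E ⊆ {x : Plane | ∃ i : ℕ → Fin κ,
      Φ.IsLimitOrientation i (Submodule.span ℝ {e}) ∧ Φ.IsCodedBy E i x} ∪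
      ⋃ w : G, Φ.wordMap w '' visiblePart (f w) E := by
    intro x hx
    obtain ⟨i, hi⟩ := hE.exists_code (hsub hx)
    by_cases hlim : Φ.IsLimitOrientation i (Submodule.span ℝ {e})
    · exact Or.inl ⟨i, hlim, Set.mem_iInter.2 hi⟩
    right
    -- Extensions of this prefix turn by at most `C * q ^ n`, so all of their orientations stay away
    -- from `e`.
    obtain ⟨n, hn, hnU⟩ : ∃ n, n₀ ≤ n ∧ 2 * (C * q ^ n) < |area (U (wordPrefix i n)) e| := by
      by_contra! hcon
      refine hlim ((H.isLimitOrientation_iff he0 i).2 ?_)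
      have h1 : Tendsto (fun n ↦ 2 * (C * q ^ n)) atTop (𝓝 0) := by
        simpa using ((tendsto_pow_atTop_nhds_zero_of_lt_one H.pos.le H.lt_one).const_mul
          C).const_mul 2
      refine squeeze_zero' (Eventually.of_forall fun _ ↦ abs_nonneg _) ?_ h1
      filter_upwards [eventually_ge_atTop n₀] with n hn using hcon n hn
    have hwlen := length_wordPrefix i n
    obtain ⟨y, hy, hyx⟩ := hi n
    set w := wordPrefix i n with hw
    have hdet := Φ.planeDet_wordLin_ne_zero w
    have hq : 0 ≤ C * q ^ n := mul_nonneg H.nonneg (pow_nonneg H.pos.le _)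
    have hwG : w ∈ G := by
      rw [hG, Set.mem_ofPred_eq, hf3]
      have hδ : 0 < |planeDet (Φ.wordLin w)| * (|area (U w) e| - C * q ^ n) :=
        mul_pos (abs_pos.2 hdet) (by linarith)
      refine H.notMem_of_forall_le (planeAdj_ne_zero hdet he0) hδ (w := w) fun v ↦ ?_
      rw [map_planeAdj, area_smul_right, abs_mul]
      refine mul_le_mul_of_nonneg_left ?_ (abs_nonneg _)
      have hw' : n₀ ≤ w.length := by omega
      have hwv : n₀ ≤ (w ++ v).length := by simp; omega
      have h1 := H.cauchy w v hw'
      rw [hwlen] at h1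
      have h2 := abs_area_triangle (H.norm_eq hw') (H.norm_eq hwv) he
      linarith
    obtain ⟨c, hc, hce⟩ := hf2 w
    refine Set.mem_iUnion.2 ⟨⟨w, hwG⟩, y, ?_, hyx⟩
    exact mem_visiblePart_of_wordMap hE he hc hce hy (by rwa [hyx])
  refine (dimH_mono hcover).trans ?_
  rw [dimH_union, dimH_iUnion]
  refine max_le hdim (iSup_le fun w ↦ (Φ.dimH_image_wordMap_le _ _).trans ?_)
  exact dimH_visiblePart_le_one_of_notMem hE hdom hproj hline (hf1 w) w.2

end AffineIFS

/-! ### Linear maps that preserve a direction -/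

/-- The eigenvalue of `A` at `e`, when the unit vector `e` is an eigenvector of `A`. -/
noncomputable def diagFst (e : Plane) (A : Plane →L[ℝ] Plane) : ℝ := inner ℝ e (A e)

/-- The off-diagonal entry of `A` in the basis `e`, `quarterTurn e`. -/
noncomputable def offDiag (e : Plane) (A : Plane →L[ℝ] Plane) : ℝ := inner ℝ e (A (quarterTurn e))

/-- The second diagonal entry of `A` in the basis `e`, `quarterTurn e`. -/
noncomputable def diagSnd (e : Plane) (A : Plane →L[ℝ] Plane) : ℝ := area e (A (quarterTurn e))

/-- The functional with value `1` at `e` and `-s` at `quarterTurn e`. -/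
noncomputable def shear (e : Plane) (s : ℝ) (z : Plane) : ℝ := inner ℝ e z - s * area e z

/-- The action of `A` on the slopes of the functionals `shear e s`. -/
noncomputable def slopeMap (e : Plane) (A : Plane →L[ℝ] Plane) (s : ℝ) : ℝ :=
  (s * diagSnd e A - offDiag e A) / diagFst e A

lemma shear_add (e : Plane) (s : ℝ) (x y : Plane) :
    shear e s (x + y) = shear e s x + shear e s y := by
  simp only [shear, inner_add_right, area_add_right]; ring

lemma continuous_shear (e : Plane) (s : ℝ) : Continuous (shear e s) := by
  have : Continuous fun z ↦ area e z := continuous_area e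
  unfold shear
  fun_prop

/-- The functionals `shear e s` are, up to scalars, the projections along all directions other than
`⟨e⟩`. -/
lemma shear_eq_area {e : Plane} (he : ‖e‖ = 1) (s : ℝ) (z : Plane) :
    shear e s z = area (-quarterTurn e - s • e) z := by
  have h1 : area (quarterTurn e) z = - inner ℝ e z := by
    conv_lhs => rw [Plane.decomp he z]
    rw [area_add_right, area_smul_right, area_smul_right, area_self, area_comm, area_quarterTurn,
      he]
    ring
  have h2 : area (-quarterTurn e) z = inner ℝ e z := by
    rw [← neg_one_smul ℝ (quarterTurn e), area_smul_left, h1]; ring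
  rw [area_sub_left, area_smul_left, h2, shear]

section Triangular

variable {e : Plane} {A B : Plane →L[ℝ] Plane}

lemma map_eq_diagFst_smul (he : ‖e‖ = 1) (hA : area e (A e) = 0) : A e = diagFst e A • e := by
  conv_lhs => rw [Plane.decomp he (A e), hA, zero_smul, add_zero]
  rfl

lemma map_eq_of_decomp (he : ‖e‖ = 1) (z : Plane) :
    A z = inner ℝ e z • A e + area e z • A (quarterTurn e) := by
  conv_lhs => rw [Plane.decomp he z, map_add, map_smul, map_smul]

lemma area_map_eq_diagSnd_mul (he : ‖e‖ = 1) (hA : area e (A e) = 0) (z : Plane) :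
    area e (A z) = diagSnd e A * area e z := by
  rw [map_eq_of_decomp he z, area_add_right, area_smul_right, area_smul_right, hA, diagSnd]; ring

lemma inner_map_eq (he : ‖e‖ = 1) (z : Plane) :
    inner ℝ e (A z) = diagFst e A * inner ℝ e z + offDiag e A * area e z := by
  rw [map_eq_of_decomp he z, inner_add_right, real_inner_smul_right, real_inner_smul_right,
    diagFst, offDiag]
  ring

lemma planeDet_eq_mul (he : ‖e‖ = 1) (hA : area e (A e) = 0) :
    planeDet A = diagFst e A * diagSnd e A := by
  have h := area_map A e (quarterTurn e)
  rw [area_quarterTurn, he, map_eq_diagFst_smul he hA, area_smul_left] at h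
  rw [diagSnd, h]; ring

lemma shear_map (he : ‖e‖ = 1) (hA : area e (A e) = 0) (hd : diagFst e A ≠ 0) (s : ℝ) (z : Plane) :
    shear e s (A z) = diagFst e A * shear e (slopeMap e A s) z := by
  rw [shear, shear, inner_map_eq he, area_map_eq_diagSnd_mul he hA, slopeMap]
  field_simp
  ring

lemma diagFst_mul (he : ‖e‖ = 1) (hB : area e (B e) = 0) :
    diagFst e (A * B) = diagFst e A * diagFst e B := by
  rw [diagFst, mul_apply_eq_comp, map_eq_diagFst_smul he hB, map_smul,
    real_inner_smul_right, mul_comm, ← diagFst]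

lemma diagSnd_mul (he : ‖e‖ = 1) (hA : area e (A e) = 0) :
    diagSnd e (A * B) = diagSnd e A * diagSnd e B := by
  rw [diagSnd, mul_apply_eq_comp, area_map_eq_diagSnd_mul he hA, ← diagSnd]

lemma offDiag_mul (he : ‖e‖ = 1) :
    offDiag e (A * B) = diagFst e A * offDiag e B + offDiag e A * diagSnd e B := by
  rw [offDiag, mul_apply_eq_comp, inner_map_eq he, ← offDiag, ← diagSnd]

lemma slopeMap_mul (he : ‖e‖ = 1) (hA : area e (A e) = 0) (hB : area e (B e) = 0)
    (hdA : diagFst e A ≠ 0) (hdB : diagFst e B ≠ 0) (s : ℝ) :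
    slopeMap e (A * B) s = slopeMap e B (slopeMap e A s) := by
  simp only [slopeMap, diagFst_mul he hB, diagSnd_mul he hA, offDiag_mul he]
  field_simp
  ring

lemma slopeMap_one {e : Plane} (he : ‖e‖ = 1) (s : ℝ) : slopeMap e 1 s = s := by
  have h : inner ℝ e (quarterTurn e) = 0 := by simp [Plane.inner_eq, quarterTurn]; ring
  simp [slopeMap, diagFst, diagSnd, offDiag, area_quarterTurn, he, h]

end Triangular

/-- An interval of length at least two mesh sizes contains the cell that starts at the first grid
point from `y` on. -/
lemma exists_grid_cell {l h y y' θ : ℝ} {N : ℕ} (hh : 0 < h) (hN : 2 ≤ N * θ) (hl : l ≤ y)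
    (hy : y + θ * h ≤ y') (hr : y' ≤ l + h) (hN0 : 0 < N) :
    ∃ m : Fin N, Set.Icc (l + m * (h / N)) (l + m * (h / N) + h / N) ⊆ Set.Icc y y' := by
  have hNr : (0 : ℝ) < N := by exact_mod_cast hN0
  set x := (y - l) / (h / N) with hx
  have hhN : 0 < h / N := by positivity
  have hx0 : 0 ≤ x := div_nonneg (by linarith) hhN.le
  have hxe : x * (h / N) = y - l := div_mul_cancel₀ _ hhN.ne'
  have h1 : x ≤ ⌈x⌉₊ := Nat.le_ceil x
  have h2 : (⌈x⌉₊ : ℝ) < x + 1 := Nat.ceil_lt_add_one hx0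
  have h3 : 2 * (h / N) ≤ θ * h := by
    rw [← mul_div_assoc, div_le_iff₀ hNr]
    nlinarith
  have h4 := mul_le_mul_of_nonneg_right h1 hhN.le
  have h5 := mul_lt_mul_of_pos_right h2 hhN
  have h6 : ((⌈x⌉₊ : ℝ) + 1) * (h / N) < N * (h / N) + h / N := by
    rw [mul_div_cancel₀ _ hNr.ne']; linarith
  have h7 : ⌈x⌉₊ < N := by
    have : ((⌈x⌉₊ : ℝ) + 1) < N + 1 := by
      refine lt_of_mul_lt_mul_right (h6.trans_le (le_of_eq ?_)) hhN.le
      ring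
    have h8 : (⌈x⌉₊ : ℝ) < N := by linarith
    exact_mod_cast h8
  refine ⟨⟨_, h7⟩, Set.Icc_subset_Icc ?_ ?_⟩
  · simp only; linarith
  · simp only; linarith

/-! ### Triangular systems and the action on slopes -/

namespace AffineIFS

variable {κ : ℕ} {Φ : AffineIFS κ} {E : Set Plane}

/-- All the linear parts are upper triangular in the basis `e`, `quarterTurn e`, and the direction
`e` is the less contracted one. -/
structure IsTriangular (Φ : AffineIFS κ) (e : Plane) : Prop where
  norm_eq : ‖e‖ = 1
  area_lin : ∀ j, area e (Φ.lin j e) = 0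
  lt : ∀ j, |diagSnd e (Φ.lin j)| < |diagFst e (Φ.lin j)|

lemma area_wordLin_of_lin {e : Plane} (he : ‖e‖ = 1) (hev : ∀ j, area e (Φ.lin j e) = 0)
    (w : List (Fin κ)) : area e (Φ.wordLin w e) = 0 := by
  induction w with
  | nil => simp
  | cons i w ih =>
    rw [wordLin_cons, mul_apply_eq_comp, area_map_eq_diagSnd_mul he (hev i), ih,
      mul_zero]

/-- The set of slopes for which all the cylinders project onto non-trivial intervals. -/
def intervalSlopes (Φ : AffineIFS κ) (e : Plane) (E : Set Plane) : Set ℝ :=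
  {s | ∀ w, Convex ℝ (shear e s '' (Φ.wordMap w '' E)) ∧
    (shear e s '' (Φ.wordMap w '' E)).Nontrivial}

namespace IsTriangular

variable {e : Plane}

lemma area_wordLin (H : Φ.IsTriangular e) (w : List (Fin κ)) : area e (Φ.wordLin w e) = 0 :=
  area_wordLin_of_lin H.norm_eq H.area_lin w

lemma diag_ne_zero (H : Φ.IsTriangular e) (w : List (Fin κ)) :
    diagFst e (Φ.wordLin w) ≠ 0 ∧ diagSnd e (Φ.wordLin w) ≠ 0 := by
  have h := Φ.planeDet_wordLin_ne_zero w
  rw [planeDet_eq_mul H.norm_eq (H.area_wordLin w)] at h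
  exact mul_ne_zero_iff.1 h

lemma diagFst_append (H : Φ.IsTriangular e) (w v : List (Fin κ)) :
    diagFst e (Φ.wordLin (w ++ v)) = diagFst e (Φ.wordLin w) * diagFst e (Φ.wordLin v) := by
  rw [wordLin_append, diagFst_mul H.norm_eq (H.area_wordLin v)]

lemma diagSnd_append (H : Φ.IsTriangular e) (w v : List (Fin κ)) :
    diagSnd e (Φ.wordLin (w ++ v)) = diagSnd e (Φ.wordLin w) * diagSnd e (Φ.wordLin v) := by
  rw [wordLin_append, diagSnd_mul H.norm_eq (H.area_wordLin w)]

lemma slopeMap_append (H : Φ.IsTriangular e) (w v : List (Fin κ)) (s : ℝ) :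
    slopeMap e (Φ.wordLin (w ++ v)) s =
      slopeMap e (Φ.wordLin v) (slopeMap e (Φ.wordLin w) s) := by
  rw [wordLin_append, slopeMap_mul H.norm_eq (H.area_wordLin w) (H.area_wordLin v)
    (H.diag_ne_zero w).1 (H.diag_ne_zero v).1]

lemma shear_wordMap (H : Φ.IsTriangular e) (w : List (Fin κ)) (s : ℝ) (z : Plane) :
    shear e s (Φ.wordMap w z) = diagFst e (Φ.wordLin w) *
      shear e (slopeMap e (Φ.wordLin w) s) z + shear e s (Φ.wordMap w 0) := by
  rw [wordMap_eq, shear_add, shear_map H.norm_eq (H.area_wordLin w) (H.diag_ne_zero w).1]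

lemma area_wordMap_sub (H : Φ.IsTriangular e) (w : List (Fin κ)) (z z' : Plane) :
    area e (Φ.wordMap w z) - area e (Φ.wordMap w z') =
      diagSnd e (Φ.wordLin w) * (area e z - area e z') := by
  rw [← area_sub_right, wordMap_sub, area_map_eq_diagSnd_mul H.norm_eq (H.area_wordLin w),
    area_sub_right]

lemma abs_diagFst_le (H : Φ.IsTriangular e) (w : List (Fin κ)) :
    |diagFst e (Φ.wordLin w)| ≤ ‖Φ.wordLin w‖ := by
  have h := abs_real_inner_le_norm e (Φ.wordLin w e)
  rw [H.norm_eq, one_mul] at h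
  refine h.trans (((Φ.wordLin w).le_opNorm e).trans ?_)
  rw [H.norm_eq, mul_one]

lemma shear_image_append (H : Φ.IsTriangular e) (u w : List (Fin κ)) (s : ℝ) :
    shear e s '' (Φ.wordMap (u ++ w) '' E) =
      (fun t ↦ diagFst e (Φ.wordLin u) * t + shear e s (Φ.wordMap u 0)) ''
        (shear e (slopeMap e (Φ.wordLin u) s) '' (Φ.wordMap w '' E)) := by
  rw [wordMap_append]
  simp only [Set.image_image, Function.comp_apply]
  exact Set.image_congr fun z _ ↦ H.shear_wordMap u s _

/-- The two projections differ by an invertible affine map of the line: `A_u` carries the functional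
of slope `s` to a multiple of the one of slope `slopeMap e (Φ.wordLin u) s`. -/
lemma convex_iff (H : Φ.IsTriangular e) (u w : List (Fin κ)) (s : ℝ) :
    (Convex ℝ (shear e s '' (Φ.wordMap (u ++ w) '' E)) ∧
      (shear e s '' (Φ.wordMap (u ++ w) '' E)).Nontrivial) ↔
    (Convex ℝ (shear e (slopeMap e (Φ.wordLin u) s) '' (Φ.wordMap w '' E)) ∧
      (shear e (slopeMap e (Φ.wordLin u) s) '' (Φ.wordMap w '' E)).Nontrivial) := by
  rw [H.shear_image_append]
  set S := shear e (slopeMap e (Φ.wordLin u) s) '' (Φ.wordMap w '' E)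
  set b := shear e s (Φ.wordMap u 0)
  have ha := (H.diag_ne_zero u).1
  set a := diagFst e (Φ.wordLin u)
  have himg : ∀ (a b : ℝ) (S : Set ℝ), Convex ℝ S → Convex ℝ ((fun t ↦ a * t + b) '' S) := by
    intro a b S h
    have h1 := h.affinity b a
    simpa only [smul_eq_mul, add_comm b] using h1
  have hinj : Function.Injective fun t ↦ a * t + b := fun x y h ↦
    mul_left_cancel₀ ha (add_right_cancel h)
  refine and_congr ⟨fun h ↦ ?_, himg a b S⟩ (Set.image_nontrivial hinj)
  have h1 := himg a⁻¹ (-(a⁻¹ * b)) _ h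
  rw [Set.image_image] at h1
  convert h1
  rw [Set.image_congr (g := id), Set.image_id]
  intro t _
  simp only [id]
  field_simp
  ring

lemma slopeMap_mem (H : Φ.IsTriangular e) {s : ℝ} (hs : s ∈ Φ.intervalSlopes e E)
    (u : List (Fin κ)) : slopeMap e (Φ.wordLin u) s ∈ Φ.intervalSlopes e E :=
  fun w ↦ (H.convex_iff u w s).1 (hs (u ++ w))

lemma exists_contraction (H : Φ.IsTriangular e) : ∃ μ : ℝ, 0 ≤ μ ∧ μ < 1 ∧
    ∀ j, |diagSnd e (Φ.lin j)| ≤ μ * |diagFst e (Φ.lin j)| := by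
  rcases isEmpty_or_nonempty (Fin κ) with h | h
  · exact ⟨0, le_rfl, one_pos, fun i ↦ h.elim i⟩
  · obtain ⟨j, hj⟩ := Finite.exists_max fun i ↦ |diagSnd e (Φ.lin i)| / |diagFst e (Φ.lin i)|
    have hpos : ∀ j, 0 < |diagFst e (Φ.lin j)| := fun j ↦ (abs_nonneg _).trans_lt (H.lt j)
    exact ⟨_, by positivity, (div_lt_one (hpos j)).2 (H.lt j),
      fun i ↦ (div_le_iff₀ (hpos i)).1 (hj i)⟩

/-- The slopes of bounded size are preserved by the actions of all words. -/
lemma exists_invariant_bound (H : Φ.IsTriangular e) (s₀ : ℝ) : ∃ R : ℝ, |s₀| ≤ R ∧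
    ∀ (w : List (Fin κ)) (s : ℝ), |s| ≤ R → |slopeMap e (Φ.wordLin w) s| ≤ R := by
  obtain ⟨μ, hμ0, hμ1, hμ⟩ := H.exists_contraction
  have hpos : ∀ j, 0 < |diagFst e (Φ.lin j)| := fun j ↦ (abs_nonneg _).trans_lt (H.lt j)
  obtain ⟨β, hβ⟩ : ∃ β : ℝ, ∀ j, |offDiag e (Φ.lin j)| ≤ β * |diagFst e (Φ.lin j)| := by
    rcases isEmpty_or_nonempty (Fin κ) with h | h
    · exact ⟨0, fun i ↦ h.elim i⟩
    · obtain ⟨j, hj⟩ := Finite.exists_max fun i ↦ |offDiag e (Φ.lin i)| / |diagFst e (Φ.lin i)|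
      exact ⟨_, fun i ↦ (div_le_iff₀ (hpos i)).1 (hj i)⟩
  have hstep : ∀ R, β / (1 - μ) ≤ R → ∀ j s, |s| ≤ R → |slopeMap e (Φ.lin j) s| ≤ R := by
    intro R hR j s hs
    rw [div_le_iff₀ (by linarith)] at hR
    rw [slopeMap, abs_div, div_le_iff₀ (hpos j)]
    calc |s * diagSnd e (Φ.lin j) - offDiag e (Φ.lin j)|
        ≤ |s * diagSnd e (Φ.lin j)| + |offDiag e (Φ.lin j)| := abs_sub _ _
      _ ≤ R * (μ * |diagFst e (Φ.lin j)|) + β * |diagFst e (Φ.lin j)| := by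
          rw [abs_mul]
          exact add_le_add (mul_le_mul hs (hμ j) (abs_nonneg _) ((abs_nonneg _).trans hs)) (hβ j)
      _ = (R * μ + β) * |diagFst e (Φ.lin j)| := by ring
      _ ≤ R * |diagFst e (Φ.lin j)| := by
          refine mul_le_mul_of_nonneg_right ?_ (abs_nonneg _)
          linarith
  refine ⟨max |s₀| (β / (1 - μ)), le_max_left _ _, fun w ↦ ?_⟩
  induction w with
  | nil =>
    intro s hs
    rwa [wordLin_nil, slopeMap_one H.norm_eq]
  | cons i w ih =>
    intro s hs
    have := H.slopeMap_append [i] w s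
    rw [List.singleton_append, wordLin_singleton] at this
    rw [this]
    exact ih _ (hstep _ (le_max_right _ _) i s hs)

/-- Both diagonal entries are multiplicative, so an exponent that works for the letters works for
all words. It bounds the separation of split cylinders from below by a power of their length. -/
lemma exists_pow_le_abs_diagSnd (H : Φ.IsTriangular e) : ∃ k : ℕ, 0 < k ∧
    ∀ w, |diagFst e (Φ.wordLin w)| ^ k ≤ |diagSnd e (Φ.wordLin w)| := by
  have hlt : ∀ j, |diagFst e (Φ.lin j)| < 1 := fun j ↦ by
    have := H.abs_diagFst_le [j]
    rw [wordLin_singleton] at this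
    exact this.trans_lt (Φ.lin_contractive j)
  have hpos : ∀ j, 0 < |diagSnd e (Φ.lin j)| := fun j ↦ by
    have := (H.diag_ne_zero [j]).2
    rw [wordLin_singleton] at this
    exact abs_pos.2 this
  obtain ⟨k, hk⟩ : ∃ k : ℕ, ∀ j, |diagFst e (Φ.lin j)| ^ k ≤ |diagSnd e (Φ.lin j)| := by
    have h : ∀ j, ∀ᶠ k : ℕ in atTop, |diagFst e (Φ.lin j)| ^ k ≤ |diagSnd e (Φ.lin j)| :=
      fun j ↦ (tendsto_pow_atTop_nhds_zero_of_lt_one (abs_nonneg _) (hlt j)).eventually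
        (ge_mem_nhds (hpos j))
    exact (eventually_all.2 h).exists
  refine ⟨k + 1, k.succ_pos, fun w ↦ ?_⟩
  induction w with
  | nil => simp [diagFst, diagSnd, H.norm_eq, area_quarterTurn]
  | cons i w ih =>
    have h1 := H.diagFst_append [i] w
    have h2 := H.diagSnd_append [i] w
    rw [List.singleton_append, wordLin_singleton] at h1 h2
    rw [h1, h2, abs_mul, abs_mul, mul_pow]
    refine mul_le_mul ?_ ih (by positivity) (abs_nonneg _)
    exact (pow_le_pow_of_le_one (abs_nonneg _) (hlt i).le k.le_succ).trans (hk i)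

end IsTriangular

end AffineIFS

/-! ### Gaps and overlapping cylinders -/

lemma exists_gap {S : Set ℝ} (hS : IsClosed S) (hconv : ¬ Convex ℝ S) :
    ∃ y g : ℝ, 0 < g ∧ (∃ t ∈ S, t < y) ∧ (∃ t ∈ S, y < t) ∧ ∀ t ∈ S, g ≤ |t - y| := by
  rw [convex_iff_ordConnected, Set.ordConnected_def] at hconv
  push Not at hconv
  obtain ⟨a, ha, b, hb, hab⟩ := hconv
  obtain ⟨y, ⟨hay, hyb⟩, hy⟩ := Set.not_subset.1 hab
  obtain ⟨g, hg, hball⟩ := Metric.isOpen_iff.1 hS.isOpen_compl y hy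
  refine ⟨y, g, hg, ⟨a, ha, lt_of_le_of_ne hay ?_⟩, ⟨b, hb, lt_of_le_of_ne hyb ?_⟩, fun t ht ↦ ?_⟩
  · rintro rfl; exact hy ha
  · rintro rfl; exact hy hb
  · by_contra! h
    exact hball (Metric.mem_ball.2 (by rwa [Real.dist_eq])) ht

namespace AffineIFS

variable {κ : ℕ} {Φ : AffineIFS κ} {E : Set Plane}

lemma IsSelfAffineSet.exists_word (hE : Φ.IsSelfAffineSet E) {x : Plane} (hx : x ∈ E) (n : ℕ) :
    ∃ w : List (Fin κ), w.length = n ∧ x ∈ Φ.wordMap w '' E := by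
  obtain ⟨i, hi⟩ := hE.exists_code hx
  exact ⟨_, length_wordPrefix i n, hi n⟩

lemma IsSelfAffineSet.exists_norm_sub_le (hE : Φ.IsSelfAffineSet E) {ε : ℝ} (hε : 0 < ε) :
    ∃ n : ℕ, ∀ w : List (Fin κ), n ≤ w.length →
      ∀ z ∈ Φ.wordMap w '' E, ∀ z' ∈ Φ.wordMap w '' E, ‖z - z'‖ < ε := by
  obtain ⟨ρ, hρ0, hρ1, hρ⟩ := Φ.exists_norm_lin_le
  obtain ⟨D, hD⟩ := hE.2.1.isBounded.exists_norm_le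
  have h1 := (tendsto_pow_atTop_nhds_zero_of_lt_one hρ0.le hρ1).mul_const (2 * D)
  rw [zero_mul] at h1
  obtain ⟨n, hn⟩ := eventually_atTop.1 (h1.eventually (gt_mem_nhds hε))
  refine ⟨n, fun w hw ↦ ?_⟩
  rintro _ ⟨z, hz, rfl⟩ _ ⟨z', hz', rfl⟩
  rw [wordMap_sub]
  refine lt_of_le_of_lt ?_ (hn _ hw)
  refine ((Φ.wordLin w).le_opNorm _).trans ?_
  refine mul_le_mul (Φ.norm_wordLin_le hρ0.le hρ w) ?_ (norm_nonneg _) (by positivity)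
  have := norm_sub_le z z'
  have := hD z hz
  have := hD z' hz'
  linarith

/-- If the projections along the functional `shear e s` of the parts of `E` below and above a gap
only touched, then a small change of the slope would disconnect the projection of `E`. -/
lemma exists_overlap (hE : Φ.IsSelfAffineSet E) {e : Plane} (he : ‖e‖ = 1) {s : ℝ}
    (hs : s ∈ Φ.intervalSlopes e E)
    (hside : ∀ σ : ℝ, σ ≠ 0 → ∀ η > 0, ∃ ε : ℝ, 0 < ε * σ ∧ |ε| < η ∧
      s + ε ∈ Φ.intervalSlopes e E)
    {y g : ℝ} (hg : 0 < g) (hlow : ∃ z ∈ E, area e z < y) (hhigh : ∃ z ∈ E, y < area e z)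
    (hgap : ∀ z ∈ E, g ≤ |area e z - y|) :
    ∃ (w v : List (Fin κ)) (x x' : ℝ), x < x' ∧ x ∈ shear e s '' (Φ.wordMap w '' E) ∧
      x' ∈ shear e s '' (Φ.wordMap w '' E) ∧ x ∈ shear e s '' (Φ.wordMap v '' E) ∧
      x' ∈ shear e s '' (Φ.wordMap v '' E) ∧
      (∀ z ∈ Φ.wordMap w '' E, area e z ≤ y - g) ∧
      (∀ z ∈ Φ.wordMap v '' E, y + g ≤ area e z) := by
  by_contra hcon
  -- Cylinders of level `n` are too small to cross the gap, so each lies entirely below or above it.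
  obtain ⟨n, hn⟩ := hE.exists_norm_sub_le (show 0 < 2 * g by positivity)
  set I : List (Fin κ) → Set ℝ := fun w ↦ shear e s '' (Φ.wordMap w '' E) with hI
  set low : List (Fin κ) → Prop := fun w ↦ ∀ z ∈ Φ.wordMap w '' E, area e z ≤ y - g with hlo
  set high : List (Fin κ) → Prop := fun w ↦ ∀ z ∈ Φ.wordMap w '' E, y + g ≤ area e z with hhi
  have hsubE : ∀ w : List (Fin κ), Φ.wordMap w '' E ⊆ E := by
    rintro w _ ⟨z, hz, rfl⟩; exact hE.wordMap_mem w hz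
  have hcases : ∀ z ∈ E, area e z ≤ y - g ∨ y + g ≤ area e z := by
    intro z hz
    rcases le_abs.1 (hgap z hz) with h | h
    · right; linarith
    · left; linarith
  have hdich : ∀ w : List (Fin κ), n ≤ w.length → low w ∨ high w := by
    intro w hw
    by_contra! h
    simp only [hlo, hhi] at h
    push Not at h
    obtain ⟨⟨z, hz, hz1⟩, z', hz', hz1'⟩ := h
    have h1 := hn w hw z hz z' hz'
    have h2 := abs_area_sub_le he z z'
    rw [dist_eq_norm] at h2
    have h3 := (hcases z (hsubE w hz)).resolve_left (by linarith)
    have h4 := (hcases z' (hsubE w hz')).resolve_right (by linarith)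
    have h5 := le_abs_self (area e z - area e z')
    linarith
  have hord : ∀ w, (I w).OrdConnected := fun w ↦ (hs w).1.ordConnected
  have hno : ∀ w v, low w → high v → ∀ x ∈ I w, x ∈ I v → ∀ x' ∈ I w, x' ∈ I v → ¬ x < x' :=
    fun w v hw hv x h1 h2 x' h3 h4 hx ↦ hcon ⟨w, v, x, x', hx, h1, h3, h2, h4, hw, hv⟩
  have hno' : ∀ w v, low w → high v → ∀ p ∈ I w, p ∈ I v → ∀ x ∈ I w, ∀ x' ∈ I v,
      ∀ σ : ℝ, 0 < σ * (x - p) → ¬ 0 < σ * (x' - p) := by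
    intro w v hw hv p hpw hpv x hx x' hx' σ h1 h2
    rcases lt_trichotomy σ 0 with hσ | hσ | hσ
    · have h3 : x < p := by nlinarith
      have h4 : x' < p := by nlinarith
      exact hno w v hw hv (max x x') ((hord w).out hx hpw ⟨le_max_left _ _, (max_lt h3 h4).le⟩)
        ((hord v).out hx' hpv ⟨le_max_right _ _, (max_lt h3 h4).le⟩) p hpw hpv (max_lt h3 h4)
    · simp [hσ] at h1
    · have h3 : p < x := by nlinarith
      have h4 : p < x' := by nlinarith
      exact hno w v hw hv p hpw hpv (min x x')
        ((hord w).out hpw hx ⟨(lt_min h3 h4).le, min_le_left _ _⟩)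
        ((hord v).out hpv hx' ⟨(lt_min h3 h4).le, min_le_right _ _⟩) (lt_min h3 h4)
  have hconvE : ∀ t ∈ Φ.intervalSlopes e E, (shear e t '' E).OrdConnected := fun t ht ↦ by
    have := (ht []).1
    rw [wordMap_nil, Set.image_id] at this
    exact this.ordConnected
  -- The projection of `E` is connected and covered by the closed projections of its low and high
  -- parts, so these share a point `p`.
  obtain ⟨p, w, v, hwn, hvn, hw, hv, hpw, hpv⟩ : ∃ p w v, w.length = n ∧ v.length = n ∧
      low w ∧ high v ∧ p ∈ I w ∧ p ∈ I v := by
    have hclosed : ∀ T : Set Plane, IsClosed T → IsClosed (shear e s '' (E ∩ T)) := fun T hT ↦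
      ((hE.2.1.inter_right hT).image (continuous_shear e s)).isClosed
    have h1 : IsClosed {z : Plane | area e z ≤ y} :=
      isClosed_le (continuous_area e) continuous_const
    have h2 : IsClosed {z : Plane | y ≤ area e z} :=
      isClosed_le continuous_const (continuous_area e)
    obtain ⟨z₁, hz₁, hz₁y⟩ := hlow
    obtain ⟨z₂, hz₂, hz₂y⟩ := hhigh
    obtain ⟨p, -, ⟨a, ⟨haE, ha⟩, hap⟩, ⟨b, ⟨hbE, hb⟩, hbp⟩⟩ :=
      isPreconnected_closed_iff.1 (hconvE s hs).isPreconnected _ _ (hclosed _ h1) (hclosed _ h2)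
      (by
        rintro _ ⟨z, hz, rfl⟩
        rcases le_total (area e z) y with h | h
        · exact Or.inl ⟨z, ⟨hz, h⟩, rfl⟩
        · exact Or.inr ⟨z, ⟨hz, h⟩, rfl⟩)
      ⟨_, ⟨z₁, hz₁, rfl⟩, z₁, ⟨hz₁, hz₁y.le⟩, rfl⟩ ⟨_, ⟨z₂, hz₂, rfl⟩, z₂, ⟨hz₂, hz₂y.le⟩, rfl⟩
    rw [Set.mem_ofPred_eq] at ha hb
    obtain ⟨w, hwn, hwa⟩ := hE.exists_word haE n
    obtain ⟨v, hvn, hvb⟩ := hE.exists_word hbE n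
    refine ⟨p, w, v, hwn, hvn, ?_, ?_, ⟨a, hwa, hap⟩, ⟨b, hvb, hbp⟩⟩
    · refine (hdich w hwn.ge).resolve_right fun h ↦ ?_
      have := h a hwa
      linarith
    · refine (hdich v hvn.ge).resolve_left fun h ↦ ?_
      have := h b hvb
      linarith
  obtain ⟨x, hx, hxp⟩ := (hs w).2.exists_ne p
  obtain ⟨x', hx', hxp'⟩ := (hs v).2.exists_ne p
  -- Without an overlap, the low projections through `p` extend to one side of `p` and the high ones
  -- to the other; the sign of `σ` records which.
  obtain ⟨σ, hσ0, hσx, hσx'⟩ : ∃ σ : ℝ, σ ≠ 0 ∧ σ * (x - p) < 0 ∧ 0 < σ * (x' - p) := by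
    have hxp0 : p - x ≠ 0 := sub_ne_zero.2 hxp.symm
    have h1 : (p - x) * (x - p) < 0 := by
      have := sq_pos_of_ne_zero hxp0; nlinarith
    refine ⟨p - x, hxp0, h1, ?_⟩
    by_contra! h
    have h2 : (p - x) * (x' - p) ≠ 0 := mul_ne_zero hxp0 (sub_ne_zero.2 hxp')
    refine hno' w v hw hv p hpw hpv x hx x' hx' (x - p) ?_ ?_
    · have := sq_pos_of_ne_zero hxp0; nlinarith
    · have := lt_of_le_of_ne h h2; linarith
  have hlowside : ∀ u, low u → p ∈ I u → ∀ t ∈ I u, σ * (t - p) ≤ 0 := by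
    intro u hu hpu t ht
    by_contra! h
    exact hno' u v hu hv p hpu hpv t ht x' hx' σ h hσx'
  have hhighside : ∀ u, high u → p ∈ I u → ∀ t ∈ I u, 0 ≤ σ * (t - p) := by
    intro u hu hpu t ht
    by_contra! h
    refine hno' w u hw hu p hpw hpu x hx t ht (-σ) ?_ ?_ <;> linarith
  obtain ⟨η, hη, hηI⟩ : ∃ η > 0, ∀ u : List (Fin κ), u.length = n → p ∉ I u →
      ∀ t ∈ I u, η ≤ |t - p| := by
    have hfin : {u : List (Fin κ) | u.length = n ∧ p ∉ I u}.Finite :=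
      (List.finite_length_eq (Fin κ) n).subset fun u hu ↦ hu.1
    have hcl : IsClosed (⋃ u ∈ {u : List (Fin κ) | u.length = n ∧ p ∉ I u}, I u) :=
      hfin.isClosed_biUnion fun u _ ↦
        ((hE.isCompact_image u).image (continuous_shear e s)).isClosed
    have hp : p ∈ (⋃ u ∈ {u : List (Fin κ) | u.length = n ∧ p ∉ I u}, I u)ᶜ := by
      simp only [Set.mem_compl_iff, Set.mem_iUnion, not_exists]
      exact fun u hu h ↦ hu.2 h
    obtain ⟨η, hη, hball⟩ := Metric.isOpen_iff.1 hcl.isOpen_compl p hp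
    refine ⟨η, hη, fun u hu hpu t ht ↦ ?_⟩
    by_contra! h
    refine hball (Metric.mem_ball.2 (by rwa [Real.dist_eq])) ?_
    exact Set.mem_biUnion (show u ∈ {u : List (Fin κ) | u.length = n ∧ p ∉ I u} from ⟨hu, hpu⟩) ht
  obtain ⟨D, hD, hDE⟩ : ∃ D : ℝ, 0 < D ∧ ∀ z ∈ E, |area e z - y| < D := by
    obtain ⟨D, hD⟩ := hE.2.1.exists_bound_of_continuousOn (f := fun z ↦ area e z - y)
      ((continuous_area e).sub continuous_const).continuousOn
    refine ⟨|D| + 1, by positivity, fun z hz ↦ ?_⟩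
    have := hD z hz
    rw [Real.norm_eq_abs] at this
    have := le_abs_self D
    linarith
  -- A slope change of sign opposite to `σ` pushes the low and high cylinders through `p` strictly
  -- apart, while all other cylinders move by less than their distance `η` from `p`. The value `p -
  -- ε * y` is then missed although both sides of it are attained.
  obtain ⟨ε, hεσ, hεη, hεS⟩ := hside (-σ) (neg_ne_zero.2 hσ0) (η / D) (by positivity)
  have hεσ' : σ * ε < 0 := by linarith
  have hshear : ∀ z, shear e (s + ε) z - (p - ε * y) =
      (shear e s z - p) - ε * (area e z - y) := fun z ↦ by simp only [shear]; ring
  have hneg : ∀ u, low u → p ∈ I u → ∀ z ∈ Φ.wordMap u '' E,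
      σ * (shear e (s + ε) z - (p - ε * y)) < 0 := by
    intro u hu hpu z hz
    have h1 := hlowside u hu hpu _ ⟨z, hz, rfl⟩
    have h2 := hu z hz
    rw [hshear]
    have h3 : 0 < σ * ε * (area e z - y) := mul_pos_of_neg_of_neg hεσ' (by linarith)
    linarith
  have hpos : ∀ u, high u → p ∈ I u → ∀ z ∈ Φ.wordMap u '' E,
      0 < σ * (shear e (s + ε) z - (p - ε * y)) := by
    intro u hu hpu z hz
    have h1 := hhighside u hu hpu _ ⟨z, hz, rfl⟩
    have h2 := hu z hz
    rw [hshear]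
    have h3 : σ * ε * (area e z - y) < 0 := mul_neg_of_neg_of_pos hεσ' (by linarith)
    linarith
  have hmiss : p - ε * y ∉ shear e (s + ε) '' E := by
    rintro ⟨z, hz, hzp⟩
    rw [← sub_eq_zero] at hzp
    obtain ⟨u, hun, hzu⟩ := hE.exists_word hz n
    by_cases hpu : p ∈ I u
    · rcases hdich u hun.ge with h | h
      · have := hneg u h hpu z hzu
        simp [hzp] at this
      · have := hpos u h hpu z hzu
        simp [hzp] at this
    · have h1 := hηI u hun hpu _ ⟨z, hzu, rfl⟩
      rw [hshear] at hzp
      rw [show shear e s z - p = ε * (area e z - y) by linarith, abs_mul] at h1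
      rw [lt_div_iff₀ hD] at hεη
      have h2 := mul_le_mul_of_nonneg_left (hDE z hz).le (abs_nonneg ε)
      linarith
  obtain ⟨z, hz, rfl⟩ := hpw
  obtain ⟨z', hz', hzp'⟩ := hpv
  have h1 := hneg w hw ⟨z, hz, rfl⟩ z hz
  have h2 := hpos v hv ⟨z', hz', hzp'⟩ z' hz'
  have hoc := hconvE _ hεS
  have h3 : shear e (s + ε) z ∈ shear e (s + ε) '' E := ⟨z, hsubE w hz, rfl⟩
  have h4 : shear e (s + ε) z' ∈ shear e (s + ε) '' E := ⟨z', hsubE v hz', rfl⟩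
  rcases lt_or_gt_of_ne hσ0 with h | h
  · exact hmiss (hoc.out h4 h3 ⟨by nlinarith, by nlinarith⟩)
  · exact hmiss (hoc.out h3 h4 ⟨by nlinarith, by nlinarith⟩)

/-! ### Triangular systems with a gap have dimension larger than one -/

namespace IsTriangular

variable {e : Plane}

/-- The action of one letter on slopes is affine with multiplier `diagSnd / diagFst`, of modulus
less than one; `s` is its fixed point. -/
lemma exists_slopeMap_replicate (H : Φ.IsTriangular e) (j : Fin κ) :
    ∃ s ν : ℝ, ν ≠ 0 ∧ |ν| < 1 ∧ ∀ (k : ℕ) (t : ℝ),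
      slopeMap e (Φ.wordLin (List.replicate k j)) t = s + ν ^ k * (t - s) := by
  have hd := H.diag_ne_zero [j]
  rw [wordLin_singleton] at hd
  obtain ⟨ha, hc⟩ := hd
  have hlt := H.lt j
  set a := diagFst e (Φ.lin j)
  set c := diagSnd e (Φ.lin j)
  set b := offDiag e (Φ.lin j) with hb
  have hac : a - c ≠ 0 := by
    intro h
    rw [sub_eq_zero.1 h] at hlt
    exact lt_irrefl _ hlt
  refine ⟨-b / (a - c), c / a, div_ne_zero hc ha, ?_, fun k ↦ ?_⟩
  · rw [abs_div, div_lt_one (abs_pos.2 ha)]; exact hlt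
  · induction k with
    | zero => intro t; simp [slopeMap_one H.norm_eq]
    | succ k ih =>
      intro t
      rw [List.replicate_succ', H.slopeMap_append, ih, wordLin_singleton, slopeMap]
      change ((_ * c - b) / a) = _
      rw [pow_succ]
      generalize (c / a) ^ k = x
      field_simp
      ring

/-- Pulling slopes towards the fixed slope `s` of a letter turns the interval condition for long
words into one for all words, at `s` and at slopes accumulating at `s` from both sides. The
resulting overlap at `s` is transplanted into every cylinder at comparable scale, which gives
`SplitsOverIntervals` for the projection `shear e s`. -/
theorem one_lt_dimH (H : Φ.IsTriangular e) (hE : Φ.IsSelfAffineSet E)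
    (hint : ∀ t : ℝ, ∃ n : ℕ, ∀ w : List (Fin κ), n ≤ w.length →
      Convex ℝ (shear e t '' (Φ.wordMap w '' E)) ∧ (shear e t '' (Φ.wordMap w '' E)).Nontrivial)
    (hconv : ¬ Convex ℝ (area e '' E)) : 1 < dimH E := by
  have he := H.norm_eq
  obtain ⟨j⟩ : Nonempty (Fin κ) := by
    obtain ⟨z, hz⟩ := hE.1
    exact ⟨(hE.exists_letter hz).choose⟩
  obtain ⟨s, ν, hν0, hν1, hT⟩ := H.exists_slopeMap_replicate j
  have hmem : ∀ t, ∃ n, ∀ k, n ≤ k → s + ν ^ k * (t - s) ∈ Φ.intervalSlopes e E := by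
    intro t
    obtain ⟨n, hn⟩ := hint t
    refine ⟨n, fun k hk w ↦ ?_⟩
    rw [← hT]
    exact (H.convex_iff _ w t).1 (hn _ (by simp; omega))
  have hs : s ∈ Φ.intervalSlopes e E := by
    obtain ⟨n, hn⟩ := hmem s
    simpa using hn n le_rfl
  have hpow : Tendsto (fun k ↦ |ν| ^ k) atTop (𝓝 0) :=
    tendsto_pow_atTop_nhds_zero_of_lt_one (abs_nonneg _) hν1
  have hside : ∀ σ : ℝ, σ ≠ 0 → ∀ η > 0, ∃ ε : ℝ, 0 < ε * σ ∧ |ε| < η ∧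
      s + ε ∈ Φ.intervalSlopes e E := by
    intro σ hσ η hη
    obtain ⟨n, hn⟩ := hmem (s + σ)
    have h1 := hpow.mul_const |σ|
    rw [zero_mul] at h1
    obtain ⟨m, hm⟩ := eventually_atTop.1 (h1.eventually (gt_mem_nhds hη))
    -- The even exponent keeps the sign of `σ` when `ν` is negative.
    refine ⟨ν ^ (2 * (n + m)) * σ, ?_, ?_, ?_⟩
    · rw [mul_assoc, pow_mul]
      have := sq_pos_of_ne_zero hσ
      have := sq_pos_of_ne_zero hν0
      rw [← pow_two]
      positivity
    · rw [abs_mul, abs_pow]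
      exact hm _ (by omega)
    · have := hn (2 * (n + m)) (by omega)
      rwa [add_sub_cancel_left] at this
  obtain ⟨y, g, hg, ⟨_, ⟨z₁, hz₁, rfl⟩, hlow⟩, ⟨_, ⟨z₂, hz₂, rfl⟩, hhigh⟩, hgap⟩ :=
    exists_gap (hE.2.1.image (continuous_area e)).isClosed hconv
  obtain ⟨w, v, x, x', hxx, ⟨p, hp, hpx⟩, ⟨p', hp', hpx'⟩, ⟨p₁, hp₁, hpx₁⟩, ⟨p₁', hp₁', hpx₁'⟩,
      hw, hv⟩ := exists_overlap hE he hs hside hg ⟨z₁, hz₁, hlow⟩ ⟨z₂, hz₂, hhigh⟩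
    fun z hz ↦ hgap _ ⟨z, hz, rfl⟩
  have hsubE : ∀ w : List (Fin κ), Φ.wordMap w '' E ⊆ E := by
    rintro w _ ⟨z, hz, rfl⟩; exact hE.wordMap_mem w hz
  obtain ⟨Y, hY, hYE⟩ : ∃ Y : ℝ, 0 < Y ∧ ∀ z ∈ E, ‖z‖ ≤ Y := by
    obtain ⟨D, hD⟩ := hE.2.1.isBounded.exists_norm_le
    exact ⟨|D| + 1, by positivity, fun z hz ↦ (hD z hz).trans (by linarith [le_abs_self D])⟩
  have hareaE : ∀ z ∈ E, |area e z| ≤ Y := fun z hz ↦ by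
    have := abs_area_le e z
    rw [he, one_mul] at this
    exact this.trans (hYE z hz)
  obtain ⟨R, hsR, hR⟩ := H.exists_invariant_bound s
  have hR0 : 0 ≤ R := (abs_nonneg _).trans hsR
  set D := 2 * (1 + R) * Y with hD
  have hD0 : 0 < D := by positivity
  have hshearE : ∀ t, |t| ≤ R → ∀ z ∈ E, |shear e t z| ≤ (1 + R) * Y := by
    intro t ht z hz
    have h1 := abs_real_inner_le_norm e z
    rw [he, one_mul] at h1
    calc |shear e t z| ≤ |inner ℝ e z| + |t * area e z| := abs_sub _ _
      _ ≤ Y + R * Y := by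
          rw [abs_mul]
          exact add_le_add (h1.trans (hYE z hz))
            (mul_le_mul ht (hareaE z hz) (abs_nonneg _) hR0)
      _ = _ := by ring
  have hdiam : ∀ t, |t| ≤ R → ∀ z ∈ E, ∀ z' ∈ E, |shear e t z - shear e t z'| ≤ D := by
    intro t ht z hz z' hz'
    have := abs_sub (shear e t z) (shear e t z')
    have := hshearE t ht z hz
    have := hshearE t ht z' hz'
    rw [hD]
    linarith
  have hsheardist : ∀ u : List (Fin κ), ∀ z ∈ Φ.wordMap u '' E, ∀ z' ∈ Φ.wordMap u '' E,
      |shear e s z - shear e s z'| ≤ |diagFst e (Φ.wordLin u)| * D := by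
    rintro u _ ⟨z, hz, rfl⟩ _ ⟨z', hz', rfl⟩
    rw [H.shear_wordMap u s z, H.shear_wordMap u s z', add_sub_add_right_eq_sub, ← mul_sub,
      abs_mul]
    exact mul_le_mul_of_nonneg_left (hdiam _ (hR u s hsR) z hz z' hz') (abs_nonneg _)
  -- the overlap persists for the slopes close to `s`
  set η := (x' - x) / (3 * Y) with hη
  have hη0 : 0 < η := div_pos (by linarith) (by positivity)
  have hstable : ∀ t ∈ Φ.intervalSlopes e E, |t - s| ≤ η → ∀ u : List (Fin κ),
      ∀ z ∈ Φ.wordMap u '' E, ∀ z' ∈ Φ.wordMap u '' E, shear e s z = x → shear e s z' = x' →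
      Set.Icc (x + (x' - x) / 3) (x' - (x' - x) / 3) ⊆ shear e t '' (Φ.wordMap u '' E) := by
    intro t ht hts u z hz z' hz' hzx hzx'
    have hclose : ∀ z ∈ E, |shear e t z - shear e s z| ≤ (x' - x) / 3 := by
      intro z hz
      have : shear e t z - shear e s z = -((t - s) * area e z) := by simp only [shear]; ring
      rw [this, abs_neg, abs_mul]
      refine (mul_le_mul hts (hareaE z hz) (abs_nonneg _) hη0.le).trans (le_of_eq ?_)
      rw [hη]
      field_simp
    have h1 := abs_le.1 (hclose z (hsubE u hz))
    have h2 := abs_le.1 (hclose z' (hsubE u hz'))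
    rw [hzx] at h1
    rw [hzx'] at h2
    refine (Set.Icc_subset_Icc ?_ ?_).trans ((ht u).1.ordConnected.out ⟨z, hz, rfl⟩ ⟨z', hz', rfl⟩)
      <;> linarith
  -- Appending `k` copies of `j` brings every slope in the invariant range so close to `s` that the
  -- overlap persists.
  obtain ⟨k, hk⟩ : ∃ k : ℕ, |ν| ^ k * (2 * R) ≤ η := by
    have h1 := hpow.mul_const (2 * R)
    rw [zero_mul] at h1
    exact (h1.eventually (ge_mem_nhds hη0)).exists
  obtain ⟨b, hb0, hb⟩ : ∃ b : ℝ, 0 < b ∧ ∀ i, b ≤ |diagFst e (Φ.lin i)| := by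
    have : Nonempty (Fin κ) := ⟨j⟩
    obtain ⟨i, hi⟩ := Finite.exists_min fun i ↦ |diagFst e (Φ.lin i)|
    exact ⟨_, (abs_nonneg _).trans_lt (H.lt i), hi⟩
  set a₁ := |diagFst e (Φ.wordLin (List.replicate k j))| with ha₁
  have ha₁0 : 0 < a₁ := abs_pos.2 (H.diag_ne_zero _).1
  obtain ⟨K, hK0, hK⟩ := H.exists_pow_le_abs_diagSnd
  obtain ⟨ρ, hρ0, hρ1, hρ⟩ := Φ.exists_norm_lin_le
  set β := b * a₁ / (4 * D) with hβ
  have hβ0 : 0 < β := by positivity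
  set θ := β * ((x' - x) / 3) with hθ
  have hθ0 : 0 < θ := mul_pos hβ0 (by linarith)
  obtain ⟨N, hN⟩ := exists_nat_ge (max 2 (2 / θ))
  have hN2 : 2 ≤ N := by exact_mod_cast (le_max_left (2 : ℝ) _).trans hN
  have hNθ : 2 ≤ N * θ := (div_le_iff₀ hθ0).1 ((le_max_right (2 : ℝ) _).trans hN)
  have hsplit : SplitsOverIntervals (Set.range fun u : List (Fin κ) ↦ Φ.wordMap u '' E)
      (shear e s) N K (β ^ K * (2 * g)) := by
    refine ⟨?_, ?_⟩
    · rintro _ ⟨u, rfl⟩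
      exact hE.isCompact_image u
    rintro _ ⟨u, rfl⟩ l h hh hl
    obtain ⟨z₀, hz₀, hz₀m⟩ := hl ⟨(by linarith : l ≤ l + h / 2), by linarith⟩
    obtain ⟨i, hi⟩ := hE.exists_code_append u hz₀
    -- The first subcylinder over the midpoint with projection of length at most `h / 4` stays
    -- inside the interval, and by minimality its length is comparable to `h`.
    have hex : ∃ n, |diagFst e (Φ.wordLin (u ++ wordPrefix i n))| * D ≤ h / 4 := by
      have h1 := (tendsto_pow_atTop_nhds_zero_of_lt_one hρ0.le hρ1).mul_const D
      rw [zero_mul] at h1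
      obtain ⟨n, hn⟩ := (h1.eventually (ge_mem_nhds (show 0 < h / 4 by positivity))).exists
      refine ⟨n, le_trans ?_ hn⟩
      refine mul_le_mul_of_nonneg_right ?_ hD0.le
      refine (H.abs_diagFst_le _).trans ((Φ.norm_wordLin_le hρ0.le hρ _).trans ?_)
      exact pow_le_pow_of_le_one hρ0.le hρ1.le (by simp)
    classical
    have hn1 := Nat.find_spec hex
    obtain ⟨n, hn⟩ : ∃ n, Nat.find hex = n + 1 := by
      refine Nat.exists_eq_succ_of_ne_zero fun h0 ↦ ?_
      rw [h0, wordPrefix_zero, List.append_nil] at hn1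
      obtain ⟨z, hz, hzl⟩ := hl ⟨le_rfl, by linarith⟩
      obtain ⟨z', hz', hzl'⟩ := hl ⟨by linarith, le_rfl⟩
      have h1 := hsheardist u z' hz' z hz
      rw [hzl, hzl', add_sub_cancel_left, abs_of_pos hh] at h1
      linarith
    have hn2 := Nat.find_min hex (m := n) (by omega)
    rw [hn] at hn1
    have hz₀' := hi (n + 1)
    set u₁ := u ++ wordPrefix i (n + 1) with hu₁
    have hdiag : b / (4 * D) * h ≤ |diagFst e (Φ.wordLin u₁)| := by
      rw [hu₁, wordPrefix_succ, ← List.append_assoc, H.diagFst_append, wordLin_singleton, abs_mul]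
      rw [not_le, ← div_lt_iff₀ hD0] at hn2
      calc b / (4 * D) * h = h / 4 / D * b := by field_simp
        _ ≤ _ := mul_le_mul hn2.le (hb _) hb0.le (abs_nonneg _)
    set u₂ := u₁ ++ List.replicate k j with hu₂
    have hdiag₂ : β * h ≤ |diagFst e (Φ.wordLin u₂)| := by
      rw [hu₂, H.diagFst_append, abs_mul, ← ha₁]
      calc β * h = (b / (4 * D) * h) * a₁ := by rw [hβ]; ring
        _ ≤ _ := by gcongr
    set t := slopeMap e (Φ.wordLin u₂) s with ht
    have htS : t ∈ Φ.intervalSlopes e E := H.slopeMap_mem hs u₂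
    have hts : |t - s| ≤ η := by
      rw [ht, hu₂, H.slopeMap_append, hT, add_sub_cancel_left, abs_mul, abs_pow]
      refine le_trans ?_ hk
      refine mul_le_mul_of_nonneg_left ?_ (by positivity)
      have h1 := hR u₁ s hsR
      have h2 := abs_sub (slopeMap e (Φ.wordLin u₁) s) s
      linarith
    have hIw := hstable t htS hts w p hp p' hp' hpx hpx'
    have hIv := hstable t htS hts v p₁ hp₁ p₁' hp₁' hpx₁ hpx₁'
    set A := diagFst e (Φ.wordLin u₂) with hA
    have hA0 : A ≠ 0 := (H.diag_ne_zero u₂).1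
    set r := shear e s (Φ.wordMap u₂ 0) with hr
    obtain ⟨y₁, y₂, hy, hyI⟩ : ∃ y₁ y₂ : ℝ, y₁ + θ * h ≤ y₂ ∧ ∀ q ∈ Set.Icc y₁ y₂,
        (q - r) / A ∈ Set.Icc (x + (x' - x) / 3) (x' - (x' - x) / 3) := by
      have h1 : θ * h ≤ |A| * ((x' - x) / 3) := by
        calc θ * h = β * h * ((x' - x) / 3) := by rw [hθ]; ring
          _ ≤ _ := mul_le_mul_of_nonneg_right hdiag₂ (by linarith)
      rcases lt_or_gt_of_ne hA0 with h0 | h0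
      · refine ⟨A * (x' - (x' - x) / 3) + r, A * (x + (x' - x) / 3) + r, ?_, ?_⟩
        · rw [abs_of_neg h0] at h1; linarith
        · rintro q ⟨hq1, hq2⟩
          constructor
          · rw [le_div_iff_of_neg h0]; linarith
          · rw [div_le_iff_of_neg h0]; linarith
      · refine ⟨A * (x + (x' - x) / 3) + r, A * (x' - (x' - x) / 3) + r, ?_, ?_⟩
        · rw [abs_of_pos h0] at h1; linarith
        · rintro q ⟨hq1, hq2⟩
          constructor
          · rw [le_div_iff₀ h0]; linarith
          · rw [div_le_iff₀ h0]; linarith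
    have himg : ∀ w : List (Fin κ), Set.Icc (x + (x' - x) / 3) (x' - (x' - x) / 3) ⊆
        shear e t '' (Φ.wordMap w '' E) →
        Set.Icc y₁ y₂ ⊆ shear e s '' (Φ.wordMap (u₂ ++ w) '' E) := by
      intro w hw q hq
      rw [H.shear_image_append]
      refine ⟨_, hw (hyI q hq), ?_⟩
      change A * ((q - r) / A) + r = q
      field_simp
      ring
    have hIcc : ∀ q ∈ Set.Icc y₁ y₂, |q - (l + h / 2)| ≤ h / 4 := by
      intro q hq
      obtain ⟨z, hz, rfl⟩ := himg w hIw hq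
      rw [← hz₀m]
      refine (hsheardist u₁ z ?_ z₀ hz₀').trans hn1
      rw [hu₂, List.append_assoc] at hz
      exact hE.image_append_subset u₁ _ hz
    have hy12 : y₁ ≤ y₂ := by
      have : 0 < θ * h := by positivity
      linarith
    have hb1 := abs_le.1 (hIcc y₁ ⟨le_rfl, hy12⟩)
    have hb2 := abs_le.1 (hIcc y₂ ⟨hy12, le_rfl⟩)
    obtain ⟨m, hm⟩ := exists_grid_cell hh hNθ (show l ≤ y₁ by linarith) hy
      (show y₂ ≤ l + h by linarith) (by omega)
    have hsub : ∀ w : List (Fin κ), Φ.wordMap (u₂ ++ w) '' E ⊆ Φ.wordMap u '' E := by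
      intro w
      rw [hu₂, hu₁, List.append_assoc, List.append_assoc]
      exact hE.image_append_subset u _
    refine ⟨m, fun c ↦ bif c then Φ.wordMap (u₂ ++ v) '' E else Φ.wordMap (u₂ ++ w) '' E,
      fun c ↦ ?_, ?_⟩
    · cases c
      · exact ⟨⟨u₂ ++ w, rfl⟩, hsub w, hm.trans (himg w hIw)⟩
      · exact ⟨⟨u₂ ++ v, rfl⟩, hsub v, hm.trans (himg v hIv)⟩
    · intro z hz z' hz'
      simp only [cond_false, cond_true, wordMap_append, Set.image_comp] at hz hz'
      obtain ⟨z, hz, rfl⟩ := hz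
      obtain ⟨z', hz', rfl⟩ := hz'
      refine le_trans ?_ (abs_area_sub_le he _ _)
      rw [H.area_wordMap_sub, abs_mul]
      have h1 : 2 * g ≤ |area e z - area e z'| := by
        have h1 := hw z hz
        have h2 := hv z' hz'
        rw [abs_sub_comm]
        exact (by linarith : 2 * g ≤ area e z' - area e z).trans (le_abs_self _)
      calc β ^ K * (2 * g) * h ^ K = (β * h) ^ K * (2 * g) := by rw [mul_pow]; ring
        _ ≤ |diagSnd e (Φ.wordLin u₂)| * |area e z - area e z'| := by
            refine mul_le_mul ?_ h1 (by positivity) (abs_nonneg _)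
            exact (pow_le_pow_left₀ (by positivity) hdiag₂ K).trans (hK u₂)
  have hG : E ∈ Set.range fun u : List (Fin κ) ↦ Φ.wordMap u '' E := ⟨[], by simp⟩
  have hl := (hs []).1.ordConnected
  obtain ⟨l, hlE, l', hlE', hll⟩ := (hs []).2.exists_lt
  rw [wordMap_nil, Set.image_id] at hl hlE hlE'
  refine hsplit.one_lt_dimH (Λ := 1 + |s|) (by positivity) (fun z z' ↦ ?_) hN2 hK0 (by positivity)
    hG (l := l) (h := l' - l) (by linarith) ?_
  · have h1 := abs_inner_sub_le he z z'
    have h2 := abs_area_sub_le he z z'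
    have h3 : shear e s z - shear e s z' =
        (inner ℝ e z - inner ℝ e z') - s * (area e z - area e z') := by simp only [shear]; ring
    rw [h3]
    refine (abs_sub _ _).trans ?_
    rw [abs_mul, add_mul, one_mul]
    gcongr
  · rw [add_sub_cancel]
    exact hl.out hlE hlE'

end IsTriangular

end AffineIFS

/-! ### Lower bounds -/

/-- By compactness each line parallel to `e` that meets `E` has a last point of `E`, and that point
is visible. -/
lemma area_image_visiblePart {e : Plane} (he : ‖e‖ = 1) {E : Set Plane} (hE : IsCompact E) :
    area e '' visiblePart e E = area e '' E := by
  refine (Set.image_mono fun x hx ↦ mem_of_mem_visiblePart hx).antisymm ?_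
  rintro _ ⟨z, hz, rfl⟩
  have hcl : IsClosed {x : Plane | area e x = area e z} :=
    isClosed_eq (continuous_area e) continuous_const
  have hci : Continuous fun x : Plane ↦ (inner ℝ e x : ℝ) := by fun_prop
  obtain ⟨x, ⟨hxE, hxz⟩, hmax⟩ := (hE.inter_right hcl).exists_isMaxOn ⟨z, hz, rfl⟩ hci.continuousOn
  refine ⟨x, ?_, hxz⟩
  rw [Set.mem_ofPred_eq] at hxz
  rw [visiblePart, Set.mem_ofPred_eq]
  refine Set.eq_singleton_iff_unique_mem.2 ⟨⟨⟨0, le_rfl, by simp⟩, hxE⟩, ?_⟩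
  rintro _ ⟨⟨t, ht, rfl⟩, hy⟩
  have h1 := hmax ⟨hy, by
    rw [Set.mem_ofPred_eq, area_add_right, area_smul_right, area_self, mul_zero, add_zero, hxz]⟩
  change inner ℝ e (x + t • e) ≤ inner ℝ e x at h1
  rw [inner_add_right, real_inner_smul_right, real_inner_self_eq_norm_sq, he] at h1
  have h2 : t = 0 := by linarith
  simp [h2]

lemma dimH_area_image_le {e : Plane} (he : ‖e‖ = 1) (S : Set Plane) :
    dimH (area e '' S) ≤ dimH S := by
  have : LipschitzWith 1 (area e) := LipschitzWith.of_dist_le_mul fun x y ↦ by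
    rw [Real.dist_eq, NNReal.coe_one, one_mul]
    exact abs_area_sub_le he x y
  exact this.dimH_image_le S

lemma one_le_dimH_of_convex {S T : Set ℝ} (hS : Convex ℝ S) (hS' : S.Nontrivial) (h : S ⊆ T) :
    1 ≤ dimH T := by
  obtain ⟨a, ha, b, hb, hab⟩ := hS'.exists_lt
  have h1 : Set.Icc a b ⊆ T := (hS.ordConnected.out ha hb).trans h
  have h2 : (interior (Set.Icc a b)).Nonempty := by
    rw [interior_Icc]; exact Set.nonempty_Ioo.2 hab
  have h3 := Real.dimH_of_nonempty_interior h2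
  rw [Module.finrank_self, Nat.cast_one] at h3
  exact h3.symm.le.trans (dimH_mono h1)

lemma nontrivial_area_image {e : Plane} (he : ‖e‖ = 1) {E : Set Plane} (hE : E.Nonempty)
    (hline : ¬ ∃ x : Plane, E ⊆ {y | ∃ t : ℝ, y = x + t • e}) : (area e '' E).Nontrivial := by
  obtain ⟨x, hx⟩ := hE
  have he0 : e ≠ 0 := by rintro rfl; simp at he
  by_contra hcon
  rw [Set.not_nontrivial_iff] at hcon
  refine hline ⟨x, fun y hy ↦ ?_⟩
  have h1 : area e y = area e x := hcon ⟨y, hy, rfl⟩ ⟨x, hx, rfl⟩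
  obtain ⟨t, ht⟩ := mem_span_of_area_eq_zero he0 (show area e (y - x) = 0 by
    rw [area_sub_right, h1, sub_self])
  exact ⟨t, by rw [← ht]; abel⟩

lemma area_planeAdj_self (A : Plane →L[ℝ] Plane) (e : Plane) :
    area (planeAdj A e) e = area e (A e) := (area_map_right A e e).symm

/-! ### The dimension of the projection along a direction -/

namespace AffineIFS

variable {κ : ℕ} {Φ : AffineIFS κ} {E : Set Plane}

/-- The projection of `φ_w (φ_v E)` along `e` is a translate of the projection of `φ_v E` along
`planeAdj A_w e`, a non-trivial interval for long `v`. -/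
lemma one_le_dimH_area_image_of_notMem (hE : Φ.IsSelfAffineSet E)
    (hproj : Φ.ProjectionCondition E) {e : Plane} (he : ‖e‖ = 1) {w : List (Fin κ)}
    (hw : Submodule.span ℝ {planeAdj (Φ.wordLin w) e} ∉ Φ.limitOrientations) :
    1 ≤ dimH (area e '' E) := by
  have he0 : e ≠ 0 := by rintro rfl; simp at he
  obtain ⟨n, hn⟩ := hproj.exists_convex_area
    (planeAdj_ne_zero (Φ.planeDet_wordLin_ne_zero w) he0) hw
  obtain ⟨z, hz⟩ := hE.1
  obtain ⟨v, hv, -⟩ := hE.exists_word hz n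
  obtain ⟨h1, h2⟩ := hn v hv.ge
  set b := area e (Φ.wordMap w 0)
  refine one_le_dimH_of_convex (h1.translate b) (h2.image (add_right_injective b)) ?_
  rintro _ ⟨_, ⟨_, ⟨z, hz, rfl⟩, rfl⟩, rfl⟩
  refine ⟨Φ.wordMap w (Φ.wordMap v z), hE.wordMap_mem w (hE.wordMap_mem v hz), ?_⟩
  rw [wordMap_eq, area_add_right, area_map_right, add_comm]

namespace HasOrientations

variable {q C : ℝ} {n₀ : ℕ} {U : List (Fin κ) → Plane}

lemma abs_area_le_of_planeAdj_mem (H : Φ.HasOrientations q C n₀ U) {g : Plane} (hg : g ≠ 0)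
    {w : List (Fin κ)} (hw : n₀ ≤ w.length)
    (h : Submodule.span ℝ {planeAdj (Φ.wordLin w) g} ∈ Φ.limitOrientations) :
    |area (U w) g| ≤ C * q ^ w.length * ‖g‖ := by
  have hdet := Φ.planeDet_wordLin_ne_zero w
  have h1 := H.abs_area_le_of_mem (planeAdj_ne_zero hdet hg) h hw
  rw [map_planeAdj, area_smul_right, norm_smul, abs_mul, Real.norm_eq_abs] at h1
  refine le_of_mul_le_mul_left (h1.trans (le_of_eq ?_)) (abs_pos.2 hdet)
  ring

lemma tendsto_pow (H : Φ.HasOrientations q C n₀ U) :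
    Tendsto (fun n ↦ C * q ^ n) atTop (𝓝 0) := by
  simpa using (tendsto_pow_atTop_nhds_zero_of_lt_one H.pos.le H.lt_one).const_mul C

/-- Apply the hypothesis to `j ^ m` and to `j ^ (m + 1)`: both `e` and `A_j⁻¹ e` are exponentially
close to the orientation of `j ^ m`, so they span the same line. -/
lemma area_lin_eq_zero (H : Φ.HasOrientations q C n₀ U) {e : Plane} (he : ‖e‖ = 1)
    (hK : ∀ w, Submodule.span ℝ {planeAdj (Φ.wordLin w) e} ∈ Φ.limitOrientations) (j : Fin κ) :
    area e (Φ.lin j e) = 0 := by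
  have he0 : e ≠ 0 := by rintro rfl; simp at he
  set g := planeAdj (Φ.lin j) e with hg
  have hg0 : g ≠ 0 := planeAdj_ne_zero (planeDet_ne_zero (Φ.lin_bijective j)) he0
  have hle : ∀ m, n₀ ≤ m → |area e g| ≤ (C * q ^ m) * (2 * ‖g‖) := by
    intro m hm
    set w := List.replicate m j with hw
    have hwm : w.length = m := by simp [hw]
    have hw0 : n₀ ≤ w.length := by omega
    have h1 := H.abs_area_le_of_planeAdj_mem he0 hw0 (hK w)
    have h2 := H.abs_area_le_of_planeAdj_mem hg0 hw0 (by
      rw [hg, ← planeAdj_mul, ← wordLin_cons]; exact hK _)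
    have h3 := abs_area_mul_norm_le e (U w) g
    rw [H.norm_eq hw0, he, abs_area_comm e (U w)] at h3
    rw [hwm] at h1 h2
    rw [he] at h1
    have h4 := mul_le_mul_of_nonneg_right h1 (norm_nonneg g)
    linarith
  have hlim := H.tendsto_pow.mul_const (2 * ‖g‖)
  rw [zero_mul] at hlim
  have h0 : |area e g| ≤ 0 := ge_of_tendsto hlim (by
    filter_upwards [eventually_ge_atTop n₀] with m hm using hle m hm)
  have h1 := area_planeAdj_self (Φ.lin j) e
  rw [← hg, area_comm, abs_nonpos_iff.1 h0, neg_zero] at h1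
  exact h1.symm

/-- If the eigenvalue at `e` did not dominate, then along the words `j ^ m` the image of
`quarterTurn e` would retain a normal component of size `|c| ^ m`. Domination aligns that image with
the orientation `u`, which forces the component of `u` along `e` to zero; but `hU` sends its normal
component to zero as well, and `u` is a unit vector. -/
lemma abs_diagSnd_lt (H : Φ.HasOrientations q C n₀ U) {e : Plane} (he : ‖e‖ = 1)
    (hev : ∀ j, area e (Φ.lin j e) = 0)
    (hU : ∀ w, n₀ ≤ w.length → |area (U w) e| ≤ C * q ^ w.length) (j : Fin κ) :
    |diagSnd e (Φ.lin j)| < |diagFst e (Φ.lin j)| := by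
  by_contra! hac
  set a := diagFst e (Φ.lin j) with ha
  set b := offDiag e (Φ.lin j) with hb
  set c := diagSnd e (Φ.lin j) with hc
  have hc0 : 0 < |c| := by
    have h := planeDet_ne_zero (Φ.lin_bijective j)
    rw [planeDet_eq_mul he (hev j)] at h
    exact abs_pos.2 (mul_ne_zero_iff.1 h).2
  set W : ℕ → List (Fin κ) := fun m ↦ List.replicate m j with hW
  have hWs : ∀ m, Φ.wordLin (W (m + 1)) = Φ.lin j * Φ.wordLin (W m) := fun m ↦ by
    simp only [hW, List.replicate_succ, wordLin_cons]
  have hWl : ∀ m, (W m).length = m := fun m ↦ by simp [hW]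
  have hWe := fun m ↦ area_wordLin_of_lin he hev (W m)
  have hWa : ∀ m, diagFst e (Φ.wordLin (W m)) = a ^ m := by
    intro m
    induction m with
    | zero => simp [hW, diagFst, he]
    | succ m ih => rw [hWs, diagFst_mul he (hWe m), ih, pow_succ']
  have hWc : ∀ m, diagSnd e (Φ.wordLin (W m)) = c ^ m := by
    intro m
    induction m with
    | zero => simp [hW, diagSnd, area_quarterTurn, he]
    | succ m ih => rw [hWs, diagSnd_mul he (hev j), ih, pow_succ']
  have hWb : ∀ m : ℕ, |offDiag e (Φ.wordLin (W m))| * |c| ≤ m * |b| * |c| ^ m := by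
    intro m
    induction m with
    | zero =>
      have h : inner ℝ e (quarterTurn e) = 0 := by simp [Plane.inner_eq, quarterTurn]; ring
      simp [hW, offDiag, h]
    | succ m ih =>
      rw [hWs, offDiag_mul he, hWc]
      have h1 := abs_add_le (a * offDiag e (Φ.wordLin (W m))) (b * c ^ m)
      rw [abs_mul, abs_mul, abs_pow] at h1
      calc _ ≤ (|a| * |offDiag e (Φ.wordLin (W m))| + |b| * |c| ^ m) * |c| := by gcongr
        _ = |a| * (|offDiag e (Φ.wordLin (W m))| * |c|) + |b| * |c| ^ (m + 1) := by ring
        _ ≤ |c| * (m * |b| * |c| ^ m) + |b| * |c| ^ (m + 1) := by gcongr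
        _ = _ := by push_cast; ring
  have hq := Real.sqrt_nonneg q
  have hq2 := Real.sq_sqrt H.pos.le
  have hle : ∀ m, n₀ ≤ m →
      |inner ℝ e (U (W m))| ≤ √q ^ m + |b| / |c| * C * (m * q ^ m) := by
    intro m hm
    set A := Φ.wordLin (W m) with hA
    set u := U (W m) with hu
    have hWm : n₀ ≤ (W m).length := by rw [hWl]; exact hm
    have hp := H.principal (W m) hWm
    have hUm := hU (W m) hWm
    rw [← hu, hWl, abs_area_comm] at hUm
    have hr := H.ratio (W m) hWm
    rw [hWl, ← hA] at hr
    have h1 := hp.norm_mul_abs_area_le (quarterTurn e)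
    rw [norm_quarterTurn, he, mul_one, ← hA, ← hu] at h1
    have hA0 : 0 < ‖A‖ := norm_pos_of_det (Φ.planeDet_wordLin_ne_zero _)
    have hdet : |planeDet A| ≤ (|c| ^ m) ^ 2 := by
      rw [hA, planeDet_eq_mul he (hWe m), hWa, hWc, abs_mul, abs_pow, abs_pow, pow_two]
      gcongr
    -- The geometric mean of the domination bound `q ^ m * ‖A‖ ^ 2` and the bound `|c| ^ (2 * m)`.
    have h2 : |planeDet A| ≤ (√q ^ m * |c| ^ m) * ‖A‖ := by
      refine abs_le_of_sq_le_sq' ?_ (by positivity) |>.2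
      calc |planeDet A| ^ 2 = |planeDet A| * |planeDet A| := by ring
        _ ≤ (q ^ m * ‖A‖ ^ 2) * (|c| ^ m) ^ 2 :=
          mul_le_mul hr hdet (abs_nonneg _) (mul_nonneg (pow_nonneg H.pos.le _) (by positivity))
        _ = ((√q ^ m * |c| ^ m) * ‖A‖) ^ 2 := by
          rw [mul_pow, mul_pow, pow_right_comm (√q), hq2]; ring
    have h3 : |area (A (quarterTurn e)) u| ≤ √q ^ m * |c| ^ m := by
      refine le_of_mul_le_mul_left ?_ hA0
      linarith
    have h4 : area (A (quarterTurn e)) u = offDiag e A * area e u + c ^ m * -inner ℝ e u := by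
      have h5 : A (quarterTurn e) = offDiag e A • e + c ^ m • quarterTurn e := by
        rw [Plane.decomp he (A (quarterTurn e)), ← hWc]; rfl
      have h6 : area (quarterTurn e) u = -inner ℝ e u := by
        conv_lhs => rw [Plane.decomp he u]
        rw [area_add_right, area_smul_right, area_smul_right, area_self, area_comm,
          area_quarterTurn, he]
        ring
      rw [h5, area_add_left, area_smul_left, area_smul_left, h6]
    have h5 : |c| ^ m * |inner ℝ e u| ≤ √q ^ m * |c| ^ m + |offDiag e A| * (C * q ^ m) := by
      have h6 : c ^ m * inner ℝ e u = offDiag e A * area e u - area (A (quarterTurn e)) u := by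
        rw [h4]; ring
      calc |c| ^ m * |inner ℝ e u| = |c ^ m * inner ℝ e u| := by rw [abs_mul, abs_pow]
        _ ≤ |offDiag e A * area e u| + |area (A (quarterTurn e)) u| := by
            rw [h6]; exact abs_sub _ _
        _ ≤ |offDiag e A| * (C * q ^ m) + √q ^ m * |c| ^ m := by
            rw [abs_mul]; gcongr
        _ = _ := by ring
    have hCq : 0 ≤ C * q ^ m := mul_nonneg H.nonneg (pow_nonneg H.pos.le _)
    have h6 : |offDiag e A| ≤ m * |b| * |c| ^ m / |c| := (le_div_iff₀ hc0).2 (hWb m)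
    have hcm : 0 < |c| ^ m := by positivity
    refine le_of_mul_le_mul_left (h5.trans ?_) hcm
    calc _ ≤ √q ^ m * |c| ^ m + m * |b| * |c| ^ m / |c| * (C * q ^ m) := by gcongr
      _ = _ := by ring
  have hlim1 : Tendsto (fun m : ℕ ↦ √q ^ m + |b| / |c| * C * (m * q ^ m)) atTop (𝓝 0) := by
    have hsq : √q < 1 := by
      rw [Real.sqrt_lt' one_pos, one_pow]; exact H.lt_one
    have h1 := tendsto_pow_atTop_nhds_zero_of_lt_one hq hsq
    have h2 := (tendsto_self_mul_const_pow_of_lt_one H.pos.le H.lt_one).const_mul (|b| / |c| * C)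
    simpa using h1.add h2
  obtain ⟨m, ⟨hm, h1⟩, h2⟩ := (((eventually_ge_atTop n₀).and
    (hlim1.eventually (gt_mem_nhds (show (0 : ℝ) < 1 / 2 by norm_num)))).and
    (H.tendsto_pow.eventually (gt_mem_nhds (show (0 : ℝ) < 1 / 2 by norm_num)))).exists
  have hWm : n₀ ≤ (W m).length := by rw [hWl]; exact hm
  have h3 := hU (W m) hWm
  rw [hWl, abs_area_comm] at h3
  have h4 := hle m hm
  have h5 := area_sq_add_inner_sq e (U (W m))
  rw [he, H.norm_eq hWm] at h5
  have h6 : |area e (U (W m))| < 1 / 2 := by linarith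
  have h7 : |inner ℝ e (U (W m))| < 1 / 2 := by linarith
  have h8 := sq_lt_sq' (abs_lt.1 h6).1 (abs_lt.1 h6).2
  have h9 := sq_lt_sq' (abs_lt.1 h7).1 (abs_lt.1 h7).2
  norm_num at h5 h8 h9
  linarith

end HasOrientations

/-- Either some preimage of `e` is not a limit orientation and the projection contains an interval,
or the system is triangular with `⟨e⟩` as the limit orientation of every code. Then the dimension
assumption covers all of `E` and excludes a gap. -/
theorem one_le_dimH_area_image (hE : Φ.IsSelfAffineSet E) (hdom : Φ.Dominated)
    (hproj : Φ.ProjectionCondition E) {e : Plane} (he : ‖e‖ = 1)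
    (hdim : dimH {x : Plane | ∃ i : ℕ → Fin κ,
        Φ.IsLimitOrientation i (Submodule.span ℝ {e}) ∧ Φ.IsCodedBy E i x} ≤ 1)
    (hline : ¬ ∃ x : Plane, E ⊆ {y | ∃ t : ℝ, y = x + t • e}) :
    1 ≤ dimH (area e '' E) := by
  by_cases hex : ∃ w, Submodule.span ℝ {planeAdj (Φ.wordLin w) e} ∉ Φ.limitOrientations
  · obtain ⟨w, hw⟩ := hex
    exact one_le_dimH_area_image_of_notMem hE hproj he hw
  push Not at hex
  have he0 : e ≠ 0 := by rintro rfl; simp at he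
  obtain ⟨q, C, n₀, U, H⟩ := hdom.exists_hasOrientations
  have hU : ∀ w, n₀ ≤ w.length → |area (U w) e| ≤ C * q ^ w.length := fun w hw ↦ by
    have := H.abs_area_le_of_planeAdj_mem he0 hw (hex w)
    rwa [he, mul_one] at this
  have hev := H.area_lin_eq_zero he hex
  have hT : Φ.IsTriangular e := ⟨he, hev, H.abs_diagSnd_lt he hev hU⟩
  have hlim : ∀ i : ℕ → Fin κ, Tendsto (fun n ↦ |area (U (wordPrefix i n)) e|) atTop (𝓝 0) := by
    intro i
    refine squeeze_zero' (Eventually.of_forall fun _ ↦ abs_nonneg _) ?_ H.tendsto_pow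
    filter_upwards [eventually_ge_atTop n₀] with n hn
    have := hU (wordPrefix i n) (by rwa [length_wordPrefix])
    rwa [length_wordPrefix] at this
  have hEdim : dimH E ≤ 1 := by
    refine (dimH_mono fun x hx ↦ ?_).trans hdim
    obtain ⟨i, hi⟩ := hE.exists_code hx
    exact ⟨i, (H.isLimitOrientation_iff he0 i).2 (hlim i), Set.mem_iInter.2 hi⟩
  by_cases hconv : Convex ℝ (area e '' E)
  · exact one_le_dimH_of_convex hconv (nontrivial_area_image he hE.1 hline) subset_rfl
  refine absurd (hT.one_lt_dimH hE (fun t ↦ ?_) hconv) (not_lt.2 hEdim)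
  -- This direction is transversal to `e`, while every code has limit orientation `⟨e⟩`; hence the
  -- projection condition applies to it for each `t`.
  set f : Plane := -quarterTurn e - t • e with hf
  have hef : area e f = -1 := by
    rw [hf, ← neg_one_smul ℝ (quarterTurn e), area_sub_right, area_smul_right, area_smul_right,
      area_self, area_quarterTurn, he]
    ring
  have hf0 : f ≠ 0 := by
    intro h
    rw [h, area_zero_right] at hef
    norm_num at hef
  have hfK : Submodule.span ℝ {f} ∉ Φ.limitOrientations := by
    rintro ⟨i, hi⟩
    have h1 := (H.isLimitOrientation_iff hf0 i).1 hi
    have h2 := ((hlim i).mul_const ‖f‖).add h1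
    rw [zero_mul, zero_add] at h2
    have h3 : |area e f| ≤ 0 := by
      refine ge_of_tendsto h2 ?_
      filter_upwards [eventually_ge_atTop n₀] with n hn
      have h4 := abs_area_mul_norm_le e (U (wordPrefix i n)) f
      rwa [H.norm_eq (by rwa [length_wordPrefix]), he, mul_one, mul_one, abs_area_comm e
        (U _)] at h4
    rw [hef] at h3
    norm_num at h3
  obtain ⟨n, hn⟩ := hproj.exists_convex_area hf0 hfK
  have hsh : shear e t = area f := funext fun z ↦ shear_eq_area he t z
  exact ⟨n, fun w hw ↦ by rw [hsh]; exact hn w hw⟩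

end AffineIFS

theorem corollary4p5 {κ : ℕ} (Φ : AffineIFS κ) (E : Set Plane)
    (hE : Φ.IsSelfAffineSet E) (hdom : Φ.Dominated) (hproj : Φ.ProjectionCondition E)
    (hdim : ∀ e : Plane, ‖e‖ = 1 →
      dimH {x : Plane | ∃ i : ℕ → Fin κ,
        Φ.IsLimitOrientation i (Submodule.span ℝ {e}) ∧ Φ.IsCodedBy E i x} ≤ 1)
    (e : Plane) (he : ‖e‖ = 1)
    (hline : ¬ ∃ x : Plane, E ⊆ {y | ∃ t : ℝ, y = x + t • e}) :
    dimH (visiblePart e E) = 1 := by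
  refine (AffineIFS.dimH_visiblePart_le hE hdom hproj he (hdim e he)).antisymm ?_
  calc 1 ≤ dimH (area e '' E) :=
        AffineIFS.one_le_dimH_area_image hE hdom hproj he (hdim e he) hline
    _ = dimH (area e '' visiblePart e E) := by rw [area_image_visiblePart he hE.2.1]
    _ ≤ dimH (visiblePart e E) := dimH_area_image_le he _
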